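/- Let $\xi$ be a random variable with values in $\{0,1,2,\dots\}$ such that $\mathbb E\,\xi=1$ and $0<\operatorname{Var}\xi<\infty$. Let $\mathcal T$ be the Galton–Watson tree with offspring distribution $\xi$, and, for each $n\ge 1$ with $\mathbb P(|\mathcal T|=n)>0$, let $T_n$ be $\mathcal T$ conditioned on having exactly $n$ vertices. For a rooted tree $\tau$ and $k\ge 1$, let $P_k(\tau)$ be the number of unordered pairs of vertices of $\tau$ at graph distance $k$, and put $$f_n(z)=\sum_{k=1}^{\infty}\mathbb E\,[P_k(T_n)]\,z^k .$$ For $0<\beta<\pi/2$ and $\delta>0$ let $$\Delta(\beta,\delta)=\{z\in\mathbb C:\ |z|<1+\delta,\ z\ne 1,\ |\arg(z-1)|>\pi/2-\beta\},$$ where $\arg$ takes values in $(-\pi,\pi]$. Then there exist constants $C>0$, $\beta\in(0,\pi/2)$ and $\delta>0$, depending only on the distribution of $\xi$, such that for every $n\ge1$ with $\mathbb P(|\mathcal T|=n)>0$ the function $f_n$ extends from the open unit disc to an analytic function in $\Delta(\beta,\delta)$, and this extension satisfies $$|f_n(z)|\le C\,n\,|1-z|^{-2}\qquad\text{for all } z\in\Delta(\beta,\delta).$$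 -/

import Mathlib

open MeasureTheory ProbabilityTheory

namespace GaltonWatson

/-- The set of individuals of the family tree in which the individual `v` has `ξ v` children.
Individuals are named by words (Ulam–Harris notation): the root is `[]` and the children of `v`
are `v ++ [i]` with `i < ξ v`. A word belongs to the tree iff every step on the way from the root
to it leads from an individual to one of its children. -/
def familyTree (ξ : List ℕ → ℕ) : Set (List ℕ) :=
  {u | ∀ (v : List ℕ) (i : ℕ), v ++ [i] <+: u → i < ξ v}

/-- The family tree as a graph: the edges join each individual to its children. -/
def familyGraph (ξ : List ℕ → ℕ) : SimpleGraph (familyTree ξ) :=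
  SimpleGraph.fromRel fun v w => ∃ i : ℕ, (w : List ℕ) = (v : List ℕ) ++ [i]

/-- The number of unordered pairs `{v, w}` of vertices at graph distance `k` (used for `k ≥ 1`). -/
noncomputable def pairsAtDist {V : Type*} (G : SimpleGraph V) (k : ℕ) : ℕ :=
  {e : Sym2 V | ∃ v w : V, e = s(v, w) ∧ G.dist v w = k}.ncard

/-- The joint law of the numbers of children: independent, each with distribution `μ`.
The Galton–Watson tree with offspring distribution `μ` is `familyTree ξ` for `ξ` with this law. -/
noncomputable def offspringLaw (μ : Measure ℕ) : Measure (List ℕ → ℕ) :=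
  Measure.infinitePi fun _ : List ℕ => μ

/-- The event that the family tree has exactly `n` vertices. -/
def sizeEvent (n : ℕ) : Set (List ℕ → ℕ) :=
  {ξ | (familyTree ξ).encard = n}

/-- The expectation of the number of unordered pairs of vertices at distance `k` in the
Galton–Watson tree conditioned on having exactly `n` vertices. -/
noncomputable def expectedPairs (μ : Measure ℕ) (n k : ℕ) : ℝ :=
  ∫ ξ, (pairsAtDist (familyGraph ξ) k : ℝ) ∂((offspringLaw μ)[|sizeEvent n])

/-- The domain `Δ(β, δ)`. -/
def deltaDomain (β δ : ℝ) : Set ℂ :=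
  {z | ‖z‖ < 1 + δ ∧ z ≠ 1 ∧ Real.pi / 2 - β < |Complex.arg (z - 1)|}

end GaltonWatson

open Filter Topology

namespace GaltonWatson

/-! Each `f_n` is a polynomial, because distances in a tree with `n` vertices are less than `2n`.
The analytic extension is therefore automatic, and everything lies in the bound, uniform in `n`.

Let `Φ` be the offspring generating function, `q_n = P(|T| = n)`, `y(x) = ∑ q_n x^n` and `Q(x) = x
Φ'(y(x))`. Cutting the tree at its root gives `y = x Φ(y)`, then `y / (1 - zQ)` for the generating
function of depths, and finally a closed form `H_z(x)` for `∑ q_n f_n(z) x^n` (`integral_depthSum`,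
`integral_pairSum`, `hasSum_distPoly_mul_pow`). It is proved only for small `x`, but its right-hand
side `treeH` is analytic in the whole disc `|x| < 1` for each `z` in the domain, so it determines
the coefficients.

The variance is merely finite, so no continuation of `y` beyond the disc is available. All estimates
inside the disc are expressed through `D = 1 - |y(x)|`. Since `x = y/Φ(y)` lies in the disc, `|y| ≤
|Φ(y)|`. As `Φ(s) - s` behaves like `a (1 - s)^2` at `1` with `a > 0`, this forces `y` into a sector
at a `d`-th root of unity, `d` being the span (`exists_sector`). Hence `|1 - x^d| ≤ C D^2`, `D ≤ C
(1 - |Q|)` and `|1 - Q| ≤ C (1 - |Q|)` (`IsTreeSeries.exists_bounds`). In a domain `Δ(β, δ)` with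
small parameters, `|z|` exceeds `1` by at most a small multiple of `|1 - z|`, so `|1 - zQ|`
dominates both `|1 - z|` and `1 - |Q|` (`norm_one_sub_mul_ge`). Differentiating `H_z` then gives
`|H_z'(x)| ≤ K |1 - z|^(-2) |1 - x^d|^(-3/2)` (`IsTreeSeries.exists_treeH_bound`).

The derivative is used because the exponent `3/2` exceeds `1`: integration over a circle of radius
`1 - 1/(2n)` costs only `n^(1/2)`, and division by `n` gives `q_n |f_n(z)| ≤ C |1 - z|^(-2)
n^(-1/2)` (`exists_coeff_bound`). In the other direction, Lagrange inversion and a local limit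
theorem give `q_n ≥ c n^(-3/2)` whenever `q_n ≠ 0` (`IsTreeSeries.exists_coeff_ge`). Dividing the
two bounds leaves the factor `n`. -/

/-- The power series with real coefficients `c`, evaluated at a complex number. -/
noncomputable def powSum (c : ℕ → ℝ) (s : ℂ) : ℂ := ∑' m, (c m : ℂ) * s ^ m

/-- The coefficients of the derivative of a power series. -/
def derivCoeff (c : ℕ → ℝ) (m : ℕ) : ℝ := (m + 1) * c (m + 1)

lemma derivCoeff_nonneg {c : ℕ → ℝ} (hc : ∀ m, 0 ≤ c m) (m : ℕ) : 0 ≤ derivCoeff c m :=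
  mul_nonneg (by positivity) (hc _)

/-! ### Power series with nonnegative summable coefficients on the closed disc -/

section powSum

variable {c : ℕ → ℝ} (hc : ∀ m, 0 ≤ c m) (hs : Summable c)
include hc

lemma norm_powSum_term_le {s : ℂ} (h : ‖s‖ ≤ 1) (m : ℕ) : ‖(c m : ℂ) * s ^ m‖ ≤ c m := by
  rw [norm_mul, norm_pow, Complex.norm_real, Real.norm_of_nonneg (hc m)]
  exact mul_le_of_le_one_right (hc m) (pow_le_one₀ (norm_nonneg _) h)

include hs

lemma summable_powSum {s : ℂ} (h : ‖s‖ ≤ 1) : Summable fun m => (c m : ℂ) * s ^ m :=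
  Summable.of_norm_bounded hs (norm_powSum_term_le hc h)

lemma hasSum_powSum {s : ℂ} (h : ‖s‖ ≤ 1) :
    HasSum (fun m => (c m : ℂ) * s ^ m) (powSum c s) := (summable_powSum hc hs h).hasSum

lemma summable_powSum_norm {r : ℝ} (h0 : 0 ≤ r) (h : r ≤ 1) : Summable fun m => c m * r ^ m :=
  Summable.of_nonneg_of_le (fun m => mul_nonneg (hc m) (pow_nonneg h0 m))
    (fun m => mul_le_of_le_one_right (hc m) (pow_le_one₀ h0 h)) hs

lemma norm_powSum_le_tsum {s : ℂ} (h : ‖s‖ ≤ 1) : ‖powSum c s‖ ≤ ∑' m, c m * ‖s‖ ^ m := by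
  refine tsum_of_norm_bounded (summable_powSum_norm hc hs (norm_nonneg s) h).hasSum fun m => ?_
  rw [norm_mul, norm_pow, Complex.norm_real, Real.norm_of_nonneg (hc m)]

lemma norm_powSum_le {s : ℂ} (h : ‖s‖ ≤ 1) : ‖powSum c s‖ ≤ ∑' m, c m :=
  tsum_of_norm_bounded hs.hasSum (norm_powSum_term_le hc h)

lemma continuousOn_powSum : ContinuousOn (powSum c) (Metric.closedBall 0 1) :=
  continuousOn_tsum (fun m => by fun_prop) hs
    fun m s h => norm_powSum_term_le hc (by simpa using h) m

omit hs in
lemma hasDerivAt_powSum (hs' : Summable (derivCoeff c)) {s : ℂ} (h : ‖s‖ < 1) :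
    HasDerivAt (powSum c) (powSum (derivCoeff c) s) s := by
  have key := hasDerivAt_tsum_of_isPreconnected (𝕜 := ℂ) (F := ℂ)
    (g := fun m s => (c m : ℂ) * s ^ m) (g' := fun m s => (c m : ℂ) * (m * s ^ (m - 1)))
    (u := fun m => m * c m) (t := Metric.ball 0 1) (y₀ := 0) (y := s)
    ((summable_nat_add_iff 1).1 (hs'.congr fun m => by simp [derivCoeff])) Metric.isOpen_ball
    (convex_ball _ _).isPreconnected
    (fun m y _ => (hasDerivAt_pow m y).const_mul _)
    (fun m y hy => by
      have hy' : ‖y‖ ≤ 1 := by simpa using (Metric.mem_ball.1 hy).le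
      rw [norm_mul, norm_mul, norm_pow, Complex.norm_real, Real.norm_of_nonneg (hc m),
        Complex.norm_natCast, mul_comm]
      exact mul_le_mul_of_nonneg_right
        (mul_le_of_le_one_right (by positivity) (pow_le_one₀ (norm_nonneg _) hy')) (hc m))
    (by simp) (summable_of_ne_finset_zero (s := {0}) fun m hm => by simp_all)
    (by simpa using h)
  have hsum : Summable fun m : ℕ => (c m : ℂ) * (m * s ^ (m - 1)) := by
    refine (summable_nat_add_iff 1).1 ((summable_powSum (derivCoeff_nonneg hc) hs' h.le).congr
      fun m => ?_)
    simp [derivCoeff]; ring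
  have he : powSum (derivCoeff c) s = ∑' m : ℕ, (c m : ℂ) * (m * s ^ (m - 1)) := by
    rw [hsum.tsum_eq_zero_add]
    simp only [powSum, derivCoeff]
    simp only [CharP.cast_eq_zero, zero_mul, mul_zero, zero_add]
    refine tsum_congr fun m => ?_
    push_cast [Nat.add_sub_cancel]; ring
  rw [he]; exact key

/-- The factorization of `s^(m+1) - t^(m+1)` has `m + 1` terms of modulus at most one. Arguing
termwise makes the estimate valid up to the boundary circle, where the series need not be
differentiable. -/
lemma norm_powSum_sub_le (hs' : Summable (derivCoeff c)) {s t : ℂ} (h : ‖s‖ ≤ 1) (ht : ‖t‖ ≤ 1) :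
    ‖powSum c s - powSum c t‖ ≤ (∑' m, derivCoeff c m) * ‖s - t‖ := by
  have h1 := (hasSum_powSum hc hs h).sub (hasSum_powSum hc hs ht)
  rw [← h1.tsum_eq, h1.summable.tsum_eq_zero_add]
  simp only [pow_zero, sub_self, zero_add]
  refine tsum_of_norm_bounded (hs'.hasSum.mul_right _) fun m => ?_
  have hg : s ^ (m + 1) - t ^ (m + 1)
      = (∑ i ∈ Finset.range (m + 1), s ^ i * t ^ (m + 1 - 1 - i)) * (s - t) :=
    ((Commute.all s t).geom_sum₂_mul (m + 1)).symm
  rw [← mul_sub, hg, norm_mul, norm_mul, Complex.norm_real, Real.norm_of_nonneg (hc _), derivCoeff]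
  have : ‖∑ i ∈ Finset.range (m + 1), s ^ i * t ^ (m + 1 - 1 - i)‖ ≤ m + 1 := by
    refine (norm_sum_le_of_le (Finset.range (m + 1)) (f := fun i => s ^ i * t ^ (m + 1 - 1 - i))
      (n := fun _ => (1:ℝ)) fun i _ => ?_).trans
      (by simp)
    rw [norm_mul, norm_pow, norm_pow]
    exact mul_le_one₀ (pow_le_one₀ (norm_nonneg _) h) (by positivity)
      (pow_le_one₀ (norm_nonneg _) ht)
  rw [← mul_assoc, mul_comm (c _)]
  gcongr
  exact hc _

-- Together with its analogue for the derivative, this reduces every estimate near a `d`-th root of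
-- unity to one near `1`.
omit hs hc in
lemma powSum_mul_of_root {ζ : ℂ} (hζ : ∀ m, c m ≠ 0 → ζ ^ m = 1) (s : ℂ) :
    powSum c (ζ * s) = powSum c s := by
  refine tsum_congr fun m => ?_
  by_cases hm : c m = 0
  · simp [hm]
  · rw [mul_pow, hζ m hm, one_mul]

omit hs hc in
lemma powSum_derivCoeff_mul_of_root {ζ : ℂ} (hζ : ∀ m, c m ≠ 0 → ζ ^ m = 1) (s : ℂ) :
    ζ * powSum (derivCoeff c) (ζ * s) = powSum (derivCoeff c) s := by
  rw [powSum, ← tsum_mul_left]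
  refine tsum_congr fun m => ?_
  by_cases hm : c (m + 1) = 0
  · simp [derivCoeff, hm]
  · rw [mul_pow, mul_left_comm, ← mul_assoc ζ, ← pow_succ', hζ _ hm, one_mul]

end powSum

/-! ### Critical offspring generating functions and their second-order remainder -/

/-- A critical offspring distribution on `ℕ` with finite non-zero variance. -/
structure CriticalOffspring (p : ℕ → ℝ) : Prop where
  nonneg : ∀ m, 0 ≤ p m
  hasSum_one : HasSum p 1
  hasSum_mean : HasSum (fun m => m * p m) 1
  summable_sq : Summable fun m : ℕ => (m : ℝ) ^ 2 * p m
  pos_zero : 0 < p 0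
  exists_two_le : ∃ m, 2 ≤ m ∧ 0 < p m

/-- The polynomials `∑_{j<m} ∑_{i<j} s^i`, i.e. `(s^m - 1 - m (s - 1)) / (s - 1)^2`. -/
noncomputable def secondQuot (m : ℕ) (s : ℂ) : ℂ :=
  ∑ j ∈ Finset.range m, ∑ i ∈ Finset.range j, s ^ i

lemma secondQuot_mul (m : ℕ) (s : ℂ) :
    secondQuot m s * (1 - s) ^ 2 = s ^ m - 1 + m * (1 - s) := by
  induction m with
  | zero => simp [secondQuot]
  | succ m ih =>
    have h := geom_sum_mul_neg s m
    rw [secondQuot, Finset.sum_range_succ, ← secondQuot, add_mul, ih]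
    push_cast
    linear_combination (1 - s) * h

lemma norm_secondQuot_le (m : ℕ) {s : ℂ} (h : ‖s‖ ≤ 1) : ‖secondQuot m s‖ ≤ (m : ℝ) ^ 2 := by
  have h2 : ∀ j ∈ Finset.range m, ‖∑ i ∈ Finset.range j, s ^ i‖ ≤ (m : ℝ) := fun j hj => by
    refine (norm_sum_le_of_le (Finset.range j) (f := fun i => s ^ i) (n := fun _ => (1 : ℝ))
      fun i _ => ?_).trans ?_
    · rw [norm_pow]; exact pow_le_one₀ (norm_nonneg _) h
    · simpa using (Finset.mem_range.1 hj).le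
  exact (norm_sum_le_of_le _ h2).trans (by simp [sq])

/-- The quotient `(Φ(s) - s) / (1 - s)^2`. -/
noncomputable def pgfRemainder (p : ℕ → ℝ) (s : ℂ) : ℂ := ∑' m, (p m : ℂ) * secondQuot m s

namespace CriticalOffspring

variable {p : ℕ → ℝ} (hp : CriticalOffspring p)
include hp

lemma summable : Summable p := hp.hasSum_one.summable

lemma summable_deriv : Summable (derivCoeff p) :=
  ((summable_nat_add_iff 1).2 hp.hasSum_mean.summable).congr fun m => by simp [derivCoeff]

lemma tsum_deriv : ∑' m, derivCoeff p m = 1 := by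
  have := hp.hasSum_mean.summable.tsum_eq_zero_add
  rw [hp.hasSum_mean.tsum_eq] at this
  simpa [derivCoeff] using this.symm

lemma summable_deriv2 : Summable (derivCoeff (derivCoeff p)) := by
  refine Summable.of_nonneg_of_le (derivCoeff_nonneg (derivCoeff_nonneg hp.nonneg)) (fun m => ?_)
    ((summable_nat_add_iff 2).2 hp.summable_sq)
  rw [derivCoeff, derivCoeff, ← mul_assoc]
  refine mul_le_mul_of_nonneg_right ?_ (hp.nonneg _)
  push_cast; nlinarith

lemma norm_pgf_le {s : ℂ} (h : ‖s‖ ≤ 1) : ‖powSum p s‖ ≤ 1 :=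
  (norm_powSum_le hp.nonneg hp.summable h).trans_eq hp.hasSum_one.tsum_eq

lemma norm_deriv_le {s : ℂ} (h : ‖s‖ ≤ 1) : ‖powSum (derivCoeff p) s‖ ≤ 1 :=
  (norm_powSum_le (derivCoeff_nonneg hp.nonneg) hp.summable_deriv h).trans_eq hp.tsum_deriv

lemma deriv_one : powSum (derivCoeff p) 1 = 1 := by
  simp only [powSum, one_pow, mul_one]
  exact_mod_cast congrArg ((↑) : ℝ → ℂ) hp.tsum_deriv

lemma norm_remainder_term_le (m : ℕ) {s : ℂ} (h : ‖s‖ ≤ 1) :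
    ‖(p m : ℂ) * secondQuot m s‖ ≤ (m : ℝ) ^ 2 * p m := by
  rw [norm_mul, Complex.norm_real, Real.norm_of_nonneg (hp.nonneg m), mul_comm]
  exact mul_le_mul_of_nonneg_right (norm_secondQuot_le m h) (hp.nonneg m)

/-- The finite second moment dominates the series on the whole closed disc. Continuity of the
remainder at `1` then replaces a second-order Taylor expansion of `Φ` there. -/
lemma continuousOn_remainder : ContinuousOn (pgfRemainder p) (Metric.closedBall 0 1) :=
  continuousOn_tsum (fun m => by unfold secondQuot; fun_prop) hp.summable_sq
    fun m s h => hp.norm_remainder_term_le m (by simpa using h)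

lemma exists_norm_remainder_le :
    ∃ M : ℝ, 0 < M ∧ ∀ s : ℂ, ‖s‖ ≤ 1 → ‖pgfRemainder p s‖ ≤ M :=
  ⟨(∑' m : ℕ, (m : ℝ) ^ 2 * p m) + 1, add_pos_of_nonneg_of_pos
    (tsum_nonneg fun m => mul_nonneg (by positivity) (hp.nonneg m)) one_pos, fun s h =>
    (tsum_of_norm_bounded hp.summable_sq.hasSum fun m => hp.norm_remainder_term_le m h).trans
      (by linarith)⟩

/-- Criticality enters here: total mass one and mean one turn `∑ p_m (s^m - 1 + m (1 - s))` into
`Φ(s) - s`. -/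
lemma remainder_mul {s : ℂ} (h : ‖s‖ ≤ 1) :
    pgfRemainder p s * (1 - s) ^ 2 = powSum p s - s := by
  have hm : HasSum (fun m : ℕ => ((m * p m : ℝ) : ℂ)) 1 := by
    rw [← Complex.ofReal_one]; exact Complex.hasSum_ofReal.2 hp.hasSum_mean
  have h1 : HasSum (fun m : ℕ => ((p m : ℝ) : ℂ)) 1 := by
    rw [← Complex.ofReal_one]; exact Complex.hasSum_ofReal.2 hp.hasSum_one
  have h3 := ((hasSum_powSum hp.nonneg hp.summable h).sub h1).add (hm.mul_right (1 - s))
  have hR : Summable fun m => (p m : ℂ) * secondQuot m s :=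
    Summable.of_norm_bounded hp.summable_sq fun m => hp.norm_remainder_term_le m h
  have h4 := hR.hasSum.mul_right ((1 - s) ^ 2)
  have h5 := h4.unique (h3.congr_fun fun m => by
    rw [mul_assoc, secondQuot_mul]; push_cast; ring)
  rw [pgfRemainder, h5]; ring

/-- The limiting value of the remainder at `1` is a positive real number. -/
lemma exists_remainder_one : ∃ a : ℝ, 0 < a ∧ pgfRemainder p 1 = a := by
  have hg : ∀ m : ℕ, secondQuot m 1 = ((∑ j ∈ Finset.range m, (j : ℝ) : ℝ) : ℂ) := fun m => by
    simp [secondQuot]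
  refine ⟨∑' m, p m * ∑ j ∈ Finset.range m, (j : ℝ), ?_, ?_⟩
  · obtain ⟨m, hm, hpm⟩ := hp.exists_two_le
    have hn : ∀ m : ℕ, 0 ≤ ∑ j ∈ Finset.range m, (j : ℝ) := fun m =>
      Finset.sum_nonneg fun _ _ => by positivity
    have hsum : Summable fun m => p m * ∑ j ∈ Finset.range m, (j : ℝ) := by
      refine Summable.of_norm_bounded hp.summable_sq fun m => ?_
      have := hp.norm_remainder_term_le m (s := 1) (by simp)
      rw [hg, ← Complex.ofReal_mul, Complex.norm_real] at this
      exact this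
    refine hsum.tsum_pos (fun m => mul_nonneg (hp.nonneg m) (hn m)) m (mul_pos hpm ?_)
    refine Finset.sum_pos' (fun _ _ => by positivity) ⟨1, by simp; omega, by simp⟩
  · rw [pgfRemainder, Complex.ofReal_tsum]
    exact tsum_congr fun m => by rw [hg, Complex.ofReal_mul]

/-- The mean of the offspring in the disc is bounded away from one. -/
lemma exists_norm_deriv_le :
    ∃ c : ℝ, 0 < c ∧ ∀ s : ℂ, ‖s‖ ≤ 1 → ‖powSum (derivCoeff p) s‖ ≤ 1 - c * (1 - ‖s‖) := by
  obtain ⟨m, hm, hpm⟩ := hp.exists_two_le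
  obtain ⟨k, rfl⟩ : ∃ k, m = k + 1 + 1 := ⟨m - 2, by omega⟩
  refine ⟨derivCoeff p (k + 1), mul_pos (by positivity) hpm, fun s h => ?_⟩
  have hn := derivCoeff_nonneg hp.nonneg
  have hs := summable_powSum_norm hn hp.summable_deriv (norm_nonneg s) h
  have h1 := hp.summable_deriv.hasSum.sub hs.hasSum
  -- The defect `1 - Φ'(|s|)` is a sum of nonnegative terms. The one coming from an offspring number
  -- at least two already gives a linear loss.
  have h2 : derivCoeff p (k + 1) - derivCoeff p (k + 1) * ‖s‖ ^ (k + 1) ≤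
      ∑' m, derivCoeff p m - ∑' m, derivCoeff p m * ‖s‖ ^ m :=
    le_hasSum h1 (k + 1) fun j _ => sub_nonneg.2
      (mul_le_of_le_one_right (hn j) (pow_le_one₀ (norm_nonneg _) h))
  have h3 : ‖s‖ ^ (k + 1) ≤ ‖s‖ := pow_le_of_le_one (norm_nonneg _) h (by omega)
  have h4 := norm_powSum_le_tsum hn hp.summable_deriv h
  rw [hp.tsum_deriv] at h2
  have := mul_le_mul_of_nonneg_left h3 (hn (k + 1))
  linarith

end CriticalOffspring

/-! ### The span, and the sectors containing the values of the tree function -/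

/-- `d` is the span of the (support of the) distribution `p`. -/
structure IsSpan (p : ℕ → ℝ) (d : ℕ) : Prop where
  pos : 0 < d
  dvd : ∀ m, p m ≠ 0 → d ∣ m
  pow_eq_one : ∀ s : ℂ, (∀ m, p m ≠ 0 → s ^ m = 1) → s ^ d = 1

lemma IsSpan.pow_eq_one_of {p : ℕ → ℝ} {d : ℕ} (hd : IsSpan p d) {ζ : ℂ} (hζ : ζ ^ d = 1)
    (m : ℕ) (hm : p m ≠ 0) : ζ ^ m = 1 := by
  obtain ⟨k, rfl⟩ := hd.dvd m hm
  rw [pow_mul, hζ, one_pow]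

namespace CriticalOffspring

variable {p : ℕ → ℝ} (hp : CriticalOffspring p)
include hp

/-- The span is the absolute value of a generator of the subgroup of `ℤ` spanned by the support. The
integers `k` with `s^k = 1` form a subgroup, so if it contains the support it contains the
generator. -/
lemma exists_isSpan : ∃ d, IsSpan p d := by
  obtain ⟨m₀, hm₀, hpm₀⟩ := hp.exists_two_le
  set S : Set ℤ := {k | ∃ m : ℕ, p m ≠ 0 ∧ k = m} with hS
  obtain ⟨a, ha⟩ := Int.subgroup_cyclic (AddSubgroup.closure S)
  have hmem : ∀ m : ℕ, p m ≠ 0 → a ∣ m := fun m hm => by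
    have : (m : ℤ) ∈ AddSubgroup.closure S := AddSubgroup.subset_closure ⟨m, hm, rfl⟩
    rw [ha, AddSubgroup.mem_closure_singleton] at this
    obtain ⟨k, hk⟩ := this
    exact ⟨k, by rw [← hk, smul_eq_mul, mul_comm]⟩
  refine ⟨a.natAbs, ?_, fun m hm => Int.natAbs_dvd_natAbs.2 (hmem m hm), fun s hs => ?_⟩
  · refine Int.natAbs_pos.2 fun h0 => ?_
    have := hmem m₀ hpm₀.ne'
    rw [h0, zero_dvd_iff] at this
    omega
  · have hs0 : s ≠ 0 := by
      rintro rfl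
      have := hs m₀ hpm₀.ne'
      rw [zero_pow (by omega)] at this
      exact zero_ne_one this
    have hz : ∀ k ∈ AddSubgroup.closure S, s ^ k = 1 := fun k hk => by
      induction hk using AddSubgroup.closure_induction with
      | mem k hk => obtain ⟨m, hm, rfl⟩ := hk; simpa using hs m hm
      | zero => simp
      | add x y _ _ hx hy => rw [zpow_add₀ hs0, hx, hy, one_mul]
      | neg x _ hx => rw [zpow_neg, hx, inv_one]
    have h1 : s ^ a = 1 := hz a (by rw [ha]; exact AddSubgroup.subset_closure rfl)
    rcases Int.natAbs_eq a with h | h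
    · rw [h, zpow_natCast] at h1; exact h1
    · rw [h, zpow_neg, inv_eq_one, zpow_natCast] at h1; exact h1

/-- Equality in the triangle inequality: all `s^m` with `p m ≠ 0` equal one common number of modulus
one, and since `p 0 > 0` that number is `s^0 = 1`. -/
lemma pow_eq_one_of_norm_pgf {s : ℂ} (h1 : ‖s‖ = 1) (h2 : ‖powSum p s‖ = 1) (m : ℕ)
    (hm : p m ≠ 0) : s ^ m = 1 := by
  set u := (powSum p s)⁻¹ with hu
  have hu1 : ‖u‖ = 1 := by rw [hu, norm_inv, h2, inv_one]
  have h0 : powSum p s ≠ 0 := norm_ne_zero_iff.1 (by rw [h2]; exact one_ne_zero)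
  have hs := (hasSum_powSum hp.nonneg hp.summable h1.le).mul_left u
  rw [inv_mul_cancel₀ h0] at hs
  have hre := Complex.hasSum_re hs
  have hsub := hp.hasSum_one.sub hre
  rw [Complex.one_re, sub_self] at hsub
  have hterm : ∀ m, (u * ((p m : ℂ) * s ^ m)).re = p m * (u * s ^ m).re := fun m => by
    rw [mul_left_comm, Complex.re_ofReal_mul]
  have hn : ∀ m, ‖u * s ^ m‖ = 1 := fun m => by rw [norm_mul, norm_pow, h1, hu1]; simp
  have hle : ∀ m, (u * s ^ m).re ≤ 1 := fun m => (Complex.re_le_norm _).trans (hn m).le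
  have hz := (hasSum_zero_iff_of_nonneg fun m => by
    rw [hterm]; nlinarith [hp.nonneg m, hle m]).1 hsub
  have hone : ∀ m, p m ≠ 0 → u * s ^ m = 1 := fun m hm => by
    have h := congrFun hz m
    simp only [hterm, Pi.zero_apply] at h
    have hr : (u * s ^ m).re = 1 := by
      have : p m * (1 - (u * s ^ m).re) = 0 := by linarith
      rcases mul_eq_zero.1 this with h | h
      · exact absurd h hm
      · linarith
    have hq : (u * s ^ m).re * (u * s ^ m).re + (u * s ^ m).im * (u * s ^ m).im = 1 := by
      rw [← Complex.normSq_apply, Complex.normSq_eq_norm_sq, hn]; norm_num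
    apply Complex.ext
    · simpa using hr
    · rw [hr] at hq
      simpa using hq
  have h3 := hone 0 hp.pos_zero.ne'
  rw [pow_zero, mul_one] at h3
  simpa [h3] using hone m hm

/-- A point of the disc near `1` at which the generating function is not smaller than the argument
lies in a sector with vertex at `1`. -/
lemma eventually_sector : ∀ᶠ s : ℂ in 𝓝 1, ‖s‖ ≤ 1 → ‖s‖ ≤ ‖powSum p s‖ →
    (1 / 4) * ‖1 - s‖ ≤ 1 - ‖s‖ := by
  obtain ⟨a, ha, hRa⟩ := hp.exists_remainder_one
  have h1 : ∀ᶠ s in 𝓝[Metric.closedBall 0 1] (1 : ℂ), dist (pgfRemainder p s) a < a / 4 := by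
    have h := hp.continuousOn_remainder 1 (by simp)
    rw [ContinuousWithinAt, hRa] at h
    exact h (Metric.ball_mem_nhds _ (by positivity))
  have h2 : ∀ᶠ s in 𝓝 (1 : ℂ), ‖1 - s‖ < 1 / 2 ∧ a * ‖1 - s‖ ^ 2 < 1 / 2 := by
    have hc1 : Continuous fun s : ℂ => ‖1 - s‖ := by fun_prop
    have hc2 : Continuous fun s : ℂ => a * ‖1 - s‖ ^ 2 := by fun_prop
    exact (hc1.continuousAt.eventually_lt continuousAt_const (by simp)).and
      (hc2.continuousAt.eventually_lt continuousAt_const (by simp))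
  filter_upwards [eventually_nhdsWithin_iff.1 h1, h2] with s hs1 hs2 hs hK
  have hR := hs1 (by simpa using hs)
  obtain ⟨hw, haw⟩ := hs2
  rw [dist_eq_norm] at hR
  have hid := hp.remainder_mul hs
  -- Near `1`, replacing `Φ(s)` by `s + a (1 - s)^2` costs at most `(a/4) |1 - s|^2`.
  have hN : ‖s‖ ≤ ‖s + a * (1 - s) ^ 2‖ + a / 4 * ‖1 - s‖ ^ 2 := by
    have he : powSum p s = (s + a * (1 - s) ^ 2) + (pgfRemainder p s - a) * (1 - s) ^ 2 := by
      linear_combination -hid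
    rw [he] at hK
    refine (hK.trans (norm_add_le _ _)).trans (add_le_add_right ?_ _)
    rw [norm_mul, norm_pow]
    gcongr
  obtain ⟨u, v, rfl⟩ : ∃ u v : ℝ, s = 1 - (u + v * Complex.I) :=
    ⟨1 - s.re, -s.im, by apply Complex.ext <;> simp⟩
  have hnw : ‖1 - (1 - (u + v * Complex.I))‖ ^ 2 = u ^ 2 + v ^ 2 := by
    rw [← Complex.normSq_eq_norm_sq, Complex.normSq_apply]; simp; ring
  have hns : ‖1 - (u + v * Complex.I)‖ ^ 2 = 1 - 2 * u + (u ^ 2 + v ^ 2) := by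
    rw [← Complex.normSq_eq_norm_sq, Complex.normSq_apply]; simp; ring
  have hnM : ‖1 - (u + v * Complex.I) + a * (1 - (1 - (u + v * Complex.I))) ^ 2‖ ^ 2 =
      1 - 2 * u + (u ^ 2 + v ^ 2) + 2 * a * ((u ^ 2 - v ^ 2) - u * (u ^ 2 + v ^ 2))
        + a ^ 2 * (u ^ 2 + v ^ 2) ^ 2 := by
    rw [← Complex.normSq_eq_norm_sq, Complex.normSq_apply]; simp [sq]; ring
  set W := ‖1 - (1 - (u + v * Complex.I))‖
  set N := ‖1 - (u + v * Complex.I)‖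
  set M := ‖1 - (u + v * Complex.I) + a * (1 - (1 - (u + v * Complex.I))) ^ 2‖
  have hW0 : 0 ≤ W := norm_nonneg _
  have hN0 : 0 ≤ N := norm_nonneg _
  have hM0 : 0 ≤ M := norm_nonneg _
  rw [hnw] at hN haw
  set q := u ^ 2 + v ^ 2 with hq
  have hq0 : 0 ≤ q := by positivity
  have hMN : N ^ 2 - a / 2 * q ≤ M ^ 2 := by
    rcases le_total N (a / 4 * q) with h | h
    · nlinarith [mul_nonneg ha.le hq0]
    · nlinarith [mul_nonneg ha.le hq0]
  have hu0 : 0 ≤ u := by nlinarith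
  have h3 : 0 ≤ a * (2 * (u ^ 2 - v ^ 2) + q) := by
    nlinarith [mul_nonneg (mul_nonneg ha.le hu0) hq0, mul_nonneg ha.le hq0]
  -- This says `v^2 ≤ 3 u^2`, hence `|1 - s| ≤ 2u`. Then `1 - |s|^2 = 2u - q ≥ W - W^2 ≥ W/2`, and
  -- dividing by `1 + |s| ≤ 2` gives the constant `1/4`.
  have h4 : 0 ≤ 2 * (u ^ 2 - v ^ 2) + q := nonneg_of_mul_nonneg_right h3 ha
  have hWu : W ≤ 2 * u := abs_le_of_sq_le_sq' (by nlinarith) (by positivity) |>.2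
  nlinarith

/-- A point of the disc at which the generating function is not smaller than the argument lies in
a sector whose vertex is a `d`-th root of unity. -/
lemma exists_sector {d : ℕ} (hd : IsSpan p d) : ∃ c : ℝ, 0 < c ∧ ∀ s : ℂ, ‖s‖ ≤ 1 →
    ‖s‖ ≤ ‖powSum p s‖ → ∃ ζ : ℂ, ζ ^ d = 1 ∧ c * ‖1 - ζ * s‖ ≤ 1 - ‖s‖ := by
  -- Compactness argument: the claim passes to subsets and to unions of two sets (with the smaller
  -- constant), so a neighbourhood of each point of the closed disc suffices.
  suffices h : ∃ c : ℝ, 0 < c ∧ ∀ s ∈ Metric.closedBall (0 : ℂ) 1,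
      ‖s‖ ≤ 1 → ‖s‖ ≤ ‖powSum p s‖ → ∃ ζ : ℂ, ζ ^ d = 1 ∧ c * ‖1 - ζ * s‖ ≤ 1 - ‖s‖ by
    obtain ⟨c, hc, h⟩ := h
    exact ⟨c, hc, fun s hs => h s (by simpa using hs) hs⟩
  refine (isCompact_closedBall (0 : ℂ) 1).induction_on ⟨1, one_pos, by simp⟩
    (fun S T hST ⟨c, hc, h⟩ => ⟨c, hc, fun s hs => h s (hST hs)⟩) ?_ ?_
  · rintro S T ⟨c, hc, h⟩ ⟨c', hc', h'⟩
    refine ⟨min c c', lt_min hc hc', fun s hs h1 hK => ?_⟩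
    rcases hs with hs | hs
    · obtain ⟨ζ, hζ, h2⟩ := h s hs h1 hK
      exact ⟨ζ, hζ, le_trans (by gcongr; exact min_le_left _ _) h2⟩
    · obtain ⟨ζ, hζ, h2⟩ := h' s hs h1 hK
      exact ⟨ζ, hζ, le_trans (by gcongr; exact min_le_right _ _) h2⟩
  · intro t ht
    have ht1 : ‖t‖ ≤ 1 := by simpa using ht
    rcases ht1.lt_or_eq with hlt | heq
    · refine ⟨{s | ‖s‖ < (1 + ‖t‖) / 2}, mem_nhdsWithin_of_mem_nhds
        ((isOpen_lt continuous_norm continuous_const).mem_nhds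
          (by simp only [Set.mem_ofPred_eq]; linarith)), (1 - ‖t‖) / 4, by linarith, fun s hs _ _ => ?_⟩
      refine ⟨1, one_pow _, ?_⟩
      simp only [Set.mem_ofPred_eq] at hs
      have h2 : ‖1 - 1 * s‖ ≤ 2 := (norm_sub_le _ _).trans (by rw [one_mul, norm_one]; linarith)
      nlinarith
    -- At a boundary point with `|Φ(t)| < 1` the hypothesis `|s| ≤ |Φ(s)|` fails nearby. Any other
    -- boundary point is a `d`-th root of unity, and rotation by `t⁻¹` moves it to `1`.
    · by_cases hlt : ‖powSum p t‖ < 1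
      · have hc : ContinuousWithinAt (fun s => ‖powSum p s‖ - ‖s‖) (Metric.closedBall 0 1) t :=
          ((continuousOn_powSum hp.nonneg hp.summable t ht).norm).sub
            continuous_norm.continuousWithinAt
        have hev : ∀ᶠ s in 𝓝[Metric.closedBall 0 1] t, ‖powSum p s‖ - ‖s‖ < 0 :=
          hc.eventually_lt_const (by linarith)
        exact ⟨_, hev, 1, one_pos, fun s hs _ hK => absurd hs (by simpa using hK)⟩
      · have hone : ‖powSum p t‖ = 1 := le_antisymm (hp.norm_pgf_le ht1) (not_lt.1 hlt)
        have htm := hp.pow_eq_one_of_norm_pgf heq hone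
        have htd := hd.pow_eq_one t htm
        have ht0 : t ≠ 0 := norm_ne_zero_iff.1 (by rw [heq]; exact one_ne_zero)
        have htend : Tendsto (fun s => t⁻¹ * s) (𝓝 t) (𝓝 1) := by
          have : ContinuousAt (fun s => t⁻¹ * s) t := by fun_prop
          simpa [ContinuousAt, inv_mul_cancel₀ ht0] using this
        refine ⟨_, mem_nhdsWithin_of_mem_nhds (htend.eventually hp.eventually_sector), 1 / 4,
          by norm_num, fun s hs hs1 hK => ⟨t⁻¹, by rw [inv_pow, htd, inv_one], ?_⟩⟩
        have hn : ‖t⁻¹ * s‖ = ‖s‖ := by rw [norm_mul, norm_inv, heq, inv_one, one_mul]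
        have h := hs (by rwa [hn])
          (by rw [hn, powSum_mul_of_root (fun m hm => by rw [inv_pow, htm m hm, inv_one])]
              exact hK)
        rwa [hn] at h

end CriticalOffspring

lemma differentiableOn_powSum {c : ℕ → ℝ} (hc : ∀ m, 0 ≤ c m) (hs : Summable c) :
    DifferentiableOn ℂ (powSum c) (Metric.ball 0 1) :=
  Complex.differentiableOn_tsum_of_summable_norm hs (fun m => by fun_prop) Metric.isOpen_ball
    fun m s h => norm_powSum_term_le hc (by simpa using (Metric.mem_ball.1 h).le) m

lemma norm_one_sub_pow_le {w : ℂ} (h : ‖w‖ ≤ 1) (n : ℕ) : ‖1 - w ^ n‖ ≤ n * ‖1 - w‖ := by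
  induction n with
  | zero => simp
  | succ n ih =>
    have h1 : 1 - w ^ (n + 1) = (1 - w) + w * (1 - w ^ n) := by ring
    have h2 : ‖w * (1 - w ^ n)‖ ≤ 1 * ‖1 - w ^ n‖ := by rw [norm_mul]; gcongr
    rw [h1]
    push_cast
    linarith [norm_add_le (1 - w) (w * (1 - w ^ n))]

/-! ### The tree function inside the unit disc -/

/-- `q` is a sequence of weights whose generating function `y` solves `y = x Φ(y)`. -/
structure IsTreeSeries (p q : ℕ → ℝ) : Prop where
  nonneg : ∀ n, 0 ≤ q n
  zero : q 0 = 0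
  summable : Summable q
  tsum_le : ∑' n, q n ≤ 1
  eq : ∀ x : ℂ, ‖x‖ < 1 → powSum q x = x * powSum p (powSum q x)

/-- The function `x Φ'(y(x))`. -/
noncomputable def treeQ (p q : ℕ → ℝ) (x : ℂ) : ℂ := x * powSum (derivCoeff p) (powSum q x)

section

variable {p q : ℕ → ℝ} (hp : CriticalOffspring p) (hq : IsTreeSeries p q)
include hq

lemma IsTreeSeries.norm_le {x : ℂ} (h : ‖x‖ ≤ 1) : ‖powSum q x‖ ≤ ‖x‖ := by
  refine (norm_powSum_le_tsum hq.nonneg hq.summable h).trans ?_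
  calc ∑' m, q m * ‖x‖ ^ m ≤ ∑' m, q m * ‖x‖ := by
        refine Summable.tsum_le_tsum (fun m => ?_)
          (summable_powSum_norm hq.nonneg hq.summable (norm_nonneg _) h) (hq.summable.mul_right _)
        rcases Nat.eq_zero_or_pos m with rfl | hm
        · simp [hq.zero]
        · exact mul_le_mul_of_nonneg_left (pow_le_of_le_one (norm_nonneg _) h hm.ne') (hq.nonneg m)
    _ = (∑' m, q m) * ‖x‖ := tsum_mul_right
    _ ≤ 1 * ‖x‖ := by gcongr; exact hq.tsum_le
    _ = ‖x‖ := one_mul _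

lemma IsTreeSeries.norm_lt_one {x : ℂ} (h : ‖x‖ < 1) : ‖powSum q x‖ < 1 :=
  (hq.norm_le h.le).trans_lt h

/-- This is what places the values of `y` in the region treated by `exists_sector`. -/
lemma IsTreeSeries.norm_le_pgf {x : ℂ} (h : ‖x‖ < 1) :
    ‖powSum q x‖ ≤ ‖powSum p (powSum q x)‖ := by
  have h1 := congrArg norm (hq.eq x h)
  rw [norm_mul] at h1
  nlinarith [norm_nonneg (powSum p (powSum q x))]

include hp

omit hq in
lemma CriticalOffspring.norm_pgf_sub_le {s : ℂ} (h : ‖s‖ ≤ 1) : p 0 - ‖s‖ ≤ ‖powSum p s‖ := by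
  have h1 := norm_powSum_sub_le hp.nonneg hp.summable hp.summable_deriv h (t := 0) (by simp)
  have h2 : powSum p 0 = p 0 := by
    rw [powSum, tsum_eq_single 0 (fun m hm => by simp [hm])]; simp
  rw [hp.tsum_deriv, h2, one_mul, sub_zero] at h1
  have h3 := norm_sub_norm_le (p 0 : ℂ) (powSum p s)
  rw [norm_sub_rev] at h3
  rw [Complex.norm_real, Real.norm_of_nonneg hp.pos_zero.le] at h3
  linarith

/-- Average of the two lower bounds `|y|` and `p 0 - |y|`. -/
lemma IsTreeSeries.half_le_norm_pgf {x : ℂ} (h : ‖x‖ < 1) :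
    p 0 / 2 ≤ ‖powSum p (powSum q x)‖ := by
  linarith [hq.norm_le_pgf h, hp.norm_pgf_sub_le (hq.norm_lt_one h).le]

/-- All estimates of functions of `x` are in terms of the distance of `y(x)` to the unit circle. -/
lemma IsTreeSeries.exists_bounds {d : ℕ} (hd : IsSpan p d) : ∃ C : ℝ, 1 ≤ C ∧ ∀ x : ℂ, ‖x‖ < 1 →
    ‖1 - x ^ d‖ ≤ C * (1 - ‖powSum q x‖) ^ 2 ∧
    1 - ‖powSum q x‖ ≤ C * (1 - ‖treeQ p q x‖) ∧
    ‖1 - treeQ p q x‖ ≤ C * (1 - ‖treeQ p q x‖) := by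
  obtain ⟨c, hc, hsec⟩ := hp.exists_sector hd
  obtain ⟨M, hM, hR⟩ := hp.exists_norm_remainder_le
  obtain ⟨b, hb, hQ⟩ := hp.exists_norm_deriv_le
  set V := ∑' m, derivCoeff (derivCoeff p) m with hV
  have hV0 : 0 ≤ V := tsum_nonneg (derivCoeff_nonneg (derivCoeff_nonneg hp.nonneg))
  have hp0 := hp.pos_zero
  set A := M / (p 0 / 2) with hA
  have hA0 : 0 ≤ A := by positivity
  have main : ∀ x : ℂ, ‖x‖ < 1 →
    ‖1 - x ^ d‖ ≤ (d * A / c ^ 2) * (1 - ‖powSum q x‖) ^ 2 ∧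
    1 - ‖powSum q x‖ ≤ (1 / b) * (1 - ‖treeQ p q x‖) ∧
    ‖1 - treeQ p q x‖ ≤ ((2 * A + V) / c / b) * (1 - ‖treeQ p q x‖) := by
    intro x hx
    have hy := hq.norm_lt_one hx
    -- Multiplying both `x` and `y` by `ζ` preserves the equation `y = x Φ(y)`, the value of `Q` and
    -- that of `x^d`. So the vertex of the sector may be taken to be `1`.
    obtain ⟨ζ, hζ, hs⟩ := hsec _ hy.le (hq.norm_le_pgf hx)
    have hroot := hd.pow_eq_one_of hζ
    have hζ1 : ‖ζ‖ = 1 := Complex.norm_eq_one_of_pow_eq_one hζ hd.pos.ne'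
    have hΦ := hq.half_le_norm_pgf hp hx
    rw [← powSum_mul_of_root hroot] at hΦ
    have heq : ζ * powSum q x = (ζ * x) * powSum p (ζ * powSum q x) := by
      rw [powSum_mul_of_root hroot, mul_assoc, ← hq.eq x hx]
    have hQe : treeQ p q x = (ζ * x) * powSum (derivCoeff p) (ζ * powSum q x) := by
      rw [treeQ, ← powSum_derivCoeff_mul_of_root hroot]; ring
    have hxd : x ^ d = (ζ * x) ^ d := by rw [mul_pow, hζ, one_mul]
    have hwn : ‖ζ * x‖ < 1 := by rw [norm_mul, hζ1, one_mul]; exact hx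
    have hsn : ‖ζ * powSum q x‖ = ‖powSum q x‖ := by rw [norm_mul, hζ1, one_mul]
    have hQn : ‖treeQ p q x‖ ≤ 1 - b * (1 - ‖powSum q x‖) := by
      refine le_trans ?_ (hQ _ hy.le)
      rw [treeQ, norm_mul]
      exact mul_le_of_le_one_left (norm_nonneg _) hx.le
    rw [hxd]
    rw [← hsn] at hs hy hQn ⊢
    set s := ζ * powSum q x
    set w := ζ * x
    -- From `s = w Φ(s)` one gets `(1 - w) Φ(s) = Φ(s) - s`, which is quadratic in `1 - s`. This is
    -- the source of the square-root singularity of `y`.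
    have hw : ‖1 - w‖ ≤ A * ‖1 - s‖ ^ 2 := by
      have h1 : (1 - w) * powSum p s = pgfRemainder p s * (1 - s) ^ 2 := by
        rw [hp.remainder_mul hy.le]; linear_combination heq
      have h2 := congrArg norm h1
      rw [norm_mul, norm_mul, norm_pow] at h2
      have h3 := mul_le_mul_of_nonneg_left hΦ (norm_nonneg (1 - w))
      have h4 := mul_le_mul_of_nonneg_right (hR s hy.le) (sq_nonneg ‖1 - s‖)
      rw [hA, div_mul_eq_mul_div, le_div_iff₀ (by positivity)]
      linarith
    have hs' : ‖1 - s‖ ≤ (1 - ‖s‖) / c := by rw [le_div_iff₀ hc]; linarith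
    have hs2 : ‖1 - s‖ ≤ 2 := (norm_sub_le _ _).trans (by rw [norm_one]; linarith)
    have hDQ : 1 - ‖s‖ ≤ (1 / b) * (1 - ‖treeQ p q x‖) := by
      rw [one_div_mul_eq_div, le_div_iff₀ hb]; linarith
    refine ⟨?_, hDQ, ?_⟩
    · calc ‖1 - w ^ d‖ ≤ d * ‖1 - w‖ := norm_one_sub_pow_le hwn.le d
        _ ≤ d * (A * ((1 - ‖s‖) / c) ^ 2) := by
            gcongr
            refine hw.trans ?_
            gcongr
        _ = _ := by ring
    · have h1 : 1 - treeQ p q x = (1 - w) + w * (1 - powSum (derivCoeff p) s) := by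
        rw [hQe]; ring
      have h2 : ‖1 - powSum (derivCoeff p) s‖ ≤ V * ‖1 - s‖ := by
        have h := norm_powSum_sub_le (derivCoeff_nonneg hp.nonneg) hp.summable_deriv
          hp.summable_deriv2 (s := 1) (t := s) (by simp) hy.le
        rwa [hp.deriv_one] at h
      have h3 : ‖w * (1 - powSum (derivCoeff p) s)‖ ≤ V * ‖1 - s‖ := by
        rw [norm_mul]
        exact (mul_le_of_le_one_left (norm_nonneg _) hwn.le).trans h2
      have h4 : A * ‖1 - s‖ ^ 2 ≤ A * (2 * ‖1 - s‖) := by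
        gcongr; nlinarith [norm_nonneg (1 - s)]
      calc ‖1 - treeQ p q x‖ ≤ ‖1 - w‖ + ‖w * (1 - powSum (derivCoeff p) s)‖ := by
            rw [h1]; exact norm_add_le _ _
        _ ≤ (2 * A + V) * ‖1 - s‖ := by linarith
        _ ≤ (2 * A + V) * ((1 / b) * (1 - ‖treeQ p q x‖) / c) := by
            gcongr
            exact hs'.trans (by gcongr)
        _ = _ := by ring
  set C := max 1 (max (d * A / c ^ 2) (max (1 / b) ((2 * A + V) / c / b)))
  have hC1 : (d * A / c ^ 2) ≤ C := (le_max_left _ _).trans (le_max_right _ _)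
  have hC2 : (1 / b) ≤ C :=
    (le_max_left _ _).trans ((le_max_right _ _).trans (le_max_right _ _))
  have hC3 : (2 * A + V) / c / b ≤ C :=
    (le_max_right _ _).trans ((le_max_right _ _).trans (le_max_right _ _))
  refine ⟨C, le_max_left _ _, fun x hx => ?_⟩
  obtain ⟨h1, h2, h3⟩ := main x hx
  have hy := hq.norm_lt_one hx
  have hQ1 : 0 ≤ 1 - ‖treeQ p q x‖ := by
    have : 0 ≤ (1 / b) * (1 - ‖treeQ p q x‖) := by linarith
    exact nonneg_of_mul_nonneg_right this (by positivity)
  exact ⟨h1.trans (by gcongr), h2.trans (by gcongr), h3.trans (by gcongr)⟩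

end

/-! ### The domain of `z` and lower bounds for `1 - zQ` -/

/-- In a domain `Δ(β, δ)` with small parameters the modulus hardly exceeds one near `1`. -/
lemma exists_deltaDomain {κ : ℝ} (hκ : 0 < κ) (hκ1 : κ ≤ 1) : ∃ β δ : ℝ, 0 < β ∧ β < Real.pi / 2 ∧
    0 < δ ∧ ∀ z ∈ deltaDomain β δ, z ≠ 1 ∧ ‖z‖ < 2 ∧ ‖z‖ ≤ 1 + κ * ‖1 - z‖ := by
  have hpi := Real.pi_gt_three
  -- The angle `κ/2` gives `Re (z - 1) ≤ (κ/2) |z - 1|`, which suffices while `|z - 1| ≤ κ`. Beyond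
  -- that, `|z| < 1 + κ^2` is already good enough.
  refine ⟨κ / 2, κ ^ 2, by positivity, by linarith, by positivity, fun z ⟨h1, h2, h3⟩ =>
    ⟨h2, by nlinarith, ?_⟩⟩
  rw [norm_sub_rev]
  rcases le_or_gt ‖z - 1‖ κ with h | h
  · have hre : (z - 1).re ≤ κ / 2 * ‖z - 1‖ := by
      rw [← Complex.norm_mul_cos_arg, mul_comm, ← Real.cos_abs]
      refine mul_le_mul_of_nonneg_right ?_ (norm_nonneg _)
      calc Real.cos |(z - 1).arg| ≤ Real.cos (Real.pi / 2 - κ / 2) :=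
            Real.cos_le_cos_of_nonneg_of_le_pi (by linarith) (Complex.abs_arg_le_pi _) h3.le
        _ = Real.sin (κ / 2) := Real.cos_pi_div_two_sub _
        _ ≤ κ / 2 := Real.sin_le (by positivity)
    have hsq : ‖z‖ ^ 2 = 1 + 2 * (z - 1).re + ‖z - 1‖ ^ 2 := by
      rw [← Complex.normSq_eq_norm_sq, ← Complex.normSq_eq_norm_sq, Complex.normSq_apply,
        Complex.normSq_apply]
      simp; ring
    refine abs_le_of_sq_le_sq' ?_ (by positivity) |>.2
    nlinarith [norm_nonneg (z - 1), mul_nonneg hκ.le (norm_nonneg (z - 1))]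
  · nlinarith

/-- Lower bounds for `1 - z Q` when `Q` is in a Stolz domain and `z` in the complementary one. -/
lemma norm_one_sub_mul_ge {C κ : ℝ} (hC : 1 ≤ C) (hκ0 : 0 < κ) (hκ : κ * (4 * C) ≤ 1) {z Q : ℂ}
    (hz2 : ‖z‖ ≤ 2) (hz : ‖z‖ ≤ 1 + κ * ‖1 - z‖) (hQ : ‖1 - Q‖ ≤ C * (1 - ‖Q‖)) :
    ‖1 - z‖ ≤ 6 * C * ‖1 - z * Q‖ ∧ 1 - ‖Q‖ ≤ 6 * C * ‖1 - z * Q‖ := by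
  have hQ1 : 0 ≤ 1 - ‖Q‖ := nonneg_of_mul_nonneg_right ((norm_nonneg _).trans hQ) (by linarith)
  have h1 : 1 - ‖z‖ * ‖Q‖ ≤ ‖1 - z * Q‖ := by
    have := norm_sub_norm_le (1 : ℂ) (z * Q)
    rwa [norm_mul, norm_one] at this
  have h2 : 1 - ‖Q‖ ≤ ‖1 - z * Q‖ + κ * ‖1 - z‖ := by
    have : ‖z‖ * ‖Q‖ ≤ (1 + κ * ‖1 - z‖) * ‖Q‖ := by gcongr
    have : κ * ‖1 - z‖ * ‖Q‖ ≤ κ * ‖1 - z‖ * 1 := by gcongr; linarith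
    linarith
  have h3 : ‖1 - z‖ ≤ ‖1 - z * Q‖ + 2 * (C * (1 - ‖Q‖)) := by
    have he : 1 - z = (1 - z * Q) - z * (1 - Q) := by ring
    have h4 : ‖z * (1 - Q)‖ ≤ 2 * (C * (1 - ‖Q‖)) := by rw [norm_mul]; gcongr
    calc ‖1 - z‖ = ‖(1 - z * Q) - z * (1 - Q)‖ := by rw [← he]
      _ ≤ _ := (norm_sub_le _ _).trans (by linarith)
  set N := ‖1 - z * Q‖
  set t := ‖1 - z‖
  have ht : 0 ≤ t := norm_nonneg _
  have hN : 0 ≤ N := norm_nonneg _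
  have h4 : C * (1 - ‖Q‖) ≤ C * (N + κ * t) := by gcongr
  -- The error `2Cκt` is at most `t/2` and is absorbed on the left. What remains is `t/2 ≤ (1 + 2C)
  -- N ≤ 3CN`.
  have h5 : κ * (4 * C) * t ≤ 1 * t := by gcongr
  have h6 : t ≤ 6 * C * N := by nlinarith
  refine ⟨h6, ?_⟩
  have h7 : κ * t ≤ κ * (6 * C * N) := by gcongr
  have h8 : κ * (4 * C) * N ≤ 1 * N := by gcongr
  nlinarith

/-! ### Circle integrals and bounds for Taylor coefficients -/

lemma norm_sq_one_sub_mul_exp (R φ : ℝ) :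
    ‖1 - (R : ℂ) * Complex.exp (φ * Complex.I)‖ ^ 2 = (1 - R) ^ 2 + 2 * R * (1 - Real.cos φ) := by
  rw [← Complex.normSq_eq_norm_sq, Complex.normSq_apply, Complex.exp_mul_I, ← Complex.ofReal_cos,
    ← Complex.ofReal_sin]
  have h := Real.sin_sq_add_cos_sq φ
  generalize Real.cos φ = a at *
  generalize Real.sin φ = b at *
  simp
  linear_combination R ^ 2 * h

/-- The squared modulus is `(1 - R)^2 + 2R (1 - cos φ)`, and `1 - cos φ ≥ 2φ^2/π^2` for `|φ| ≤ π`. A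
lower bound on `R` keeps the angular term alive. -/
lemma norm_one_sub_mul_exp_ge {ρ R φ : ℝ} (hρ : 0 < ρ) (hR : ρ ≤ R) (hR1 : R ≤ 1)
    (hφ : |φ| ≤ Real.pi) :
    Real.sqrt ρ / Real.pi * (1 - R + |φ|) ≤ ‖1 - (R : ℂ) * Complex.exp (φ * Complex.I)‖ := by
  have hpi := Real.pi_gt_three
  refine abs_le_of_sq_le_sq' ?_ (norm_nonneg _) |>.2
  rw [norm_sq_one_sub_mul_exp, mul_pow, div_pow, Real.sq_sqrt hρ.le]
  have hc := Real.cos_le_one_sub_mul_cos_sq hφ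
  have h1 : (1 - R + |φ|) ^ 2 ≤ 2 * (1 - R) ^ 2 + 2 * φ ^ 2 := by
    have h := sq_nonneg (1 - R - |φ|)
    have := sq_abs φ
    nlinarith
  have h2 : ρ / Real.pi ^ 2 ≤ 1 / 2 := by
    rw [div_le_iff₀ (by positivity)]; nlinarith
  have h3 : 2 * R * (2 / Real.pi ^ 2 * φ ^ 2) ≤ 2 * R * (1 - Real.cos φ) := by
    have : 0 ≤ R := by linarith
    gcongr
    linarith
  have h4 : ρ / Real.pi ^ 2 * φ ^ 2 ≤ R / Real.pi ^ 2 * φ ^ 2 := by gcongr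
  have h5 : 2 * R * (2 / Real.pi ^ 2 * φ ^ 2) = 4 * (R / Real.pi ^ 2 * φ ^ 2) := by ring
  have h6 : 0 ≤ R / Real.pi ^ 2 * φ ^ 2 := by
    have : 0 ≤ R := by linarith
    positivity
  calc ρ / Real.pi ^ 2 * (1 - R + |φ|) ^ 2
      ≤ ρ / Real.pi ^ 2 * (2 * (1 - R) ^ 2 + 2 * φ ^ 2) := by gcongr
    _ ≤ _ := by nlinarith [sq_nonneg (1 - R)]

lemma integral_add_rpow_le {b : ℝ} (hb : 0 < b) :
    ∫ φ in (0 : ℝ)..Real.pi, (b + φ) ^ (-(3 / 2) : ℝ) ≤ 2 * b ^ (-(1 / 2) : ℝ) := by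
  have hpi := Real.pi_pos
  have h : ∫ φ in (0 : ℝ)..Real.pi, (b + φ) ^ (-(3 / 2) : ℝ)
      = ∫ x in (b + 0)..(b + Real.pi), x ^ (-(3 / 2) : ℝ) :=
    intervalIntegral.integral_comp_add_left (fun x : ℝ => x ^ (-(3 / 2) : ℝ)) b
  rw [h, integral_rpow (Or.inr ⟨by norm_num, ?_⟩)]
  · have : 0 ≤ (b + Real.pi) ^ (-(3 / 2) + 1 : ℝ) := Real.rpow_nonneg (by positivity) _
    rw [show (-(3 / 2) + 1 : ℝ) = -(1 / 2) by norm_num] at *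
    rw [add_zero]
    linarith
  · rw [Set.uIcc_of_le (by linarith), Set.mem_Icc]
    rintro ⟨h1, -⟩; linarith

lemma integral_norm_rpow_le {ρ R : ℝ} (hρ : 0 < ρ) (hR : ρ ≤ R) (hR1 : R < 1) :
    ∫ φ in (-Real.pi)..Real.pi,
      ‖1 - (R : ℂ) * Complex.exp (φ * Complex.I)‖ ^ (-(3 / 2) : ℝ) ≤
      4 * (Real.sqrt ρ / Real.pi) ^ (-(3 / 2) : ℝ) * (1 - R) ^ (-(1 / 2) : ℝ) := by
  have hpi := Real.pi_pos
  set κ := Real.sqrt ρ / Real.pi with hκ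
  have hκ0 : 0 < κ := by positivity
  have hcont : Continuous fun φ : ℝ =>
      ‖1 - (R : ℂ) * Complex.exp (φ * Complex.I)‖ ^ (-(3 / 2) : ℝ) := by
    refine Continuous.rpow_const (by fun_prop) fun φ => Or.inl (norm_ne_zero_iff.2 fun h => ?_)
    have h1 := congrArg norm (sub_eq_zero.1 h)
    rw [norm_mul, Complex.norm_exp_ofReal_mul_I, norm_one, mul_one, Complex.norm_real,
      Real.norm_of_nonneg (by linarith)] at h1
    linarith
  have hcg : ContinuousOn (fun φ : ℝ => κ ^ (-(3 / 2) : ℝ) * (1 - R + φ) ^ (-(3 / 2) : ℝ))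
      (Set.uIcc 0 Real.pi) := by
    refine continuousOn_const.mul (ContinuousOn.rpow_const (by fun_prop) fun φ hφ => Or.inl ?_)
    rw [Set.uIcc_of_le hpi.le] at hφ
    have := hφ.1
    linarith
  have hpt : ∀ φ ∈ Set.Icc 0 Real.pi, ∀ ψ : ℝ, |ψ| = φ →
      ‖1 - (R : ℂ) * Complex.exp (ψ * Complex.I)‖ ^ (-(3 / 2) : ℝ) ≤
      κ ^ (-(3 / 2) : ℝ) * (1 - R + φ) ^ (-(3 / 2) : ℝ) := by
    intro φ hφ ψ hψ
    have h1 := norm_one_sub_mul_exp_ge hρ hR hR1.le (hψ.le.trans hφ.2)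
    rw [hψ] at h1
    rw [← Real.mul_rpow hκ0.le (by linarith [hφ.1])]
    exact Real.rpow_le_rpow_of_nonpos (mul_pos hκ0 (by linarith [hφ.1])) h1 (by norm_num)
  have hint : ∫ φ in (0 : ℝ)..Real.pi, κ ^ (-(3 / 2) : ℝ) * (1 - R + φ) ^ (-(3 / 2) : ℝ) ≤
      κ ^ (-(3 / 2) : ℝ) * (2 * (1 - R) ^ (-(1 / 2) : ℝ)) := by
    rw [intervalIntegral.integral_const_mul]
    exact mul_le_mul_of_nonneg_left (integral_add_rpow_le (by linarith))
      (Real.rpow_nonneg hκ0.le _)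
  have hA : ∫ φ in (0 : ℝ)..Real.pi,
      ‖1 - (R : ℂ) * Complex.exp (φ * Complex.I)‖ ^ (-(3 / 2) : ℝ) ≤
      κ ^ (-(3 / 2) : ℝ) * (2 * (1 - R) ^ (-(1 / 2) : ℝ)) :=
    (intervalIntegral.integral_mono_on hpi.le (hcont.intervalIntegrable _ _)
      hcg.intervalIntegrable fun φ hφ => hpt φ hφ φ (abs_of_nonneg hφ.1)).trans hint
  have hB : ∫ φ in (-Real.pi)..0,
      ‖1 - (R : ℂ) * Complex.exp (φ * Complex.I)‖ ^ (-(3 / 2) : ℝ) ≤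
      κ ^ (-(3 / 2) : ℝ) * (2 * (1 - R) ^ (-(1 / 2) : ℝ)) := by
    have h := intervalIntegral.integral_comp_neg (a := 0) (b := Real.pi) fun φ : ℝ =>
      ‖1 - (R : ℂ) * Complex.exp (φ * Complex.I)‖ ^ (-(3 / 2) : ℝ)
    rw [neg_zero] at h
    rw [← h]
    exact (intervalIntegral.integral_mono_on hpi.le
      ((hcont.comp continuous_neg).intervalIntegrable _ _) hcg.intervalIntegrable
      fun φ hφ => hpt φ hφ (-φ) (by rw [abs_neg, abs_of_nonneg hφ.1])).trans hint
  rw [← intervalIntegral.integral_add_adjacent_intervals (hcont.intervalIntegrable _ 0)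
    (hcont.intervalIntegrable 0 _)]
  linarith

/-- The map `x ↦ x^d` wraps the circle `d` times around the circle of radius `r^d`. By periodicity
the mean value is unchanged, so the case `d = 1` applies. -/
lemma integral_circle_norm_rpow_le {d : ℕ} (hd : 0 < d) {ρ r : ℝ} (hρ : 0 < ρ) (hr : ρ ≤ r ^ d)
    (hr0 : 0 ≤ r) (hr1 : r < 1) :
    ∫ θ in (0 : ℝ)..2 * Real.pi, ‖1 - (circleMap 0 r θ) ^ d‖ ^ (-(3 / 2) : ℝ) ≤
      4 * (Real.sqrt ρ / Real.pi) ^ (-(3 / 2) : ℝ) * (1 - r) ^ (-(1 / 2) : ℝ) := by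
  set R := r ^ d with hRdef
  have hR1 : R < 1 := pow_lt_one₀ hr0 hr1 hd.ne'
  set G : ℝ → ℝ := fun φ => ‖1 - (R : ℂ) * Complex.exp (φ * Complex.I)‖ ^ (-(3 / 2) : ℝ) with hG
  have hcont : Continuous G := by
    refine Continuous.rpow_const (by fun_prop) fun φ => Or.inl (norm_ne_zero_iff.2 fun h => ?_)
    have h1 := congrArg norm (sub_eq_zero.1 h)
    rw [norm_mul, Complex.norm_exp_ofReal_mul_I, norm_one, mul_one, Complex.norm_real,
      Real.norm_of_nonneg (by linarith)] at h1
    linarith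
  have hper : Function.Periodic G (2 * Real.pi) := fun φ => by
    simp only [hG]
    push_cast
    rw [add_mul, Complex.exp_add, Complex.exp_two_pi_mul_I, mul_one]
  have h1 : ∀ θ : ℝ, ‖1 - (circleMap 0 r θ) ^ d‖ ^ (-(3 / 2) : ℝ) = G (d * θ) := fun θ => by
    simp only [hG, circleMap, zero_add, mul_pow, ← Complex.exp_nat_mul, hRdef]
    push_cast
    ring_nf
  simp_rw [h1]
  have hd0 : (d : ℝ) ≠ 0 := by positivity
  rw [intervalIntegral.integral_comp_mul_left G hd0]
  have h2 := hper.intervalIntegral_add_zsmul_eq d 0 (fun _ _ => hcont.intervalIntegrable _ _)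
  have h3 : ∫ φ in (0 : ℝ)..0 + 2 * Real.pi, G φ = ∫ φ in (-Real.pi)..Real.pi, G φ := by
    rw [hper.intervalIntegral_add_eq 0 (-Real.pi)]
    congr 1; ring
  rw [h3] at h2
  have h4 : (0 : ℝ) + (d : ℤ) • (2 * Real.pi) = d * (2 * Real.pi) := by simp
  rw [h4] at h2
  rw [mul_zero, h2, natCast_zsmul, nsmul_eq_mul, smul_eq_mul, inv_mul_cancel_left₀ hd0]
  refine (integral_norm_rpow_le hρ hr hR1).trans ?_
  refine mul_le_mul_of_nonneg_left ?_
    (mul_nonneg (by norm_num) (Real.rpow_nonneg (by positivity) _))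
  exact Real.rpow_le_rpow_of_nonpos (by linarith)
    (by linarith [pow_le_of_le_one hr0 hr1.le hd.ne']) (by norm_num)

/-- Bound for the coefficients of a function in the unit disc by an integral of its derivative. -/
lemma norm_coeff_le_integral_deriv {f : ℂ → ℂ} {h : ℕ → ℂ} (hf : DifferentiableOn ℂ f
    (Metric.ball 0 1)) {ε : ℝ} (hε : 0 < ε) (hh : ∀ x : ℂ, ‖x‖ < ε →
      HasSum (fun n => h n * x ^ n) (f x)) {r : ℝ} (hr0 : 0 < r) (hr1 : r < 1) (n : ℕ) :
    (n + 1) * ‖h (n + 1)‖ ≤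
      ((2 * Real.pi)⁻¹ * ∫ θ in (0 : ℝ)..2 * Real.pi, ‖deriv f (circleMap 0 r θ)‖) * r⁻¹ ^ n := by
  have hball : Metric.ball (0 : ℂ) 1 ∈ 𝓝 (0 : ℂ) := Metric.ball_mem_nhds _ one_pos
  have hfa : AnalyticAt ℂ f 0 := hf.analyticAt hball
  have hP : HasFPowerSeriesAt f (FormalMultilinearSeries.ofScalars ℂ h) 0 := by
    rw [hasFPowerSeriesAt_iff]
    filter_upwards [Metric.ball_mem_nhds (0 : ℂ) hε] with x hx
    rw [zero_add]
    refine (hh x (by simpa using hx)).congr_fun fun n => ?_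
    rw [FormalMultilinearSeries.coeff_ofScalars, smul_eq_mul, mul_comm]
  -- The expansion is known only near `0`. Uniqueness of Taylor coefficients lets Cauchy's formula
  -- for `f'` be applied on the larger circle of radius `r`.
  have hc1 : ∀ n, h n = iteratedDeriv n f 0 / (n.factorial : ℂ) := fun n => by
    have := congrArg (fun P : FormalMultilinearSeries ℂ ℂ ℂ => P.coeff n)
      (hP.eq_formalMultilinearSeries hfa.hasFPowerSeriesAt)
    simpa only [FormalMultilinearSeries.coeff_ofScalars] using this
  have hdf : DifferentiableOn ℂ (deriv f) (Metric.ball 0 1) := hf.deriv Metric.isOpen_ball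
  have hda : AnalyticAt ℂ (deriv f) 0 := hdf.analyticAt hball
  lift r to NNReal using hr0.le
  have hcau := (hdf.mono (Metric.closedBall_subset_ball hr1)).hasFPowerSeriesOnBall
    (by exact_mod_cast hr0)
  have hc2 : (cauchyPowerSeries (deriv f) 0 r).coeff n
      = iteratedDeriv n (deriv f) 0 / (n.factorial : ℂ) := by
    have := congrArg (fun P : FormalMultilinearSeries ℂ ℂ ℂ => P.coeff n)
      (hcau.hasFPowerSeriesAt.eq_formalMultilinearSeries hda.hasFPowerSeriesAt)
    simpa only [FormalMultilinearSeries.coeff_ofScalars] using this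
  have hc3 : (cauchyPowerSeries (deriv f) 0 r).coeff n = (n + 1) * h (n + 1) := by
    rw [hc2, hc1, iteratedDeriv_succ', Nat.factorial_succ]
    have : (n.factorial : ℂ) ≠ 0 := by exact_mod_cast n.factorial_ne_zero
    have h2 : (n + 1 : ℂ) ≠ 0 := by exact_mod_cast n.succ_ne_zero
    push_cast
    field_simp
  have hle := norm_cauchyPowerSeries_le (deriv f) 0 r n
  rw [abs_of_pos hr0] at hle
  have hn : ‖(cauchyPowerSeries (deriv f) 0 r).coeff n‖ ≤ ‖cauchyPowerSeries (deriv f) 0 r n‖ := by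
    rw [FormalMultilinearSeries.norm_apply_eq_norm_coef]
  refine le_trans (le_of_eq ?_) (hn.trans hle)
  rw [hc3, norm_mul]
  congr 1
  rw [← Nat.cast_add_one n, ← Nat.cast_add_one n, Complex.norm_natCast]

/-- Functions whose derivative is of order `|1 - x^d|^(-3/2)` have coefficients of order
`n^(-1/2)`. -/
lemma exists_coeff_bound {d : ℕ} (hd : 0 < d) : ∃ C : ℝ, 0 < C ∧ ∀ (f : ℂ → ℂ) (h : ℕ → ℂ) (K : ℝ),
    0 ≤ K → DifferentiableOn ℂ f (Metric.ball 0 1) →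
    (∀ x : ℂ, ‖x‖ < 1 → ‖deriv f x‖ ≤ K * ‖1 - x ^ d‖ ^ (-(3 / 2) : ℝ)) →
    (∃ ε : ℝ, 0 < ε ∧ ∀ x : ℂ, ‖x‖ < ε → HasSum (fun n => h n * x ^ n) (f x)) →
    ∀ n : ℕ, ‖h (n + 1)‖ ≤ C * K * ((n + 1 : ℕ) : ℝ) ^ (-(1 / 2) : ℝ) := by
  set B := 4 * (Real.sqrt ((1 / 2 : ℝ) ^ d) / Real.pi) ^ (-(3 / 2) : ℝ) with hB
  have hB0 : 0 < B := by positivity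
  refine ⟨(2 * Real.pi)⁻¹ * (B * 2 ^ (1 / 2 : ℝ)) * 2, by positivity,
    fun f h K hK hf hbd ⟨ε, hε, hh⟩ n => ?_⟩
  set N : ℝ := ((n + 1 : ℕ) : ℝ) with hN
  have hN1 : 1 ≤ N := by rw [hN]; exact_mod_cast Nat.succ_pos n
  -- With this radius `r⁻¹ ^ n ≤ 2` by Bernoulli's inequality, while `(1 - r)^(-1/2)` is of order
  -- `N^(1/2)`.
  set r : ℝ := 1 - 1 / (2 * N) with hr
  have hrN : 1 / (2 * N) ≤ 1 / 2 := by
    rw [div_le_div_iff₀ (by positivity) (by positivity)]; linarith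
  have hrpos : 0 < 1 / (2 * N) := by positivity
  have hr0 : 1 / 2 ≤ r := by linarith
  have hr1 : r < 1 := by linarith
  have h1 := norm_coeff_le_integral_deriv hf hε hh (by linarith : 0 < r) hr1 n
  have hcirc : ∀ θ, ‖circleMap 0 r θ‖ < 1 := fun θ => by
    simp [abs_of_nonneg (by linarith : 0 ≤ r), hr1]
  have hxd : ∀ θ, 1 - circleMap 0 r θ ^ d ≠ 0 := fun θ h => by
    have h2 := congrArg norm (sub_eq_zero.1 h)
    rw [norm_one, norm_pow] at h2
    exact absurd h2.symm (pow_lt_one₀ (norm_nonneg _) (hcirc θ) hd.ne').ne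
  have hcont : Continuous fun θ => ‖deriv f (circleMap 0 r θ)‖ := by
    have hdf : DifferentiableOn ℂ (deriv f) (Metric.ball 0 1) := hf.deriv Metric.isOpen_ball
    exact (hdf.continuousOn.comp_continuous (continuous_circleMap 0 r)
      fun θ => by simpa using hcirc θ).norm
  have hcont2 : Continuous fun θ => K * ‖1 - circleMap 0 r θ ^ d‖ ^ (-(3 / 2) : ℝ) :=
    continuous_const.mul (Continuous.rpow_const
      (continuous_const.sub ((continuous_circleMap 0 r).pow d)).norm
      fun θ => Or.inl (norm_ne_zero_iff.2 (hxd θ)))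
  have h2 : ∫ θ in (0 : ℝ)..2 * Real.pi, ‖deriv f (circleMap 0 r θ)‖ ≤
      K * (B * (1 - r) ^ (-(1 / 2) : ℝ)) := by
    refine (intervalIntegral.integral_mono_on Real.two_pi_pos.le (hcont.intervalIntegrable _ _)
      (hcont2.intervalIntegrable _ _) fun θ _ => hbd _ (hcirc θ)).trans ?_
    rw [intervalIntegral.integral_const_mul]
    refine mul_le_mul_of_nonneg_left ?_ hK
    exact integral_circle_norm_rpow_le hd (by positivity) (by gcongr) (by linarith) hr1
  have h3 : r⁻¹ ^ n ≤ 2 := by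
    have hb := one_add_mul_le_pow (show (-2 : ℝ) ≤ -(1 / (2 * N)) by linarith) n
    have hb2 : 1 / 2 ≤ r ^ n := by
      have : (n : ℝ) * (1 / (2 * N)) ≤ 1 / 2 := by
        rw [mul_one_div, div_le_div_iff₀ (by positivity) (by positivity), hN]; push_cast; linarith
      rw [hr, sub_eq_add_neg]
      linarith
    rw [inv_pow]
    exact (inv_anti₀ (by norm_num) hb2).trans (by norm_num)
  have h4 : (1 - r) ^ (-(1 / 2) : ℝ) = 2 ^ (1 / 2 : ℝ) * N ^ (1 / 2 : ℝ) := by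
    rw [hr, sub_sub_cancel, one_div, Real.inv_rpow (by positivity), Real.rpow_neg (by positivity),
      inv_inv, Real.mul_rpow (by norm_num) (by positivity)]
  have hN' : (n + 1 : ℝ) = N := by rw [hN]; push_cast; rfl
  rw [hN'] at h1
  have h5 : N * ‖h (n + 1)‖ ≤
      (2 * Real.pi)⁻¹ * (K * (B * (2 ^ (1 / 2 : ℝ) * N ^ (1 / 2 : ℝ)))) * 2 := by
    rw [h4] at h2
    refine h1.trans ?_
    gcongr
  have h6 : N ^ (-(1 / 2) : ℝ) * N = N ^ (1 / 2 : ℝ) := by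
    rw [← Real.rpow_add_one (by positivity)]; norm_num
  refine le_of_mul_le_mul_right (a := N) ?_ (by positivity)
  rw [mul_assoc, h6]
  calc ‖h (n + 1)‖ * N = N * ‖h (n + 1)‖ := mul_comm _ _
    _ ≤ _ := h5
    _ = _ := by ring

/-! ### The bivariate generating function and its derivative in `x` -/

/-- The generating function of the distances between pairs of vertices. -/
noncomputable def treeH (p q : ℕ → ℝ) (z x : ℂ) : ℂ :=
  (powSum q x * (z * treeQ p q x) * (1 - z * treeQ p q x)⁻¹ +
    z ^ 2 / 2 * (x * powSum (derivCoeff (derivCoeff p)) (powSum q x)) *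
      (powSum q x ^ 2 * (1 - z * treeQ p q x)⁻¹ ^ 2)) * (1 - treeQ p q x)⁻¹

section

variable {p q : ℕ → ℝ} (hp : CriticalOffspring p) (hq : IsTreeSeries p q)
include hp hq

/-- Implicit differentiation of `y = x Φ(y)`, which gives `y' = Φ(y) + Q y'`. -/
lemma IsTreeSeries.hasDerivAt {x : ℂ} (hx : ‖x‖ < 1) (hQ : 1 - treeQ p q x ≠ 0) :
    HasDerivAt (powSum q) (powSum p (powSum q x) * (1 - treeQ p q x)⁻¹) x := by
  have hxb : x ∈ Metric.ball (0 : ℂ) 1 := by simpa using hx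
  have hnhds : Metric.ball (0 : ℂ) 1 ∈ 𝓝 x := Metric.isOpen_ball.mem_nhds hxb
  have hd : HasDerivAt (powSum q) (deriv (powSum q) x) x :=
    ((differentiableOn_powSum hq.nonneg hq.summable).differentiableAt hnhds).hasDerivAt
  have h1 := (hasDerivAt_id x).mul ((hasDerivAt_powSum hp.nonneg hp.summable_deriv
    (hq.norm_lt_one hx)).comp x hd)
  have h2 : powSum q =ᶠ[𝓝 x] id * (powSum p ∘ powSum q) := by
    filter_upwards [hnhds] with w hw
    exact hq.eq w (by simpa using hw)
  have h3 := (h1.congr_of_eventuallyEq h2).unique hd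
  have h4 : deriv (powSum q) x = powSum p (powSum q x) * (1 - treeQ p q x)⁻¹ := by
    rw [eq_mul_inv_iff_mul_eq₀ hQ, treeQ]
    simp only [id_eq, Function.comp_apply] at h3
    linear_combination -h3
  rwa [h4] at hd

-- The third moment may be infinite, so `Φ'''` is controlled only by Cauchy's estimate on a disc of
-- radius `(1 - |s|)/2`. This costs one factor `1/(1 - |s|)`.
omit hq in
lemma CriticalOffspring.exists_deriv_bound : ∃ V : ℝ, 1 ≤ V ∧ ∀ s : ℂ, ‖s‖ < 1 →
    ‖powSum (derivCoeff (derivCoeff p)) s‖ ≤ V ∧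
    ∃ w : ℂ, HasDerivAt (powSum (derivCoeff (derivCoeff p))) w s ∧ ‖w‖ ≤ V * (1 - ‖s‖)⁻¹ := by
  have hn := derivCoeff_nonneg (derivCoeff_nonneg hp.nonneg)
  set V := ∑' m, derivCoeff (derivCoeff p) m
  have hV : 0 ≤ V := tsum_nonneg hn
  refine ⟨2 * V + 1, by linarith, fun s hs =>
    ⟨?_, deriv (powSum (derivCoeff (derivCoeff p))) s, ?_, ?_⟩⟩
  · exact (norm_powSum_le hn hp.summable_deriv2 hs.le).trans (by linarith)
  · exact ((differentiableOn_powSum hn hp.summable_deriv2).differentiableAt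
      (Metric.isOpen_ball.mem_nhds (by simpa using hs))).hasDerivAt
  · have hsub : Metric.closedBall s ((1 - ‖s‖) / 2) ⊆ Metric.ball 0 1 := fun w hw => by
      rw [mem_closedBall_iff_norm] at hw
      rw [mem_ball_zero_iff]
      have := norm_le_norm_add_norm_sub' w s
      linarith
    refine (Complex.norm_deriv_le_of_forall_mem_sphere_norm_le (R := (1 - ‖s‖) / 2) (C := V)
      (by linarith) ?_ ?_).trans ?_
    · exact (differentiableOn_powSum hn hp.summable_deriv2).diffContOnCl_ball hsub
    · intro w hw
      have := hsub (Metric.sphere_subset_closedBall hw)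
      exact norm_powSum_le hn hp.summable_deriv2 (by simpa using (mem_ball_zero_iff.1 this).le)
    · have h0 : 0 < 1 - ‖s‖ := by linarith
      rw [div_div_eq_mul_div, div_eq_mul_inv]
      gcongr
      linarith

-- The product rule for `treeH`, with `u = (1 - zQ)⁻¹`, `v = (1 - Q)⁻¹`, `F = Φ''(y)` and a
-- subscript `₁` for derivatives in `x`. Here `α` stands for `1/|1 - z|` and `ε` for `1/(1 - |y|)`;
-- every term must be kept within `α^2 ε^3`.
omit hp hq in
lemma norm_treeH_deriv_le {B α ε : ℝ} (hB : 1 ≤ B) (hα : 1 ≤ 3 * α) (hε : 1 ≤ ε)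
    {z x y y₁ Q Q₁ u u₁ v v₁ F F₁ : ℂ} (hz : ‖z‖ ≤ 2) (hx : ‖x‖ ≤ 1) (hy : ‖y‖ ≤ 1)
    (hy₁ : ‖y₁‖ ≤ B * ε) (hQ : ‖Q‖ ≤ 1) (hQ₁ : ‖Q₁‖ ≤ 2 * B ^ 2 * ε) (hu : ‖u‖ ≤ B * α)
    (hu' : ‖u‖ ≤ B * ε) (hu₁ : u₁ = z * Q₁ * u ^ 2) (hv : ‖v‖ ≤ B * ε) (hv₁ : v₁ = Q₁ * v ^ 2)
    (hF : ‖F‖ ≤ B) (hF₁ : ‖F₁‖ ≤ B * ε) :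
    ‖(y₁ * (z * Q) * u + y * (z * Q₁) * u + y * (z * Q) * u₁ +
        z ^ 2 / 2 * (F + x * (F₁ * y₁)) * (y ^ 2 * u ^ 2) +
        z ^ 2 / 2 * (x * F) * (2 * y * y₁ * u ^ 2 + y ^ 2 * (2 * (u * u₁)))) * v +
      (y * (z * Q) * u + z ^ 2 / 2 * (x * F) * (y ^ 2 * u ^ 2)) * v₁‖ ≤
      66 * B ^ 7 * α ^ 2 * ε ^ 3 := by
  have hα0 : 0 < α := by linarith
  have hε0 : 0 < ε := by linarith
  have hB0 : 0 < B := by linarith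
  set E := α ^ 2 * ε ^ 2 with hE
  have hE0 : 0 < E := by positivity
  have e1 : α * ε ≤ 3 * E := by
    have : α * ε * 1 ≤ α * ε * (3 * α * ε) :=
      mul_le_mul_of_nonneg_left (by nlinarith) (by positivity)
    rw [hE]; linarith
  have e2 : α ^ 2 * ε ≤ E := by
    rw [hE]
    exact mul_le_mul_of_nonneg_left (by nlinarith) (by positivity)
  have e3 : α ^ 2 ≤ α ^ 2 * ε := le_mul_of_one_le_right (by positivity) hε
  have e4 : α ≤ 3 * α ^ 2 := by nlinarith
  have hBp : ∀ k : ℕ, k ≤ 6 → B ^ k ≤ B ^ 6 := fun k hk => pow_le_pow_right₀ hB hk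
  have hz2 : ‖z ^ 2 / 2‖ ≤ 2 := by
    rw [norm_div, norm_pow, Complex.norm_ofNat]
    nlinarith [norm_nonneg z]
  have hy2 : ‖y ^ 2‖ ≤ 1 := by rw [norm_pow]; exact pow_le_one₀ (norm_nonneg _) hy
  have hu2 : ‖u ^ 2‖ ≤ (B * α) ^ 2 := by rw [norm_pow]; gcongr
  have hv2 : ‖v ^ 2‖ ≤ (B * ε) ^ 2 := by rw [norm_pow]; gcongr
  have hu₁' : ‖u₁‖ ≤ 2 * (2 * B ^ 2 * ε) * (B * α) ^ 2 := by
    rw [hu₁]; exact norm_mul_le_of_le (norm_mul_le_of_le hz hQ₁) hu2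
  have hv₁' : ‖v₁‖ ≤ (2 * B ^ 2 * ε) * (B * ε) ^ 2 := by
    rw [hv₁]; exact norm_mul_le_of_le hQ₁ hv2
  have h2 : ‖(2 : ℂ)‖ ≤ 2 := by simp
  have t1 : ‖y₁ * (z * Q) * u‖ ≤ 6 * B ^ 6 * E := by
    refine (norm_mul_le_of_le (norm_mul_le_of_le hy₁ (norm_mul_le_of_le hz hQ)) hu).trans ?_
    calc B * ε * (2 * 1) * (B * α) = 2 * B ^ 2 * (α * ε) := by ring
      _ ≤ 2 * B ^ 6 * (3 * E) := by gcongr ?_ * ?_ * ?_; exact hBp 2 (by norm_num)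
      _ = _ := by ring
  have t2 : ‖y * (z * Q₁) * u‖ ≤ 12 * B ^ 6 * E := by
    refine (norm_mul_le_of_le (norm_mul_le_of_le hy (norm_mul_le_of_le hz hQ₁)) hu).trans ?_
    calc 1 * (2 * (2 * B ^ 2 * ε)) * (B * α) = 4 * B ^ 3 * (α * ε) := by ring
      _ ≤ 4 * B ^ 6 * (3 * E) := by gcongr ?_ * ?_ * ?_; exact hBp 3 (by norm_num)
      _ = _ := by ring
  have t3 : ‖y * (z * Q) * u₁‖ ≤ 8 * B ^ 6 * E := by
    refine (norm_mul_le_of_le (norm_mul_le_of_le hy (norm_mul_le_of_le hz hQ)) hu₁').trans ?_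
    calc 1 * (2 * 1) * (2 * (2 * B ^ 2 * ε) * (B * α) ^ 2) = 8 * B ^ 4 * (α ^ 2 * ε) := by ring
      _ ≤ 8 * B ^ 6 * E := by gcongr ?_ * ?_ * ?_; exact hBp 4 (by norm_num)
  have t4 : ‖z ^ 2 / 2 * (F + x * (F₁ * y₁)) * (y ^ 2 * u ^ 2)‖ ≤ 4 * B ^ 6 * E := by
    have h : ‖F + x * (F₁ * y₁)‖ ≤ 2 * (B * ε) ^ 2 := by
      refine (norm_add_le_of_le hF (norm_mul_le_of_le hx (norm_mul_le_of_le hF₁ hy₁))).trans ?_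
      have : 1 * 1 ≤ B * ε := by gcongr
      have : B * 1 ≤ B * ε := by gcongr
      nlinarith
    refine (norm_mul_le_of_le (norm_mul_le_of_le hz2 h) (norm_mul_le_of_le hy2 hu2)).trans ?_
    calc 2 * (2 * (B * ε) ^ 2) * (1 * (B * α) ^ 2) = 4 * B ^ 4 * E := by rw [hE]; ring
      _ ≤ 4 * B ^ 6 * E := by gcongr ?_ * ?_ * ?_; exact hBp 4 (by norm_num)
  -- The product `u * u₁` contains `u^3`. Two factors are bounded by `Bα` and the third by `Bε`,
  -- which keeps the exponent of `1/|1 - z|` at two.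
  have t5 : ‖z ^ 2 / 2 * (x * F) * (2 * y * y₁ * u ^ 2 + y ^ 2 * (2 * (u * u₁)))‖
      ≤ 20 * B ^ 6 * E := by
    refine (norm_mul_le_of_le (norm_mul_le_of_le hz2 (norm_mul_le_of_le hx hF))
      (norm_add_le_of_le (norm_mul_le_of_le (norm_mul_le_of_le (norm_mul_le_of_le h2 hy) hy₁) hu2)
        (norm_mul_le_of_le hy2 (norm_mul_le_of_le h2 (norm_mul_le_of_le hu' hu₁'))))).trans ?_
    calc _ = 4 * B ^ 4 * (α ^ 2 * ε) + 16 * B ^ 6 * E := by rw [hE]; ring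
      _ ≤ 4 * B ^ 6 * E + 16 * B ^ 6 * E := by
        gcongr ?_ + _
        gcongr ?_ * ?_ * ?_; exact hBp 4 (by norm_num)
      _ = _ := by ring
  have t6 : ‖y * (z * Q) * u + z ^ 2 / 2 * (x * F) * (y ^ 2 * u ^ 2)‖ ≤ 8 * B ^ 3 * α ^ 2 := by
    refine (norm_add_le_of_le
      (norm_mul_le_of_le (norm_mul_le_of_le hy (norm_mul_le_of_le hz hQ)) hu)
      (norm_mul_le_of_le (norm_mul_le_of_le hz2 (norm_mul_le_of_le hx hF))
        (norm_mul_le_of_le hy2 hu2))).trans ?_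
    calc _ = 2 * B ^ 1 * α + 2 * B ^ 3 * α ^ 2 := by ring
      _ ≤ 2 * B ^ 3 * (3 * α ^ 2) + 2 * B ^ 3 * α ^ 2 := by
        gcongr ?_ + _
        gcongr ?_ * ?_ * ?_; exact pow_le_pow_right₀ hB (by norm_num)
      _ = _ := by ring
  refine (norm_add_le_of_le (norm_mul_le_of_le (norm_add_le_of_le (norm_add_le_of_le
    (norm_add_le_of_le (norm_add_le_of_le t1 t2) t3) t4) t5) hv)
    (norm_mul_le_of_le t6 hv₁')).trans (le_of_eq ?_)
  rw [hE]; ring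

/-- The generating function is analytic in the disc, with a bound for its derivative. -/
theorem IsTreeSeries.exists_treeH_bound {d : ℕ} (hd : IsSpan p d) :
    ∃ κ K : ℝ, 0 < κ ∧ κ ≤ 1 ∧ 0 < K ∧ ∀ z : ℂ, z ≠ 1 → ‖z‖ < 2 → ‖z‖ ≤ 1 + κ * ‖1 - z‖ →
      DifferentiableOn ℂ (treeH p q z) (Metric.ball 0 1) ∧ ∀ x : ℂ, ‖x‖ < 1 →
        ‖deriv (treeH p q z) x‖ ≤ K * (‖1 - z‖ ^ 2)⁻¹ * ‖1 - x ^ d‖ ^ (-(3 / 2) : ℝ) := by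
  obtain ⟨C, hC, hbd⟩ := hq.exists_bounds hp hd
  obtain ⟨V, hV, hF⟩ := hp.exists_deriv_bound
  set B := 6 * C * C * V with hBdef
  have hC0 : 0 < C := by linarith
  have hV0 : 0 < V := by linarith
  have hCC : 1 ≤ C * C := by nlinarith
  have hB0 : 0 < B := by positivity
  have hB6 : 6 * C * C ≤ B := le_mul_of_one_le_right (by positivity) hV
  have hB6' : 6 * C ≤ B := (le_mul_of_one_le_right (by positivity) hC).trans hB6
  have hBV : V ≤ B := by
    rw [hBdef]; exact le_mul_of_one_le_left hV0.le (by linarith)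
  have hBC : C ≤ B := by linarith
  have hB1 : 1 ≤ B := by linarith
  refine ⟨1 / (4 * C), 66 * B ^ 7 * C ^ (3 / 2 : ℝ), by positivity, ?_, by positivity, ?_⟩
  · rw [div_le_one (by positivity)]; linarith
  intro z hz1 hz2 hz
  have hα0 : 0 < ‖1 - z‖ := norm_pos_iff.2 (sub_ne_zero.2 hz1.symm)
  have hα3 : ‖1 - z‖ ≤ 3 := (norm_sub_le _ _).trans (by rw [norm_one]; linarith)
  have hα : 1 ≤ 3 * ‖1 - z‖⁻¹ := by
    rw [← div_eq_mul_inv, le_div_iff₀ hα0]; linarith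
  have main : ∀ x : ℂ, ‖x‖ < 1 → ∃ w : ℂ, HasDerivAt (treeH p q z) w x ∧
      ‖w‖ ≤ 66 * B ^ 7 * ‖1 - z‖⁻¹ ^ 2 * (1 - ‖powSum q x‖)⁻¹ ^ 3 := by
    intro x hx
    obtain ⟨-, h2, h3⟩ := hbd x hx
    have hy := hq.norm_lt_one hx
    have hD : 0 < 1 - ‖powSum q x‖ := by linarith
    have hQ1 : 0 < 1 - ‖treeQ p q x‖ := pos_of_mul_pos_right (hD.trans_le h2) hC0.le
    obtain ⟨h4, h5⟩ := norm_one_sub_mul_ge hC (by positivity : 0 < 1 / (4 * C))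
      (by field_simp; rfl) hz2.le hz h3
    have hzQ : 0 < ‖1 - z * treeQ p q x‖ :=
      pos_of_mul_pos_right (hα0.trans_le h4) (by positivity)
    have hzQ' : 1 - z * treeQ p q x ≠ 0 := norm_pos_iff.1 hzQ
    have h1Q : 1 - ‖treeQ p q x‖ ≤ ‖1 - treeQ p q x‖ := by
      have := norm_sub_norm_le (1 : ℂ) (treeQ p q x)
      rwa [norm_one] at this
    have hQ' : 1 - treeQ p q x ≠ 0 := norm_pos_iff.1 (hQ1.trans_le h1Q)
    have hε : 1 ≤ (1 - ‖powSum q x‖)⁻¹ :=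
      (one_le_inv₀ hD).2 (by linarith [norm_nonneg (powSum q x)])
    obtain ⟨hFb, F₁, hF₁, hF₁b⟩ := hF _ hy
    have hdy := hq.hasDerivAt hp hx hQ'
    set y₁ := powSum p (powSum q x) * (1 - treeQ p q x)⁻¹ with hy₁
    have hdF := hF₁.comp x hdy
    have hdΦ := (hasDerivAt_powSum (derivCoeff_nonneg hp.nonneg) hp.summable_deriv2 hy).comp x hdy
    have hdQ := (hasDerivAt_id x).mul hdΦ
    set F := powSum (derivCoeff (derivCoeff p)) (powSum q x) with hFdef
    set Q₁ := powSum (derivCoeff p) (powSum q x) + x * (F * y₁) with hQ₁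
    have hdQ' : HasDerivAt (treeQ p q) Q₁ x := by
      refine hdQ.congr_deriv ?_
      simp [hQ₁]
    have hdu := ((hdQ'.const_mul z).const_sub 1).fun_inv hzQ'
    have hdv := (hdQ'.const_sub 1).fun_inv hQ'
    have hv : ‖(1 - treeQ p q x)⁻¹‖ ≤ B * (1 - ‖powSum q x‖)⁻¹ := by
      rw [norm_inv, ← div_eq_mul_inv, le_div_iff₀ hD, inv_mul_le_iff₀ (hQ1.trans_le h1Q)]
      nlinarith
    have hu : ‖(1 - z * treeQ p q x)⁻¹‖ ≤ B * ‖1 - z‖⁻¹ := by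
      rw [norm_inv, ← div_eq_mul_inv, le_div_iff₀ hα0, inv_mul_le_iff₀ hzQ]
      nlinarith
    have hu' : ‖(1 - z * treeQ p q x)⁻¹‖ ≤ B * (1 - ‖powSum q x‖)⁻¹ := by
      rw [norm_inv, ← div_eq_mul_inv, le_div_iff₀ hD, inv_mul_le_iff₀ hzQ]
      have : C * (1 - ‖treeQ p q x‖) ≤ C * (6 * C * ‖1 - z * treeQ p q x‖) := by gcongr
      nlinarith
    have hΦ := hp.norm_pgf_le hy.le
    have hΦ₁ := hp.norm_deriv_le hy.le
    have hy₁b : ‖y₁‖ ≤ B * (1 - ‖powSum q x‖)⁻¹ := by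
      rw [hy₁, norm_mul]
      exact (mul_le_of_le_one_left (norm_nonneg _) hΦ).trans hv
    have hQ₁b : ‖Q₁‖ ≤ 2 * B ^ 2 * (1 - ‖powSum q x‖)⁻¹ := by
      refine (norm_add_le_of_le hΦ₁ (norm_mul_le_of_le hx.le
        (norm_mul_le_of_le (hFb.trans hBV) hy₁b))).trans ?_
      have : 1 * 1 ≤ B ^ 2 * (1 - ‖powSum q x‖)⁻¹ := by
        gcongr
        exact one_le_pow₀ hB1
      nlinarith
    refine ⟨_, ?_, norm_treeH_deriv_le hB1 hα hε hz2.le hx.le hy.le hy₁b (by linarith)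
      hQ₁b hu hu' rfl hv rfl (hFb.trans hBV) (hF₁b.trans (by gcongr)) (Q := treeQ p q x)⟩
    have hd := (((hdy.mul (hdQ'.const_mul z)).mul hdu).add
      ((((hasDerivAt_id x).mul hdF).const_mul (z ^ 2 / 2)).mul
        ((hdy.pow 2).mul (hdu.pow 2)))).mul hdv
    refine HasDerivAt.congr_deriv (f := treeH p q z) hd ?_
    simp only [Pi.mul_apply, Pi.add_apply, Pi.pow_apply, id_eq, Function.comp_apply, ← hFdef,
      Nat.reduceSub, pow_one, div_eq_mul_inv, ← inv_pow, Nat.cast_ofNat]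
    ring
  refine ⟨fun x hx => ?_, fun x hx => ?_⟩
  · obtain ⟨w, hw, -⟩ := main x (by simpa using hx)
    exact hw.differentiableAt.differentiableWithinAt
  · obtain ⟨w, hw, hwb⟩ := main x hx
    rw [hw.deriv]
    refine hwb.trans ?_
    obtain ⟨h1, -, -⟩ := hbd x hx
    have hy := hq.norm_lt_one hx
    have hD : 0 < 1 - ‖powSum q x‖ := by linarith
    have hxd : 0 < ‖1 - x ^ d‖ := by
      rw [norm_pos_iff, sub_ne_zero]
      intro h
      have h2 := congrArg norm h
      rw [norm_one, norm_pow] at h2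
      exact absurd h2.symm (pow_lt_one₀ (norm_nonneg _) hx hd.pos.ne').ne
    -- The third power of `1/(1 - |y|)` becomes `|1 - x^d|^(-3/2)` through `|1 - x^d| ≤ C (1 -
    -- |y|)^2`.
    have h6 : (C * (1 - ‖powSum q x‖) ^ 2) ^ (-(3 / 2) : ℝ) ≤ ‖1 - x ^ d‖ ^ (-(3 / 2) : ℝ) :=
      Real.rpow_le_rpow_of_nonpos hxd h1 (by norm_num)
    have h7 : (C * (1 - ‖powSum q x‖) ^ 2) ^ (-(3 / 2) : ℝ)
        = (C ^ (3 / 2 : ℝ))⁻¹ * (1 - ‖powSum q x‖)⁻¹ ^ 3 := by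
      rw [Real.mul_rpow hC0.le (by positivity), Real.rpow_neg hC0.le, ← Real.rpow_natCast _ 2,
        ← Real.rpow_mul hD.le, inv_pow, ← Real.rpow_natCast _ 3, ← Real.rpow_neg hD.le]
      norm_num
    rw [h7, inv_mul_le_iff₀ (by positivity)] at h6
    rw [inv_pow ‖1 - z‖] at *
    calc _ ≤ 66 * B ^ 7 * (‖1 - z‖ ^ 2)⁻¹ * (C ^ (3 / 2 : ℝ) * ‖1 - x ^ d‖ ^ (-(3 / 2) : ℝ)) := by
          gcongr
      _ = _ := by ring

end

/-! ### Lagrange inversion by contour integrals -/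

/-- Termwise integration over a circle. -/
lemma hasSum_circleIntegral_mul {ρ : ℝ} (hρ : 0 ≤ ρ) {c : ℕ → ℝ} (hc : ∀ n, 0 ≤ c n)
    (hs : Summable c) {g M S : ℂ → ℂ} (hg : ContinuousOn g (Metric.sphere 0 ρ))
    (hM : ContinuousOn M (Metric.sphere 0 ρ)) (hg1 : ∀ s ∈ Metric.sphere (0 : ℂ) ρ, ‖g s‖ ≤ 1)
    (hS : ∀ s ∈ Metric.sphere (0 : ℂ) ρ, S s = powSum c (g s)) :
    HasSum (fun n => (c n : ℂ) * ∮ s in C(0, ρ), g s ^ n * M s) (∮ s in C(0, ρ), S s * M s) := by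
  have hmem : ∀ θ, circleMap 0 ρ θ ∈ Metric.sphere (0 : ℂ) ρ := circleMap_mem_sphere _ hρ
  have hgc : Continuous fun θ => g (circleMap 0 ρ θ) :=
    hg.comp_continuous (continuous_circleMap 0 ρ) hmem
  have hMc : Continuous fun θ => M (circleMap 0 ρ θ) :=
    hM.comp_continuous (continuous_circleMap 0 ρ) hmem
  have hdc : Continuous fun θ => deriv (circleMap 0 ρ) θ := by
    simp only [deriv_circleMap]; exact (continuous_circleMap 0 ρ).mul continuous_const
  simp_rw [← circleIntegral.integral_const_mul, circleIntegral, smul_eq_mul]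
  refine intervalIntegral.hasSum_integral_of_dominated_convergence
    (fun n θ => c n * ‖deriv (circleMap 0 ρ) θ * M (circleMap 0 ρ θ)‖) (fun n => ?_)
    (fun n => ae_of_all _ fun θ _ => ?_) (ae_of_all _ fun θ _ => hs.mul_right _) ?_
    (ae_of_all _ fun θ _ => ?_)
  · exact (hdc.mul (continuous_const.mul ((hgc.pow n).mul hMc))).aestronglyMeasurable
  · have h1 : ‖g (circleMap 0 ρ θ) ^ n‖ ≤ 1 := by
      rw [norm_pow]; exact pow_le_one₀ (norm_nonneg _) (hg1 _ (hmem θ))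
    rw [norm_mul, norm_mul, norm_mul, norm_mul, Complex.norm_real, Real.norm_of_nonneg (hc n)]
    have := mul_le_mul_of_nonneg_right h1 (norm_nonneg (M (circleMap 0 ρ θ)))
    rw [one_mul] at this
    calc _ = c n * (‖deriv (circleMap 0 ρ) θ‖ * (‖g (circleMap 0 ρ θ) ^ n‖ *
            ‖M (circleMap 0 ρ θ)‖)) := by ring
      _ ≤ _ := by gcongr; exact hc n
  · simp_rw [tsum_mul_right]
    exact (continuous_const.mul (hdc.mul hMc).norm).intervalIntegrable _ _
  · rw [hS _ (hmem θ)]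
    have := (hasSum_powSum hc hs (hg1 _ (hmem θ))).mul_right (M (circleMap 0 ρ θ))
    refine (this.mul_left (deriv (circleMap 0 ρ) θ)).congr_fun fun n => ?_
    ring

section

variable {p q : ℕ → ℝ} (hp : CriticalOffspring p) (hq : IsTreeSeries p q)
include hp hq

/-- Both `s` and `y(x)` are fixed points of `t ↦ x Φ(t)`, a strict contraction of the disc because
`|x| < 1` and `Φ` is 1-Lipschitz there. -/
lemma IsTreeSeries.apply_div_pgf {s : ℂ} (hs : ‖s‖ < 1) (h0 : powSum p s ≠ 0)
    (h1 : ‖s / powSum p s‖ < 1) : powSum q (s / powSum p s) = s := by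
  set x := s / powSum p s with hx
  have he : s = x * powSum p s := by rw [hx, div_mul_cancel₀ _ h0]
  have he2 := hq.eq x h1
  have h3 := norm_powSum_sub_le hp.nonneg hp.summable hp.summable_deriv
    (hq.norm_lt_one h1).le hs.le
  rw [hp.tsum_deriv, one_mul] at h3
  have h4 : powSum q x - s = x * (powSum p (powSum q x) - powSum p s) := by
    linear_combination he2 - he
  have h5 := congrArg norm h4
  rw [norm_mul] at h5
  by_contra hne
  have h6 : 0 < ‖powSum q x - s‖ := norm_pos_iff.2 (sub_ne_zero.2 hne)
  nlinarith [norm_nonneg x]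

/-- **Lagrange inversion**, as a contour integral over a small circle. -/
lemma IsTreeSeries.circleIntegral_small {ρ : ℝ} (hρ : 0 < ρ) (hρ' : 4 * ρ ≤ p 0) (N : ℕ) :
    (∮ s in C(0, ρ), (s / powSum p s) ^ (-(N : ℤ))) = 2 * Real.pi * Complex.I * (N * q N) := by
  have hp0 := hp.pos_zero
  have hp1 : p 0 ≤ 1 := by
    have := le_hasSum hp.hasSum_one 0 fun j _ => hp.nonneg j
    simpa using this
  -- The bound `4ρ ≤ p 0` gives `|Φ| ≥ 3ρ`, so `|s/Φ(s)| ≤ 1/3` on the circle and `y` can be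
  -- evaluated there.
  have hΦ : ∀ s : ℂ, ‖s‖ ≤ ρ → 3 * ρ ≤ ‖powSum p s‖ := fun s hs => by
    have := hp.norm_pgf_sub_le (s := s) (by linarith)
    linarith
  have hΦ0 : ∀ s : ℂ, ‖s‖ ≤ ρ → powSum p s ≠ 0 := fun s hs =>
    norm_pos_iff.1 (by linarith [hΦ s hs])
  have hdΦ : ∀ s : ℂ, ‖s‖ < 1 → HasDerivAt (powSum p) (powSum (derivCoeff p) s) s :=
    fun s hs => hasDerivAt_powSum hp.nonneg hp.summable_deriv hs
  have hsph : ∀ s ∈ Metric.sphere (0 : ℂ) ρ, ‖s‖ = ρ := fun s hs => by simpa using hs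
  have hsub : Metric.sphere (0 : ℂ) ρ ⊆ Metric.closedBall 0 1 := fun s hs => by
    rw [mem_closedBall_zero_iff, hsph s hs]; linarith
  set ψ : ℂ → ℂ := fun s => s / powSum p s with hψ
  set ψ' : ℂ → ℂ := fun s =>
    (1 * powSum p s - s * powSum (derivCoeff p) s) / powSum p s ^ 2 with hψ'
  have hdψ : ∀ s : ℂ, ‖s‖ ≤ ρ → HasDerivAt ψ (ψ' s) s := fun s hs =>
    (hasDerivAt_id s).div (hdΦ s (by linarith)) (hΦ0 s hs)
  have hψ0 : ∀ s ∈ Metric.sphere (0 : ℂ) ρ, ψ s ≠ 0 := fun s hs => by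
    refine div_ne_zero (norm_pos_iff.1 ?_) (hΦ0 s (hsph s hs).le)
    rw [hsph s hs]; exact hρ
  have hψ1 : ∀ s ∈ Metric.sphere (0 : ℂ) ρ, ‖ψ s‖ < 1 := fun s hs => by
    have := hΦ s (hsph s hs).le
    rw [norm_div, div_lt_one (by linarith), hsph s hs]; linarith
  have hcψ : ContinuousOn ψ (Metric.sphere 0 ρ) := fun s hs =>
    (hdψ s (hsph s hs).le).continuousAt.continuousWithinAt
  have hcψ' : ContinuousOn ψ' (Metric.sphere 0 ρ) := by
    have h1 := (continuousOn_powSum hp.nonneg hp.summable).mono hsub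
    have h2 := (continuousOn_powSum (derivCoeff_nonneg hp.nonneg) hp.summable_deriv).mono hsub
    exact ((continuousOn_const.mul h1).sub (continuousOn_id.mul h2)).div (h1.pow 2)
      fun s hs => pow_ne_zero 2 (hΦ0 s (hsph s hs).le)
  have hcz : ∀ k : ℤ, ContinuousOn (fun s => ψ s ^ k) (Metric.sphere 0 ρ) := fun k =>
    hcψ.zpow₀ k fun s hs => Or.inl (hψ0 s hs)
  have hdz : ∀ k : ℤ, ∀ s ∈ Metric.sphere (0 : ℂ) ρ,
      HasDerivAt (fun s => ψ s ^ k) (k * ψ s ^ (k - 1) * ψ' s) s := fun k s hs =>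
    (hasDerivAt_zpow k _ (Or.inl (hψ0 s hs))).comp s (hdψ s (hsph s hs).le)
  have hI0 : ∀ k : ℤ, k ≠ 0 → (∮ s in C(0, ρ), ψ s ^ (k - 1) * ψ' s) = 0 := fun k hk => by
    have h := circleIntegral.integral_eq_zero_of_hasDerivWithinAt hρ.le
      fun s hs => (hdz k s hs).hasDerivWithinAt
    simp_rw [mul_assoc, circleIntegral.integral_const_mul] at h
    exact (mul_eq_zero.1 h).resolve_left (by exact_mod_cast hk)
  -- The logarithmic derivative of `s/Φ(s)` is `1/s - Φ'/Φ`, whose second part is analytic. For the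
  -- other exponents the integrand has a primitive, by `hI0`.
  have hI1 : (∮ s in C(0, ρ), ψ s ^ (-1 : ℤ) * ψ' s) = 2 * Real.pi * Complex.I := by
    have h1 : (∮ s in C(0, ρ), ψ s ^ (-1 : ℤ) * ψ' s) =
        ∮ s in C(0, ρ), ((s - 0)⁻¹ - powSum (derivCoeff p) s / powSum p s) := by
      refine circleIntegral.integral_congr hρ.le fun s hs => ?_
      have hs0 : s ≠ 0 := norm_pos_iff.1 (by rw [hsph s hs]; exact hρ)
      have := hΦ0 s (hsph s hs).le
      simp only [hψ, hψ', zpow_neg_one]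
      field_simp
      rw [sub_zero]
      ring
    have hd : DiffContOnCl ℂ (fun s => powSum (derivCoeff p) s / powSum p s)
        (Metric.ball 0 ρ) := by
      refine DifferentiableOn.diffContOnCl_ball (U := Metric.closedBall 0 ρ)
        (fun s hs => ?_) subset_rfl
      have hs' : ‖s‖ ≤ ρ := by simpa using hs
      exact ((hasDerivAt_powSum (derivCoeff_nonneg hp.nonneg) hp.summable_deriv2
        (by linarith : ‖s‖ < 1)).differentiableAt.div
        (hdΦ s (by linarith)).differentiableAt (hΦ0 s hs')).differentiableWithinAt
    rw [h1, circleIntegral.integral_sub, circleIntegral.integral_sub_center_inv _ hρ.ne',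
      hd.circleIntegral_eq_zero hρ.le, sub_zero]
    · refine ContinuousOn.circleIntegrable hρ.le ?_
      refine ContinuousOn.inv₀ (by fun_prop) fun s hs => ?_
      rw [sub_zero]; exact norm_pos_iff.1 (by rw [hsph s hs]; exact hρ)
    · exact (hd.continuousOn_ball.mono Metric.sphere_subset_closedBall).circleIntegrable hρ.le
  -- Integrating `s = ∑ q_n ψ^n` against this kernel isolates `q_N`.
  set M : ℂ → ℂ := fun s => ψ s ^ (-(N : ℤ) - 1) * ψ' s with hM
  have hcM : ContinuousOn M (Metric.sphere 0 ρ) := (hcz _).mul hcψ'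
  have hS := hasSum_circleIntegral_mul hρ.le hq.nonneg hq.summable hcψ hcM
    (fun s hs => (hψ1 s hs).le) (S := id) fun s hs =>
      (hq.apply_div_pgf hp (by rw [hsph s hs]; linarith) (hΦ0 s (hsph s hs).le) (hψ1 s hs)).symm
  have hterm : ∀ n : ℕ, (∮ s in C(0, ρ), ψ s ^ n * M s) =
      if n = N then 2 * Real.pi * Complex.I else 0 := fun n => by
    have h1 : (∮ s in C(0, ρ), ψ s ^ n * M s) =
        ∮ s in C(0, ρ), ψ s ^ (((n : ℤ) - N) - 1) * ψ' s := by
      refine circleIntegral.integral_congr hρ.le fun s hs => ?_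
      simp only [hM]
      rw [← mul_assoc, ← zpow_natCast, ← zpow_add₀ (hψ0 s hs)]
      congr 2; ring
    rw [h1]
    split_ifs with h
    · rw [← hI1, h]; simp
    · exact hI0 _ (by omega)
  simp_rw [hterm] at hS
  have hS' := hS.unique (hasSum_single N fun n hn => by simp [hn])
  rw [if_pos rfl] at hS'
  -- Integration by parts: the derivative of `s ψ^(-N)` integrates to zero over the circle.
  have hparts := circleIntegral.integral_eq_zero_of_hasDerivWithinAt hρ.le
    fun s hs => ((hasDerivAt_id s).mul (hdz (-(N : ℤ)) s hs)).hasDerivWithinAt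
  have hsplit : (∮ s in C(0, ρ), (1 * ψ s ^ (-(N : ℤ)) +
      id s * (((-(N : ℤ) : ℤ) : ℂ) * ψ s ^ (-(N : ℤ) - 1) * ψ' s))) =
      (∮ s in C(0, ρ), ψ s ^ (-(N : ℤ))) - N * ∮ s in C(0, ρ), id s * M s := by
    rw [← circleIntegral.integral_const_mul, ← circleIntegral.integral_sub]
    · refine circleIntegral.integral_congr hρ.le fun s hs => ?_
      simp only [hM]
      push_cast
      ring
    · exact (hcz _).circleIntegrable hρ.le
    · exact (continuousOn_const.mul (continuousOn_id.mul hcM)).circleIntegrable hρ.le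
  rw [hsplit, hS', sub_eq_zero] at hparts
  rw [hparts]; ring

/-- **Lagrange inversion**, as an integral over the unit circle. -/
lemma IsTreeSeries.integral_unit_circle (N : ℕ) :
    ∫ θ in (0 : ℝ)..2 * Real.pi, Complex.exp (θ * Complex.I) *
      (powSum p (Complex.exp (θ * Complex.I)) * Complex.exp (-(θ * Complex.I))) ^ N =
      2 * Real.pi * (N * q N) := by
  have hp0 := hp.pos_zero
  have hp1 : p 0 ≤ 1 := by
    have := le_hasSum hp.hasSum_one 0 fun j _ => hp.nonneg j
    simpa using this
  have h1 := hq.circleIntegral_small hp (ρ := p 0 / 4) (by positivity) (by linarith) N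
  -- The contour is enlarged to the unit circle, where `Φ` need only be continuous; `(Φ(s)/s)^N` is
  -- analytic in the annulus.
  have h2 := Complex.circleIntegral_eq_of_differentiable_on_annulus_off_countable
    (c := 0) (r := p 0 / 4) (R := 1) (by positivity) (by linarith) (Set.countable_empty)
    (f := fun s : ℂ => (powSum p s / s) ^ N) ?_ ?_
  · have h3 : (∮ s in C(0, p 0 / 4), (powSum p s / s) ^ N) =
        ∮ s in C(0, p 0 / 4), (s / powSum p s) ^ (-(N : ℤ)) := by
      congr 1; ext s
      rw [zpow_neg, zpow_natCast, ← inv_pow, inv_div]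
    rw [h3, h1] at h2
    have hI : Complex.I ≠ 0 := Complex.I_ne_zero
    refine mul_left_cancel₀ hI ?_
    rw [← intervalIntegral.integral_const_mul]
    calc _ = ∮ s in C(0, 1), (powSum p s / s) ^ N := by
          rw [circleIntegral]
          refine intervalIntegral.integral_congr fun θ _ => ?_
          simp only [deriv_circleMap, circleMap, Complex.ofReal_one, one_mul, zero_add, smul_eq_mul,
            Complex.exp_neg, ← div_eq_mul_inv]
          ring
      _ = _ := by rw [h2]; ring
  · have hc := continuousOn_powSum hp.nonneg hp.summable
    refine ((hc.mono Set.sdiff_subset).div continuousOn_id fun s hs => ?_).pow N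
    rintro rfl
    exact hs.2 (by simpa using hp0)
  · rintro s ⟨⟨hs1, hs2⟩, -⟩
    have hs0 : s ≠ 0 := by
      rintro rfl
      exact hs2 (by simpa using (by positivity : 0 ≤ p 0 / 4))
    exact (((hasDerivAt_powSum hp.nonneg hp.summable_deriv
      (by simpa using hs1)).differentiableAt).div differentiableAt_id hs0).pow N

end

/-! ### The local limit theorem and the lower bound for the size probabilities -/

lemma four_mul_sin_sq_eq (θ : ℝ) : 4 * Real.sin (θ / 2) ^ 2 = θ ^ 2 * Real.sinc (θ / 2) ^ 2 := by
  rcases eq_or_ne θ 0 with rfl | h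
  · simp
  · rw [Real.sinc_of_ne_zero (by simpa using h)]
    field_simp
    ring

lemma one_sub_exp_sq_mul (θ : ℝ) : (1 - Complex.exp (θ * Complex.I)) ^ 2 *
    Complex.exp (-(θ * Complex.I)) = -((θ ^ 2 * Real.sinc (θ / 2) ^ 2 : ℝ) : ℂ) := by
  rw [← four_mul_sin_sq_eq]
  have h1 : Complex.exp (θ * Complex.I) = Complex.exp ((θ / 2 : ℂ) * Complex.I) ^ 2 := by
    rw [← Complex.exp_nat_mul]; congr 1; push_cast; ring
  have h2 : Complex.exp (-(θ * Complex.I)) = Complex.exp (-(θ / 2 : ℂ) * Complex.I) ^ 2 := by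
    rw [← Complex.exp_nat_mul]; congr 1; push_cast; ring
  have h3 : Complex.exp ((θ / 2 : ℂ) * Complex.I) * Complex.exp (-(θ / 2 : ℂ) * Complex.I) = 1 := by
    rw [← Complex.exp_add]; simp
  push_cast
  rw [h1, h2, Complex.sin]
  set a := Complex.exp ((θ / 2 : ℂ) * Complex.I)
  set b := Complex.exp (-(θ / 2 : ℂ) * Complex.I)
  have hI : Complex.I ^ 2 = -1 := Complex.I_sq
  calc (1 - a ^ 2) ^ 2 * b ^ 2 = (b - (a * b) * a) ^ 2 := by ring
    _ = (b - a) ^ 2 := by rw [h3, one_mul]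
    _ = -(4 * ((b - a) * Complex.I / 2) ^ 2) := by rw [div_pow, mul_pow, hI]; ring

namespace CriticalOffspring

variable {p : ℕ → ℝ} (hp : CriticalOffspring p)
include hp

omit hp in
lemma norm_exp_le (θ : ℝ) : ‖Complex.exp (θ * Complex.I)‖ ≤ 1 :=
  (Complex.norm_exp_ofReal_mul_I θ).le

/-- The factor `e^(-iθ)` centres the offspring at its mean one, so the linear term disappears. The
`sinc` form is also valid at `θ = 0` and displays the factor `θ^2`. -/
lemma pgf_mul_exp (θ : ℝ) :
    powSum p (Complex.exp (θ * Complex.I)) * Complex.exp (-(θ * Complex.I)) =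
    1 + -((θ ^ 2 * Real.sinc (θ / 2) ^ 2 : ℝ) : ℂ) *
      pgfRemainder p (Complex.exp (θ * Complex.I)) := by
  have h := hp.remainder_mul (norm_exp_le θ)
  have h2 : Complex.exp (θ * Complex.I) * Complex.exp (-(θ * Complex.I)) = 1 := by
    rw [← Complex.exp_add]; simp
  rw [← one_sub_exp_sq_mul]
  linear_combination -Complex.exp (-(θ * Complex.I)) * h + h2

lemma continuous_remainder_exp :
    Continuous fun θ : ℝ => pgfRemainder p (Complex.exp (θ * Complex.I)) :=
  hp.continuousOn_remainder.comp_continuous (by fun_prop) fun θ => by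
    simp

lemma continuous_pgf_exp : Continuous fun θ : ℝ => powSum p (Complex.exp (θ * Complex.I)) :=
  (continuousOn_powSum hp.nonneg hp.summable).comp_continuous (by fun_prop) fun θ => by
    simp

/-- Quadratic bound for the characteristic function of a distribution with span `d`. -/
lemma exists_norm_pgf_exp_le {d : ℕ} (hd : IsSpan p d) : ∃ c : ℝ, 0 < c ∧
    ∀ θ ∈ Set.Icc (-(Real.pi / d)) (Real.pi / d),
      ‖powSum p (Complex.exp (θ * Complex.I))‖ ≤ 1 - c * θ ^ 2 := by
  have hpi := Real.pi_pos
  have hd0 : (0 : ℝ) < d := by exact_mod_cast hd.pos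
  have hd1 : (1 : ℝ) ≤ d := by exact_mod_cast hd.pos
  suffices h : ∃ c : ℝ, 0 < c ∧ ∀ θ ∈ Set.Icc (-(Real.pi / d)) (Real.pi / d),
      |θ| ≤ Real.pi / d →
      ‖powSum p (Complex.exp (θ * Complex.I))‖ ≤ 1 - c * θ ^ 2 by
    obtain ⟨c, hc, h⟩ := h
    exact ⟨c, hc, fun θ hθ => h θ hθ (abs_le.2 hθ)⟩
  have habs : ∀ θ : ℝ, |θ| ≤ Real.pi / d → |θ| ≤ Real.pi := fun θ hθ =>
    hθ.trans (div_le_self hpi.le hd1)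
  refine isCompact_Icc.induction_on ⟨1, one_pos, by simp⟩
    (fun S T hST ⟨c, hc, h⟩ => ⟨c, hc, fun s hs => h s (hST hs)⟩) ?_ ?_
  · rintro S T ⟨c, hc, h⟩ ⟨c', hc', h'⟩
    refine ⟨min c c', lt_min hc hc', fun θ hθ h1 => ?_⟩
    rcases hθ with hθ | hθ
    · refine (h θ hθ h1).trans ?_
      gcongr; exact min_le_left _ _
    · refine (h' θ hθ h1).trans ?_
      gcongr; exact min_le_right _ _
  · intro t ht
    -- At `0` the quadratic decay comes from the expansion with `a > 0`. Elsewhere on `[-π/d, π/d]`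
    -- the modulus is strictly below one, because the span is `d`.
    rcases eq_or_ne t 0 with rfl | ht0
    · obtain ⟨a, ha, hRa⟩ := hp.exists_remainder_one
      have h1 : ∀ᶠ θ : ℝ in 𝓝 0,
          dist (pgfRemainder p (Complex.exp (θ * Complex.I))) a < a / 2 := by
        have h := hp.continuous_remainder_exp.tendsto 0
        simp only [Complex.ofReal_zero, zero_mul, Complex.exp_zero, hRa] at h
        exact h (Metric.ball_mem_nhds _ (by positivity))
      have h2 : ∀ᶠ θ : ℝ in 𝓝 0, θ ^ 2 * a < 1 := by
        have hc : Continuous fun θ : ℝ => θ ^ 2 * a := by fun_prop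
        exact hc.continuousAt.eventually_lt continuousAt_const (by simp)
      refine ⟨_, mem_nhdsWithin_of_mem_nhds (h1.and h2), 2 * a / Real.pi ^ 2, by positivity,
        fun θ hθ hmem => ?_⟩
      obtain ⟨hR, hsmall⟩ := hθ
      rw [dist_eq_norm] at hR
      have hnorm : ‖powSum p (Complex.exp (θ * Complex.I))‖ =
          ‖powSum p (Complex.exp (θ * Complex.I)) * Complex.exp (-(θ * Complex.I))‖ := by
        rw [norm_mul, ← neg_mul, ← Complex.ofReal_neg, Complex.norm_exp_ofReal_mul_I, mul_one]
      rw [hnorm, hp.pgf_mul_exp]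
      set τ := θ ^ 2 * Real.sinc (θ / 2) ^ 2 with hτ
      have hτ0 : 0 ≤ τ := by positivity
      have hτ1 : τ ≤ θ ^ 2 := mul_le_of_le_one_right (sq_nonneg _)
        ((sq_le_one_iff_abs_le_one _).2 (Real.abs_sinc_le_one _))
      have hτ2 : 4 / Real.pi ^ 2 * θ ^ 2 ≤ τ := by
        rw [hτ, ← four_mul_sin_sq_eq]
        have h3 : 2 / Real.pi * |θ / 2| ≤ |Real.sin (θ / 2)| := by
          refine Real.mul_abs_le_abs_sin ?_
          have := habs θ hmem
          rw [abs_div, abs_two]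
          linarith
        have h4 : (2 / Real.pi * |θ / 2|) ^ 2 ≤ |Real.sin (θ / 2)| ^ 2 := by gcongr
        rw [sq_abs, mul_pow, sq_abs] at h4
        calc _ = 4 * ((2 / Real.pi) ^ 2 * (θ / 2) ^ 2) := by ring
          _ ≤ _ := by gcongr
      have he : 1 + -(τ : ℂ) * pgfRemainder p (Complex.exp (θ * Complex.I)) =
          ((1 - τ * a : ℝ) : ℂ) +
            -(τ : ℂ) * (pgfRemainder p (Complex.exp (θ * Complex.I)) - a) := by
        push_cast; ring
      rw [he]
      refine (norm_add_le _ _).trans ?_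
      rw [Complex.norm_real, norm_mul, norm_neg, Complex.norm_real, Real.norm_of_nonneg hτ0,
        Real.norm_of_nonneg (by nlinarith)]
      have h5 := mul_le_mul_of_nonneg_left hR.le hτ0
      have h6 := mul_le_mul_of_nonneg_right hτ2 ha.le
      calc _ ≤ 1 - τ * a + τ * (a / 2) := by linarith
        _ ≤ 1 - (4 / Real.pi ^ 2 * θ ^ 2 * a) / 2 := by linarith
        _ = _ := by ring
    · have hlt : ‖powSum p (Complex.exp (t * Complex.I))‖ < 1 := by
        refine lt_of_le_of_ne (hp.norm_pgf_le (norm_exp_le t)) fun heq => ht0 ?_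
        have h1 := hd.pow_eq_one _
          (hp.pow_eq_one_of_norm_pgf (Complex.norm_exp_ofReal_mul_I t) heq)
        rw [← Complex.exp_nat_mul, Complex.exp_eq_one_iff] at h1
        obtain ⟨n, hn⟩ := h1
        have h2 : (d : ℝ) * t = n * (2 * Real.pi) := by
          have hI := Complex.I_ne_zero
          have : (d : ℂ) * t = n * (2 * Real.pi) := by
            refine mul_right_cancel₀ hI ?_
            linear_combination hn
          exact_mod_cast this
        have h3 : |(d : ℝ) * t| ≤ Real.pi := by
          rw [abs_mul, abs_of_pos hd0]
          have := abs_le.2 ht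
          rwa [le_div_iff₀' hd0] at this
        rw [h2, abs_mul, abs_of_pos (by positivity : 0 < 2 * Real.pi)] at h3
        have h4 : |(n : ℝ)| < 1 := by nlinarith
        have h5 : n = 0 := by
          rw [← Int.abs_lt_one_iff]; exact_mod_cast h4
        rw [h5] at h2
        simpa [hd0.ne'] using h2
      set m := (1 + ‖powSum p (Complex.exp (t * Complex.I))‖) / 2 with hm
      have hev : ∀ᶠ θ : ℝ in 𝓝 t, ‖powSum p (Complex.exp (θ * Complex.I))‖ < m :=
        hp.continuous_pgf_exp.norm.continuousAt.eventually_lt_const (by simp only; linarith)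
      refine ⟨_, mem_nhdsWithin_of_mem_nhds hev, (1 - m) / Real.pi ^ 2,
        div_pos (by linarith) (by positivity), fun θ hθ hmem => ?_⟩
      refine (le_of_lt hθ).trans ?_
      have h6 : θ ^ 2 ≤ Real.pi ^ 2 := sq_le_sq' (by linarith [(abs_le.1 (habs θ hmem)).1])
        (abs_le.1 (habs θ hmem)).2
      have h7 : (1 - m) / Real.pi ^ 2 * θ ^ 2 ≤ (1 - m) / Real.pi ^ 2 * Real.pi ^ 2 := by
        exact mul_le_mul_of_nonneg_left h6 (div_nonneg (by linarith) (by positivity))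
      rw [div_mul_cancel₀ _ (by positivity)] at h7
      linarith

/-- The local limit theorem at the centre. -/
lemma tendsto_sqrt_mul_integral {d : ℕ} (hd : IsSpan p d) : ∃ b : ℝ, 0 < b ∧
    Tendsto (fun N : ℕ => (Real.sqrt N : ℂ) *
      ∫ θ in (-(Real.pi / d))..(Real.pi / d), Complex.exp (θ * Complex.I) *
      (powSum p (Complex.exp (θ * Complex.I)) * Complex.exp (-(θ * Complex.I))) ^ N)
      atTop (𝓝 b) := by
  obtain ⟨a, ha, hRa⟩ := hp.exists_remainder_one
  obtain ⟨c, hc, hbd⟩ := hp.exists_norm_pgf_exp_le hd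
  have hpi := Real.pi_pos
  have hd0 : (0 : ℝ) < d := by exact_mod_cast hd.pos
  set T := Real.pi / d with hT
  have hT0 : 0 < T := by positivity
  set g : ℕ → ℝ → ℂ := fun N θ => Complex.exp (θ * Complex.I) *
      (powSum p (Complex.exp (θ * Complex.I)) * Complex.exp (-(θ * Complex.I))) ^ N with hg
  have hgc : ∀ N, Continuous (g N) := fun N => by
    refine Continuous.mul (by fun_prop) ((hp.continuous_pgf_exp.mul (by fun_prop)).pow N)
  refine ⟨Real.sqrt (Real.pi / a), by positivity, ?_⟩
  -- Substituting `θ = s/√N` produces the factor `√N`. The quadratic bound gives the Gaussian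
  -- majorant `exp(-c s^2)`, and the pointwise limit is `exp(-a s^2)`.
  set F : ℕ → ℝ → ℂ := fun N =>
    (Set.Ioc (-(T * Real.sqrt N)) (T * Real.sqrt N)).indicator fun s => g N (s / Real.sqrt N)
    with hF
  have hconv : ∀ᶠ N : ℕ in atTop, ∫ s, F N s = (Real.sqrt N : ℂ) * ∫ θ in (-T)..T, g N θ := by
    filter_upwards [eventually_gt_atTop 0] with N hN
    have hN0 : 0 < Real.sqrt N := Real.sqrt_pos.2 (by exact_mod_cast hN)
    rw [hF, integral_indicator measurableSet_Ioc,
      ← intervalIntegral.integral_of_le (by nlinarith),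
      intervalIntegral.integral_comp_div (fun θ => g N θ) hN0.ne', neg_div,
      mul_div_cancel_right₀ _ hN0.ne', Complex.real_smul]
  have hlim : ∫ s : ℝ, Complex.exp (-(a * s ^ 2 : ℝ)) = ((Real.sqrt (Real.pi / a) : ℝ) : ℂ) := by
    rw [← integral_gaussian a, ← integral_complex_ofReal]
    refine integral_congr_ae (ae_of_all _ fun s => ?_)
    simp only
    push_cast
    rw [neg_mul]
  rw [← hlim]
  refine Tendsto.congr' hconv ?_
  refine tendsto_integral_filter_of_dominated_convergence (fun s => Real.exp (-c * s ^ 2)) ?_ ?_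
    (integrable_exp_neg_mul_sq hc) ?_
  · refine Eventually.of_forall fun N => ?_
    exact ((hgc N).comp (continuous_id.div_const _)).aestronglyMeasurable.indicator
      measurableSet_Ioc
  · filter_upwards [eventually_gt_atTop 0] with N hN
    refine ae_of_all _ fun s => ?_
    have hN0 : 0 < Real.sqrt N := Real.sqrt_pos.2 (by exact_mod_cast hN)
    simp only [hF, Set.indicator]
    split_ifs with hs
    · have hmem : s / Real.sqrt N ∈ Set.Icc (-T) T := by
        constructor
        · rw [le_div_iff₀ hN0, neg_mul]; exact hs.1.le
        · rw [div_le_iff₀ hN0]; exact hs.2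
      have h1 := hbd _ hmem
      have h2 : ‖g N (s / Real.sqrt N)‖ =
          ‖powSum p (Complex.exp ((s / Real.sqrt N : ℝ) * Complex.I))‖ ^ N := by
        simp only [hg]
        rw [norm_mul, norm_pow, norm_mul, Complex.norm_exp_ofReal_mul_I, ← neg_mul,
          ← Complex.ofReal_neg, Complex.norm_exp_ofReal_mul_I, mul_one, one_mul]
      rw [h2]
      have h3 : ‖powSum p (Complex.exp ((s / Real.sqrt N : ℝ) * Complex.I))‖ ≤
          Real.exp (-(c * (s / Real.sqrt N) ^ 2)) :=
        h1.trans (by linarith [Real.add_one_le_exp (-(c * (s / Real.sqrt N) ^ 2))])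
      refine (pow_le_pow_left₀ (norm_nonneg _) h3 N).trans (le_of_eq ?_)
      rw [← Real.exp_nat_mul, div_pow, Real.sq_sqrt (Nat.cast_nonneg N)]
      congr 1
      field_simp
    · rw [norm_zero]; exact (Real.exp_pos _).le
  · refine ae_of_all _ fun s => ?_
    have hsq : Tendsto (fun N : ℕ => Real.sqrt N) atTop atTop :=
      Real.tendsto_sqrt_atTop.comp tendsto_natCast_atTop_atTop
    have hθ : Tendsto (fun N : ℕ => s / Real.sqrt N) atTop (𝓝 0) := hsq.const_div_atTop s
    have hev : ∀ᶠ N : ℕ in atTop, F N s = g N (s / Real.sqrt N) := by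
      have h1 : ∀ᶠ N : ℕ in atTop, |s| / T < Real.sqrt N := hsq.eventually_gt_atTop _
      filter_upwards [h1] with N hN
      simp only [hF]
      rw [Set.indicator_of_mem]
      rw [div_lt_iff₀' hT0] at hN
      exact ⟨by linarith [neg_abs_le s], by linarith [le_abs_self s]⟩
    refine Tendsto.congr' (hev.mono fun N h => h.symm) ?_
    have hexp : Tendsto (fun N : ℕ => Complex.exp ((s / Real.sqrt N : ℝ) * Complex.I)) atTop
        (𝓝 1) := by
      have hcx : Continuous fun θ : ℝ => Complex.exp (θ * Complex.I) := by fun_prop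
      have := (hcx.tendsto 0).comp hθ
      simpa only [Function.comp_def, Complex.ofReal_zero, zero_mul, Complex.exp_zero] using this
    rw [show Complex.exp (-(a * s ^ 2 : ℝ)) = 1 * Complex.exp (-(a * s ^ 2 : ℝ)) by rw [one_mul]]
    refine hexp.mul ?_
    simp_rw [hp.pgf_mul_exp]
    refine Complex.tendsto_one_add_pow_exp_of_tendsto ?_
    have hR : Tendsto (fun N : ℕ => pgfRemainder p
        (Complex.exp ((s / Real.sqrt N : ℝ) * Complex.I))) atTop (𝓝 a) := by
      have := (hp.continuous_remainder_exp.tendsto 0).comp hθ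
      simpa [hRa, Function.comp_def] using this
    have hsinc : Tendsto (fun N : ℕ => Real.sinc (s / Real.sqrt N / 2)) atTop (𝓝 1) := by
      have h1 : Tendsto (fun N : ℕ => s / Real.sqrt N / 2) atTop (𝓝 0) := by
        simpa using hθ.div_const 2
      have := (Real.continuous_sinc.tendsto 0).comp h1
      simpa only [Function.comp_def, Real.sinc_zero] using this
    have hfin : Tendsto (fun N : ℕ => -((s ^ 2 * Real.sinc (s / Real.sqrt N / 2) ^ 2 : ℝ) : ℂ) *
        pgfRemainder p (Complex.exp ((s / Real.sqrt N : ℝ) * Complex.I))) atTop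
        (𝓝 (-((s ^ 2 * 1 ^ 2 : ℝ) : ℂ) * a)) :=
      (((Complex.continuous_ofReal.tendsto _).comp ((hsinc.pow 2).const_mul (s ^ 2))).neg).mul hR
    have he : -((s ^ 2 * 1 ^ 2 : ℝ) : ℂ) * a = -(a * s ^ 2 : ℝ) := by push_cast; ring
    rw [he] at hfin
    refine Tendsto.congr' ?_ hfin
    filter_upwards [eventually_gt_atTop 0] with N hN
    have hN0 : (N : ℝ) ≠ 0 := by positivity
    have h1 : ((s / Real.sqrt N) ^ 2 * Real.sinc (s / Real.sqrt N / 2) ^ 2 : ℝ) =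
        (s ^ 2 * Real.sinc (s / Real.sqrt N / 2) ^ 2) / N := by
      rw [div_pow, Real.sq_sqrt (Nat.cast_nonneg N)]; ring
    rw [h1]
    have hN1 : (N : ℂ) ≠ 0 := by exact_mod_cast hN0
    push_cast
    field_simp

end CriticalOffspring

/-- Lower bound for the non-zero coefficients of the generating function of the size. -/
theorem IsTreeSeries.exists_coeff_ge {p q : ℕ → ℝ} (hp : CriticalOffspring p)
    (hq : IsTreeSeries p q) {d : ℕ} (hd : IsSpan p d) : ∃ c : ℝ, 0 < c ∧ ∀ N : ℕ, 1 ≤ N → q N ≠ 0 →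
      c ≤ (N : ℝ) ^ (3 / 2 : ℝ) * q N := by
  obtain ⟨b, hb, hlim⟩ := hp.tendsto_sqrt_mul_integral hd
  have hpi := Real.pi_pos
  have hd0 : (0 : ℝ) < d := by exact_mod_cast hd.pos
  have hdC : (d : ℂ) ≠ 0 := by exact_mod_cast hd.pos.ne'
  set g : ℕ → ℝ → ℂ := fun N θ => Complex.exp (θ * Complex.I) *
      (powSum p (Complex.exp (θ * Complex.I)) * Complex.exp (-(θ * Complex.I))) ^ N with hg
  have hgc : ∀ N, Continuous (g N) := fun N => by
    refine Continuous.mul (by fun_prop) ((hp.continuous_pgf_exp.mul (by fun_prop)).pow N)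
  have hper2 : ∀ N, Function.Periodic (g N) (2 * Real.pi) := fun N θ => by
    have h1 : Complex.exp (((θ + 2 * Real.pi : ℝ) : ℂ) * Complex.I)
        = Complex.exp (θ * Complex.I) := by
      push_cast; rw [add_mul, Complex.exp_add, Complex.exp_two_pi_mul_I, mul_one]
    simp only [hg, Complex.exp_neg, h1]
  set ω := Complex.exp (2 * Real.pi * Complex.I / d) with hω
  have hω0 : ω ≠ 0 := Complex.exp_ne_zero _
  have hωd : ω ^ d = 1 := by
    rw [hω, ← Complex.exp_nat_mul, mul_div_cancel₀ _ hdC, Complex.exp_two_pi_mul_I]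
  have hshift : ∀ N θ, g N (θ + 2 * Real.pi / d) = ω * ω⁻¹ ^ N * g N θ := fun N θ => by
    have h1 : Complex.exp (((θ + 2 * Real.pi / d : ℝ) : ℂ) * Complex.I)
        = ω * Complex.exp (θ * Complex.I) := by
      rw [hω, ← Complex.exp_add]; congr 1; push_cast; ring
    simp only [hg, Complex.exp_neg, h1, powSum_mul_of_root (hd.pow_eq_one_of hωd), mul_inv]
    rw [mul_left_comm _ ω⁻¹, mul_pow ω⁻¹]
    ring
  have hint : ∀ N, ∫ θ in (0 : ℝ)..2 * Real.pi, g N θ = 2 * Real.pi * (N * q N) :=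
    hq.integral_unit_circle hp
  have key : ∀ N : ℕ, 1 ≤ N → q N ≠ 0 → (N : ℂ) * q N =
      d / (2 * Real.pi) * ∫ θ in (-(Real.pi / d))..(Real.pi / d), g N θ := by
    intro N hN hqN
    have hne : ∫ θ in (0 : ℝ)..2 * Real.pi, g N θ ≠ 0 := by
      rw [hint]
      have h1 : (N : ℂ) ≠ 0 := by exact_mod_cast (by omega : N ≠ 0)
      have h2 : (q N : ℂ) ≠ 0 := by exact_mod_cast hqN
      have h3 : (Real.pi : ℂ) ≠ 0 := by exact_mod_cast hpi.ne'
      exact mul_ne_zero (mul_ne_zero two_ne_zero h3) (mul_ne_zero h1 h2)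
    -- A shift by `2π/d` multiplies the integrand by `ω^(1-N)` and leaves the integral over a full
    -- period unchanged. As that integral is not zero, the multiplier is one, i.e. `N ≡ 1` modulo
    -- `d`.
    have hmul : ω * ω⁻¹ ^ N = 1 := by
      have h1 : ∫ θ in (0 : ℝ)..2 * Real.pi, g N (θ + 2 * Real.pi / d) =
          ∫ θ in (0 : ℝ)..2 * Real.pi, g N θ := by
        rw [intervalIntegral.integral_comp_add_right (g N), zero_add, add_comm (2 * Real.pi),
          (hper2 N).intervalIntegral_add_eq _ 0, zero_add]
      simp_rw [hshift, intervalIntegral.integral_const_mul] at h1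
      exact mul_right_cancel₀ hne (by rw [h1, one_mul])
    have hper : Function.Periodic (g N) (2 * Real.pi / d) := fun θ => by
      rw [hshift, hmul, one_mul]
    have h2 := hper.intervalIntegral_add_zsmul_eq d (-(Real.pi / d))
      (fun _ _ => (hgc N).intervalIntegrable _ _)
    have h3 : (-(Real.pi / d)) + (d : ℤ) • (2 * Real.pi / d) = -(Real.pi / d) + 2 * Real.pi := by
      rw [zsmul_eq_mul, Int.cast_natCast, mul_div_cancel₀ _ hd0.ne']
    have h4 : (-(Real.pi / d)) + 2 * Real.pi / d = Real.pi / d := by ring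
    rw [h3, h4, (hper2 N).intervalIntegral_add_eq _ 0, zero_add, hint, natCast_zsmul,
      nsmul_eq_mul] at h2
    have h5 : (Real.pi : ℂ) ≠ 0 := by exact_mod_cast hpi.ne'
    rw [div_mul_eq_mul_div, ← h2]
    field_simp
  have hre : Tendsto (fun N : ℕ => ((Real.sqrt N : ℂ) *
      ∫ θ in (-(Real.pi / d))..(Real.pi / d), g N θ).re) atTop (𝓝 b) := by
    have := (Complex.continuous_re.tendsto _).comp hlim
    simpa only [Function.comp_def, Complex.ofReal_re] using this
  obtain ⟨N₀, hN₀⟩ := eventually_atTop.1 (hre.eventually_const_lt (half_lt_self hb))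
  have hlarge : ∀ N : ℕ, 1 ≤ N → N₀ ≤ N → q N ≠ 0 →
      d / (2 * Real.pi) * (b / 2) ≤ (N : ℝ) ^ (3 / 2 : ℝ) * q N := by
    intro N hN hNN hqN
    have h1 := hN₀ N hNN
    have h2 : ((Real.sqrt N : ℝ) * (N * q N) : ℝ) = d / (2 * Real.pi) *
        ((Real.sqrt N : ℂ) * ∫ θ in (-(Real.pi / d))..(Real.pi / d), g N θ).re := by
      rw [← Complex.ofReal_re ((Real.sqrt N : ℝ) * (N * q N)), ← Complex.re_ofReal_mul]
      congr 1
      push_cast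
      rw [key N hN hqN]; ring
    have hN0 : (0 : ℝ) < N := by exact_mod_cast hN
    have h3 : (N : ℝ) ^ (3 / 2 : ℝ) * q N = Real.sqrt N * (N * q N) := by
      rw [Real.sqrt_eq_rpow, ← mul_assoc, ← Real.rpow_add_one hN0.ne']; norm_num
    rw [h3, h2]
    gcongr
  -- The limit covers large `N` only. The finitely many remaining nonzero coefficients are handled
  -- by a minimum.
  have hsmall : ∀ M : ℕ, ∃ c : ℝ, 0 < c ∧ ∀ N : ℕ, N < M → 1 ≤ N → q N ≠ 0 →
      c ≤ (N : ℝ) ^ (3 / 2 : ℝ) * q N := by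
    intro M
    induction M with
    | zero => exact ⟨1, one_pos, fun N hN => absurd hN (Nat.not_lt_zero N)⟩
    | succ M ih =>
      obtain ⟨c, hc, h⟩ := ih
      by_cases hM : 1 ≤ M ∧ q M ≠ 0
      · have hpos : 0 < (M : ℝ) ^ (3 / 2 : ℝ) * q M :=
          mul_pos (Real.rpow_pos_of_pos (by exact_mod_cast hM.1) _)
            (lt_of_le_of_ne (hq.nonneg M) hM.2.symm)
        refine ⟨min c ((M : ℝ) ^ (3 / 2 : ℝ) * q M), lt_min hc hpos, fun N hN h1 h2 => ?_⟩
        rcases Nat.lt_succ_iff_lt_or_eq.1 hN with h3 | rfl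
        · exact (min_le_left _ _).trans (h N h3 h1 h2)
        · exact min_le_right _ _
      · refine ⟨c, hc, fun N hN h1 h2 => ?_⟩
        rcases Nat.lt_succ_iff_lt_or_eq.1 hN with h3 | rfl
        · exact h N h3 h1 h2
        · exact absurd ⟨h1, h2⟩ hM
  obtain ⟨c, hc, h⟩ := hsmall N₀
  refine ⟨min c (d / (2 * Real.pi) * (b / 2)), lt_min hc (by positivity), fun N h1 h2 => ?_⟩
  rcases lt_or_ge N N₀ with h3 | h3
  · exact (min_le_left _ _).trans (h N h3 h1 h2)
  · exact (min_le_right _ _).trans (hlarge N h1 h3 h2)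

/-! ### Words, and graph distance in the family tree -/

/-- The distance of two words in the tree of all words. -/
def wordDist : List ℕ → List ℕ → ℕ
  | [], w => w.length
  | a :: v, [] => (a :: v).length
  | a :: v, b :: w => if a = b then wordDist v w else v.length + w.length + 2

@[simp] lemma wordDist_nil_left (w : List ℕ) : wordDist [] w = w.length := by
  simp [wordDist]

@[simp] lemma wordDist_nil_right (v : List ℕ) : wordDist v [] = v.length := by
  cases v <;> simp [wordDist]

@[simp] lemma wordDist_cons_self (a : ℕ) (v w : List ℕ) :
    wordDist (a :: v) (a :: w) = wordDist v w := by
  simp [wordDist]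

lemma wordDist_cons_of_ne {a b : ℕ} (h : a ≠ b) (v w : List ℕ) :
    wordDist (a :: v) (b :: w) = v.length + w.length + 2 := by
  simp [wordDist, h]

@[simp] lemma wordDist_self (v : List ℕ) : wordDist v v = 0 := by
  induction v with
  | nil => simp
  | cons a v ih => simpa using ih

lemma wordDist_comm (v w : List ℕ) : wordDist v w = wordDist w v := by
  induction v generalizing w with
  | nil => simp
  | cons a v ih =>
    cases w with
    | nil => simp
    | cons b w =>
      rcases eq_or_ne a b with rfl | h
      · simpa using ih w
      · rw [wordDist_cons_of_ne h, wordDist_cons_of_ne h.symm]; ring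

lemma wordDist_le (v w : List ℕ) : wordDist v w ≤ v.length + w.length := by
  induction v generalizing w with
  | nil => simp
  | cons a v ih =>
    cases w with
    | nil => simp
    | cons b w =>
      rcases eq_or_ne a b with rfl | h
      · have := ih w
        simp only [wordDist_cons_self, List.length_cons]; omega
      · rw [wordDist_cons_of_ne h]; simp only [List.length_cons]; omega

lemma wordDist_append_singleton (v w : List ℕ) (i : ℕ) :
    wordDist v (w ++ [i]) ≤ wordDist v w + 1 ∧ wordDist v w ≤ wordDist v (w ++ [i]) + 1 := by
  induction v generalizing w with
  | nil => simp; omega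
  | cons a v ih =>
    cases w with
    | nil =>
      rcases eq_or_ne a i with rfl | h
      · simp; omega
      · rw [List.nil_append, wordDist_cons_of_ne h]; simp
    | cons b w =>
      rcases eq_or_ne a b with rfl | h
      · simpa using ih w
      · rw [List.cons_append, wordDist_cons_of_ne h, wordDist_cons_of_ne h]; simp; omega

/-- A geodesic step: deleting the last letter of one of the words brings them closer. Family trees
are closed under prefixes, so the step stays in the tree. -/
lemma exists_closer {v w : List ℕ} (h : v ≠ w) :
    (∃ w' i, w = w' ++ [i] ∧ wordDist v w = wordDist v w' + 1) ∨
    (∃ v' i, v = v' ++ [i] ∧ wordDist v w = wordDist v' w + 1) := by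
  induction v generalizing w with
  | nil =>
    left
    rcases List.eq_nil_or_concat' w with rfl | ⟨w', i, rfl⟩
    · exact absurd rfl h
    · exact ⟨w', i, rfl, by simp⟩
  | cons a v ih =>
    cases w with
    | nil =>
      right
      rcases List.eq_nil_or_concat' (a :: v) with h0 | ⟨v', i, h1⟩
      · exact absurd h0 (by simp)
      · exact ⟨v', i, h1, by rw [h1]; simp⟩
    | cons b w =>
      rcases eq_or_ne a b with rfl | hab
      · rcases ih (fun e => h (by rw [e])) with ⟨w', i, rfl, hw⟩ | ⟨v', i, rfl, hv⟩
        · exact Or.inl ⟨a :: w', i, rfl, by simpa using hw⟩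
        · exact Or.inr ⟨a :: v', i, rfl, by simpa using hv⟩
      · left
        rcases List.eq_nil_or_concat' w with rfl | ⟨w', i, rfl⟩
        · exact ⟨[], b, rfl, by rw [wordDist_cons_of_ne hab]; simp⟩
        · exact ⟨b :: w', i, rfl, by
            rw [wordDist_cons_of_ne hab, wordDist_cons_of_ne hab]; simp; omega⟩

lemma nil_mem_familyTree (ξ : List ℕ → ℕ) : [] ∈ familyTree ξ := by
  intro v i h
  have := h.length_le
  simp at this

lemma mem_of_append_mem {ξ : List ℕ → ℕ} {v w : List ℕ} (h : v ++ w ∈ familyTree ξ) :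
    v ∈ familyTree ξ :=
  fun u i hu => h u i (hu.trans (List.prefix_append v w))

lemma cons_mem_familyTree {ξ : List ℕ → ℕ} {i : ℕ} {u : List ℕ} :
    i :: u ∈ familyTree ξ ↔ i < ξ [] ∧ u ∈ familyTree fun v => ξ (i :: v) := by
  constructor
  · intro h
    exact ⟨h [] i ⟨u, rfl⟩, fun v j hv => h (i :: v) j (by simpa using hv)⟩
  · rintro ⟨h1, h2⟩ v j hv
    cases v with
    | nil =>
      obtain ⟨r, hr⟩ := hv
      simp only [List.nil_append, List.singleton_append, List.cons.injEq] at hr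
      rw [hr.1]; exact h1
    | cons a v =>
      rw [List.cons_append, List.cons_prefix_cons] at hv
      obtain ⟨rfl, hv⟩ := hv
      exact h2 v j hv

section graph

variable {ξ : List ℕ → ℕ}

lemma adj_of_eq_append {v w : familyTree ξ} {i : ℕ} (h : (w : List ℕ) = (v : List ℕ) ++ [i]) :
    (familyGraph ξ).Adj v w := by
  rw [familyGraph, SimpleGraph.fromRel_adj]
  refine ⟨?_, Or.inl ⟨i, h⟩⟩
  rintro rfl
  have := congrArg List.length h
  simp at this

lemma wordDist_le_of_adj {v w : familyTree ξ} (h : (familyGraph ξ).Adj v w) (u : List ℕ) :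
    wordDist v u ≤ wordDist w u + 1 := by
  rw [familyGraph, SimpleGraph.fromRel_adj] at h
  rw [wordDist_comm _ u, wordDist_comm _ u]
  obtain ⟨-, ⟨i, hi⟩ | ⟨i, hi⟩⟩ := h
  · rw [hi]; exact (wordDist_append_singleton u v i).2
  · rw [hi]; exact (wordDist_append_singleton u w i).1

lemma wordDist_le_length {v w : familyTree ξ} (P : (familyGraph ξ).Walk v w) :
    wordDist v w ≤ P.length := by
  induction P with
  | nil => simp
  | cons h P ih =>
    rw [SimpleGraph.Walk.length_cons]
    exact (wordDist_le_of_adj h _).trans (by omega)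

lemma exists_walk_length_eq (n : ℕ) : ∀ v w : familyTree ξ, wordDist v w = n →
    ∃ P : (familyGraph ξ).Walk v w, P.length = n := by
  induction n with
  | zero =>
    intro v w h
    have hvw : v = w := by
      by_contra hne
      rcases exists_closer (fun e => hne (Subtype.ext e)) with ⟨_, _, _, h1⟩ | ⟨_, _, _, h1⟩ <;>
        omega
    subst hvw
    exact ⟨SimpleGraph.Walk.nil, rfl⟩
  | succ n ih =>
    intro v w h
    have hne : (v : List ℕ) ≠ w := fun e => by rw [e, wordDist_self] at h; omega
    rcases exists_closer hne with ⟨w', i, hw, h1⟩ | ⟨v', i, hv, h1⟩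
    · have hmem : w' ∈ familyTree ξ := mem_of_append_mem (w := [i]) (by rw [← hw]; exact w.2)
      obtain ⟨P, hP⟩ := ih v ⟨w', hmem⟩ (by simp only; omega)
      exact ⟨P.concat (adj_of_eq_append hw), by rw [SimpleGraph.Walk.length_concat, hP]⟩
    · have hmem : v' ∈ familyTree ξ := mem_of_append_mem (w := [i]) (by rw [← hv]; exact v.2)
      obtain ⟨P, hP⟩ := ih ⟨v', hmem⟩ w (by simp only; omega)
      exact ⟨SimpleGraph.Walk.cons (adj_of_eq_append hv).symm P, by
        rw [SimpleGraph.Walk.length_cons, hP]⟩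

/-- Graph distances in the family tree are distances of words. -/
lemma familyGraph_dist (v w : familyTree ξ) : (familyGraph ξ).dist v w = wordDist v w := by
  obtain ⟨P, hP⟩ := exists_walk_length_eq _ v w rfl
  refine le_antisymm (hP ▸ SimpleGraph.dist_le P) ?_
  obtain ⟨P', hP'⟩ := SimpleGraph.Reachable.exists_walk_length_eq_dist ⟨P⟩
  exact hP' ▸ wordDist_le_length P'

end graph

/-- Counting ordered pairs at distance `k ≥ 1` counts every unordered pair twice. -/
lemma two_mul_pairsAtDist {V : Type*} [Fintype V] [DecidableEq V] (G : SimpleGraph V) {k : ℕ}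
    (hk : 1 ≤ k) :
    2 * pairsAtDist G k = ∑ v : V, ∑ w : V, if G.dist v w = k then 1 else 0 := by
  classical
  -- The graph joining vertices at distance `k`. The handshake lemma for it is the claim, and `k ≥
  -- 1` makes it loopless.
  let H : SimpleGraph V :=
    { Adj := fun v w => G.dist v w = k
      symm := ⟨fun v w h => by rw [SimpleGraph.dist_comm]; exact h⟩
      loopless := ⟨fun v h => by rw [SimpleGraph.dist_self] at h; omega⟩ }
  have hset : {e : Sym2 V | ∃ v w : V, e = s(v, w) ∧ G.dist v w = k} = (H.edgeFinset : Set _) := by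
    ext e
    induction e using Sym2.ind with
    | _ v w =>
      rw [SimpleGraph.coe_edgeFinset, SimpleGraph.mem_edgeSet]
      constructor
      · rintro ⟨v', w', he, hd⟩
        rcases Sym2.eq_iff.1 he with ⟨rfl, rfl⟩ | ⟨rfl, rfl⟩
        · exact hd
        · exact (SimpleGraph.dist_comm).trans hd
      · exact fun h => ⟨v, w, rfl, h⟩
  rw [pairsAtDist, hset, Set.ncard_coe_finset, ← SimpleGraph.sum_degrees_eq_twice_card_edges]
  refine Finset.sum_congr rfl fun v _ => ?_
  rw [← SimpleGraph.card_neighborFinset_eq_degree, Finset.card_eq_sum_ones,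
    SimpleGraph.neighborFinset_eq_filter, Finset.sum_filter]

/-! ### Finite family trees and their decomposition at the root -/

open scoped Classical in
/-- The family tree as a finite set, the empty set if it is infinite. -/
noncomputable def fam (ξ : List ℕ → ℕ) : Finset (List ℕ) :=
  if h : (familyTree ξ).Finite then h.toFinset else ∅

lemma fam_of_finite {ξ : List ℕ → ℕ} (h : (familyTree ξ).Finite) : fam ξ = h.toFinset := by
  rw [fam, dif_pos h]

lemma fam_ne_empty_iff {ξ : List ℕ → ℕ} : fam ξ ≠ ∅ ↔ (familyTree ξ).Finite := by
  by_cases h : (familyTree ξ).Finite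
  · rw [fam_of_finite h]
    refine iff_of_true (Finset.ne_empty_of_mem (a := []) ?_) h
    rw [Set.Finite.mem_toFinset]; exact nil_mem_familyTree ξ
  · simp [fam, h]

lemma coe_fam {ξ : List ℕ → ℕ} (h : fam ξ ≠ ∅) : (fam ξ : Set (List ℕ)) = familyTree ξ := by
  rw [fam_of_finite (fam_ne_empty_iff.1 h), Set.Finite.coe_toFinset]

lemma mem_fam {ξ : List ℕ → ℕ} (h : fam ξ ≠ ∅) {u : List ℕ} : u ∈ fam ξ ↔ u ∈ familyTree ξ := by
  rw [← coe_fam h, Finset.mem_coe]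

lemma length_lt_card_fam {ξ : List ℕ → ℕ} {v : List ℕ} (h : v ∈ fam ξ) :
    v.length < (fam ξ).card := by
  have h0 : fam ξ ≠ ∅ := Finset.ne_empty_of_mem h
  have hle : ((Finset.range (v.length + 1)).image fun j => v.take j).card ≤ (fam ξ).card := by
    refine Finset.card_le_card fun u hu => ?_
    obtain ⟨j, -, rfl⟩ := Finset.mem_image.1 hu
    rw [mem_fam h0] at h ⊢
    rw [← List.take_append_drop j v] at h
    exact mem_of_append_mem h
  rw [Finset.card_image_of_injOn, Finset.card_range] at hle
  · omega
  · intro i hi j hj hij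
    have := congrArg List.length hij
    simp only [Finset.coe_range, Set.mem_Iio, List.length_take] at hi hj this
    omega

/-- The number of ordered pairs of words with distance `k`. -/
def pairCount (k : ℕ) (τ : Finset (List ℕ)) : ℕ :=
  ∑ v ∈ τ, ∑ w ∈ τ, if wordDist v w = k then 1 else 0

lemma two_mul_pairsAtDist_fam {ξ : List ℕ → ℕ} (h : fam ξ ≠ ∅) {k : ℕ} (hk : 1 ≤ k) :
    2 * pairsAtDist (familyGraph ξ) k = pairCount k (fam ξ) := by
  classical
  have : Fintype (familyTree ξ) := (fam_ne_empty_iff.1 h).fintype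
  rw [two_mul_pairsAtDist _ hk, pairCount]
  simp_rw [familyGraph_dist]
  have key : ∀ f : List ℕ → ℕ, ∑ v ∈ fam ξ, f v = ∑ v : familyTree ξ, f v := fun f =>
    Finset.sum_subtype _ (fun u => mem_fam h) f
  simp_rw [key]

/-- The tree with a root whose children are the roots of the trees `τ i`, `i < m`. -/
def graftFinset (m : ℕ) (τ : ℕ → Finset (List ℕ)) : Finset (List ℕ) :=
  insert [] ((Finset.range m).biUnion fun i => (τ i).image (List.cons i))

lemma sum_graftFinset {M : Type*} [AddCommMonoid M] (m : ℕ) (τ : ℕ → Finset (List ℕ))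
    (f : List ℕ → M) :
    ∑ v ∈ graftFinset m τ, f v = f [] + ∑ i ∈ Finset.range m, ∑ u ∈ τ i, f (i :: u) := by
  rw [graftFinset, Finset.sum_insert (by simp), Finset.sum_biUnion]
  · congr 1
    refine Finset.sum_congr rfl fun i _ => ?_
    exact Finset.sum_image fun a _ b _ h => List.cons_injective h
  · intro i _ j _ hij
    rw [Function.onFun, Finset.disjoint_left]
    intro u hu hu'
    obtain ⟨a, -, rfl⟩ := Finset.mem_image.1 hu
    obtain ⟨b, -, hb⟩ := Finset.mem_image.1 hu'
    exact hij (List.cons.inj hb).1.symm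

-- A family tree is finite exactly when all subtrees at the children of the root are. For a
-- childless root the condition is vacuous and the tree is `{[]}`.
open scoped Classical in
lemma fam_eq (ξ : List ℕ → ℕ) : fam ξ = if ∀ i < ξ [], fam (fun v => ξ (i :: v)) ≠ ∅ then
    graftFinset (ξ []) (fun i => fam fun v => ξ (i :: v)) else ∅ := by
  split_ifs with h
  · have hset : familyTree ξ = (graftFinset (ξ []) (fun i => fam fun v => ξ (i :: v)) : Set _) := by
      ext u
      rw [Finset.mem_coe, graftFinset]
      cases u with
      | nil => simp [nil_mem_familyTree]
      | cons i u =>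
        rw [cons_mem_familyTree]
        simp only [Finset.mem_insert, reduceCtorEq, false_or, Finset.mem_biUnion, Finset.mem_range,
          Finset.mem_image, List.cons.injEq]
        constructor
        · rintro ⟨h1, h2⟩
          exact ⟨i, h1, u, (mem_fam (h i h1)).2 h2, rfl, rfl⟩
        · rintro ⟨j, h1, w, h2, rfl, rfl⟩
          exact ⟨h1, (mem_fam (h j h1)).1 h2⟩
    have hfin : (familyTree ξ).Finite := by rw [hset]; exact Finset.finite_toSet _
    rw [fam_of_finite hfin]
    ext u
    rw [Set.Finite.mem_toFinset, hset, Finset.mem_coe]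
  · by_contra hne
    refine h fun i hi => ?_
    rw [fam_ne_empty_iff]
    refine ((fam_ne_empty_iff.1 hne).preimage (List.cons_injective (a := i)).injOn).subset
      fun u hu => ?_
    exact cons_mem_familyTree.2 ⟨hi, hu⟩

section weights

variable (x z : ℂ)

/-- The weight `x^|τ|`, zero for the empty set. -/
noncomputable def sizeWeight (τ : Finset (List ℕ)) : ℂ := if τ = ∅ then 0 else x ^ τ.card

/-- The generating function of the distances to the root. -/
def depthSum (τ : Finset (List ℕ)) : ℂ := ∑ v ∈ τ, z ^ v.length

/-- The generating function of the distances of ordered pairs of distinct words. -/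
def pairSum (τ : Finset (List ℕ)) : ℂ := ∑ v ∈ τ, ∑ w ∈ τ, if v = w then 0 else z ^ wordDist v w

lemma card_graftFinset (m : ℕ) (τ : ℕ → Finset (List ℕ)) :
    (graftFinset m τ).card = 1 + ∑ i ∈ Finset.range m, (τ i).card := by
  rw [Finset.card_eq_sum_ones, sum_graftFinset]
  simp

lemma depthSum_graftFinset (m : ℕ) (τ : ℕ → Finset (List ℕ)) :
    depthSum z (graftFinset m τ) = 1 + z * ∑ i ∈ Finset.range m, depthSum z (τ i) := by
  rw [depthSum, sum_graftFinset, Finset.mul_sum]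
  simp [depthSum, Finset.mul_sum, pow_succ']

/-- Ordered pairs either involve the root, lie in one subtree, or lie in two different subtrees. In
the last case the path passes through the root, so the distance is the sum of both depths plus two.
-/
lemma pairSum_graftFinset (m : ℕ) (τ : ℕ → Finset (List ℕ)) :
    pairSum z (graftFinset m τ) = 2 * z * ∑ i ∈ Finset.range m, depthSum z (τ i) +
      ∑ i ∈ Finset.range m, pairSum z (τ i) +
      z ^ 2 * ∑ i ∈ Finset.range m, ∑ j ∈ Finset.range m,
        if i = j then 0 else depthSum z (τ i) * depthSum z (τ j) := by
  have hinner : ∀ i ∈ Finset.range m, ∀ j ∈ Finset.range m,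
      (∑ u ∈ τ i, ∑ w ∈ τ j, if i :: u = j :: w then 0 else z ^ wordDist (i :: u) (j :: w)) =
      if i = j then pairSum z (τ i) else z ^ 2 * (depthSum z (τ i) * depthSum z (τ j)) := by
    intro i _ j _
    split_ifs with h
    · subst h
      simp [pairSum]
    · rw [depthSum, depthSum, Finset.sum_mul_sum, Finset.mul_sum]
      refine Finset.sum_congr rfl fun u _ => ?_
      rw [Finset.mul_sum]
      refine Finset.sum_congr rfl fun w _ => ?_
      rw [if_neg (fun e => h (List.cons.inj e).1), wordDist_cons_of_ne h]
      ring
  rw [pairSum, sum_graftFinset]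
  simp_rw [sum_graftFinset]
  simp only [if_true, zero_add, List.nil_eq, reduceCtorEq, if_false, wordDist_nil_left,
    wordDist_nil_right, List.length_cons, Finset.sum_add_distrib]
  have h1 : ∑ i ∈ Finset.range m, ∑ u ∈ τ i, z ^ (u.length + 1) =
      z * ∑ i ∈ Finset.range m, depthSum z (τ i) := by
    simp [depthSum, Finset.mul_sum, pow_succ']
  have h2 : ∑ i ∈ Finset.range m, ∑ u ∈ τ i, ∑ j ∈ Finset.range m, ∑ w ∈ τ j,
      (if i :: u = j :: w then 0 else z ^ wordDist (i :: u) (j :: w)) =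
      ∑ i ∈ Finset.range m, pairSum z (τ i) +
      z ^ 2 * ∑ i ∈ Finset.range m, ∑ j ∈ Finset.range m,
        if i = j then 0 else depthSum z (τ i) * depthSum z (τ j) := by
    rw [Finset.mul_sum, ← Finset.sum_add_distrib]
    refine Finset.sum_congr rfl fun i hi => ?_
    rw [Finset.sum_comm, Finset.sum_congr rfl (hinner i hi), Finset.mul_sum]
    calc _ = ∑ j ∈ Finset.range m, ((if i = j then pairSum z (τ i) else 0) +
          z ^ 2 * if i = j then 0 else depthSum z (τ i) * depthSum z (τ j)) := by
          refine Finset.sum_congr rfl fun j _ => ?_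
          split_ifs <;> simp
      _ = _ := by rw [Finset.sum_add_distrib, Finset.sum_ite_eq, if_pos hi]
  rw [h1, h2]
  ring

/-- This remains true for infinite trees: some subtree is then infinite as well, and its weight zero
annihilates the product. -/
lemma sizeWeight_fam (ξ : List ℕ → ℕ) : sizeWeight x (fam ξ) =
    x * ∏ i ∈ Finset.range (ξ []), sizeWeight x (fam fun v => ξ (i :: v)) := by
  classical
  rw [fam_eq]
  split_ifs with h
  · rw [sizeWeight, if_neg (by simp [graftFinset]), card_graftFinset, pow_add, pow_one,
      ← Finset.prod_pow_eq_pow_sum]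
    congr 1
    refine Finset.prod_congr rfl fun i hi => ?_
    rw [sizeWeight, if_neg (h i (Finset.mem_range.1 hi))]
  · push Not at h
    obtain ⟨i, hi, h0⟩ := h
    rw [Finset.prod_eq_zero (Finset.mem_range.2 hi) (by rw [h0, sizeWeight, if_pos rfl]),
      mul_zero, sizeWeight, if_pos rfl]

lemma fam_eq_of_sizeWeight_ne_zero {ξ : List ℕ → ℕ} (h : sizeWeight x (fam ξ) ≠ 0) :
    fam ξ = graftFinset (ξ []) (fun i => fam fun v => ξ (i :: v)) := by
  have h0 : fam ξ ≠ ∅ := fun e => h (by rw [e, sizeWeight, if_pos rfl])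
  rw [fam_eq] at h0 ⊢
  split_ifs at h0 ⊢ with h1
  · rfl
  · exact absurd rfl h0

/-- The weight is kept on both sides because the recursion for `depthSum` alone fails for infinite
trees, which `fam` encodes as the empty set. -/
lemma sizeWeight_mul_depthSum_fam (ξ : List ℕ → ℕ) :
    sizeWeight x (fam ξ) * depthSum z (fam ξ) = sizeWeight x (fam ξ) *
      (1 + z * ∑ i ∈ Finset.range (ξ []), depthSum z (fam fun v => ξ (i :: v))) := by
  by_cases h : sizeWeight x (fam ξ) = 0
  · rw [h, zero_mul, zero_mul]
  · conv_lhs => rw [fam_eq_of_sizeWeight_ne_zero x h, depthSum_graftFinset]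
    rw [← fam_eq_of_sizeWeight_ne_zero x h]

lemma sizeWeight_mul_pairSum_fam (ξ : List ℕ → ℕ) :
    sizeWeight x (fam ξ) * pairSum z (fam ξ) = sizeWeight x (fam ξ) *
      (2 * z * ∑ i ∈ Finset.range (ξ []), depthSum z (fam fun v => ξ (i :: v)) +
      ∑ i ∈ Finset.range (ξ []), pairSum z (fam fun v => ξ (i :: v)) +
      z ^ 2 * ∑ i ∈ Finset.range (ξ []), ∑ j ∈ Finset.range (ξ []), if i = j then 0 else
        depthSum z (fam fun v => ξ (i :: v)) * depthSum z (fam fun v => ξ (j :: v))) := by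
  by_cases h : sizeWeight x (fam ξ) = 0
  · rw [h, zero_mul, zero_mul]
  · conv_lhs => rw [fam_eq_of_sizeWeight_ne_zero x h, pairSum_graftFinset]
    rw [← fam_eq_of_sizeWeight_ne_zero x h]

end weights

/-! ### The branching property and expectations over independent subtrees -/

instance (μ : Measure ℕ) [IsProbabilityMeasure μ] : IsProbabilityMeasure (offspringLaw μ) := by
  unfold offspringLaw; infer_instance

/-- The offspring numbers of a tree whose root has `m` children with given subtrees. -/
def graft (m : ℕ) (η : ℕ → List ℕ → ℕ) : List ℕ → ℕ
  | [] => m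
  | i :: u => η i u

lemma measurable_graft : Measurable fun x : ℕ × (ℕ → List ℕ → ℕ) => graft x.1 x.2 := by
  refine measurable_pi_iff.2 fun v => ?_
  cases v with
  | nil => exact measurable_fst
  | cons i u =>
    exact (measurable_pi_apply u).comp ((measurable_pi_apply i).comp measurable_snd)

section law

variable (μ : Measure ℕ) [IsProbabilityMeasure μ]

/-- The law of the subtrees at the children of the root: independent copies of the tree. -/
noncomputable def subtreeLaw : Measure (ℕ → List ℕ → ℕ) :=
  Measure.infinitePi fun _ : ℕ => offspringLaw μ

instance : IsProbabilityMeasure (subtreeLaw μ) := by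
  unfold subtreeLaw; infer_instance

/-- The recursive structure of the Galton–Watson tree. -/
lemma map_graft : Measure.map (fun x : ℕ × (ℕ → List ℕ → ℕ) => graft x.1 x.2)
    (μ.prod (subtreeLaw μ)) = offspringLaw μ := by
  classical
  refine Measure.eq_infinitePi _ fun s t ht => ?_
  have hinj : Function.Injective fun p : ℕ × List ℕ => p.1 :: p.2 := fun a b h => by
    simpa [Prod.ext_iff] using h
  set s' : Finset (ℕ × List ℕ) := s.preimage (fun p => p.1 :: p.2) hinj.injOn with hs'
  set A : Set ℕ := if [] ∈ s then t [] else Set.univ with hA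
  set B : Set (ℕ × List ℕ → ℕ) := Set.pi s' fun p => t (p.1 :: p.2) with hB
  have hBm : MeasurableSet B := MeasurableSet.pi s'.countable_toSet fun _ _ => ht _
  -- A cylinder splits into a condition on the root and a cylinder in the coordinates `(i, u)`,
  -- which stand for the words `i :: u`.
  have hpre : (fun x : ℕ × (ℕ → List ℕ → ℕ) => graft x.1 x.2) ⁻¹' Set.pi s t =
      A ×ˢ ((MeasurableEquiv.curry ℕ (List ℕ) ℕ).symm ⁻¹' B) := by
    ext ⟨m, η⟩
    simp only [Set.mem_preimage, Set.mem_pi, Set.mem_prod, Finset.mem_coe]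
    constructor
    · intro h
      refine ⟨?_, fun p hp => ?_⟩
      · rw [hA]
        split_ifs with h0
        · exact h [] h0
        · trivial
      · rw [hs', Finset.mem_coe, Finset.mem_preimage] at hp
        exact h (p.1 :: p.2) hp
    · rintro ⟨h1, h2⟩ v hv
      cases v with
      | nil => rw [hA, if_pos hv] at h1; exact h1
      | cons i u => exact h2 (i, u) (by rw [hs', Finset.mem_coe, Finset.mem_preimage]; exact hv)
  rw [Measure.map_apply measurable_graft (MeasurableSet.pi s.countable_toSet fun _ _ => ht _),
    hpre, Measure.prod_prod, ← Measure.map_apply (MeasurableEquiv.measurable _) hBm, subtreeLaw]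
  unfold offspringLaw
  rw [Measure.infinitePi_map_curry_symm (fun _ _ => μ), hB,
    Measure.infinitePi_pi _ (fun _ _ => ht _)]
  rw [hs', Finset.prod_preimage' (fun p : ℕ × List ℕ => p.1 :: p.2) s hinj.injOn
    (fun v => μ (t v)), ← Finset.prod_filter_mul_prod_filter_not s
    (fun v => v ∈ Set.range fun p : ℕ × List ℕ => p.1 :: p.2), mul_comm]
  congr 1
  have hfil : s.filter (fun v => v ∉ Set.range fun p : ℕ × List ℕ => p.1 :: p.2) =
      if [] ∈ s then {[]} else ∅ := by
    ext v
    cases v with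
    | nil => by_cases h : [] ∈ s <;> simp [h]
    | cons i u => by_cases h : [] ∈ s <;> simp [h]
  rw [hfil, hA]
  split_ifs <;> simp

/-- Bounded measurable functionals. -/
def BddMeas {Ω : Type*} [MeasurableSpace Ω] (g : Ω → ℂ) : Prop :=
  Measurable g ∧ ∃ C : ℝ, ∀ ω, ‖g ω‖ ≤ C

lemma BddMeas.integrable {Ω : Type*} [MeasurableSpace Ω] {g : Ω → ℂ} (hg : BddMeas g)
    (ν : Measure Ω) [IsFiniteMeasure ν] : Integrable g ν := by
  obtain ⟨h, C, hC⟩ := hg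
  exact Integrable.of_bound h.aestronglyMeasurable C (ae_of_all _ hC)

lemma integral_eq_tsum_graft {h : (List ℕ → ℕ) → ℂ} (hh : BddMeas h) :
    ∫ ξ, h ξ ∂offspringLaw μ = ∑' m, (μ.real {m} : ℂ) * ∫ η, h (graft m η) ∂subtreeLaw μ := by
  have hb : BddMeas fun x : ℕ × (ℕ → List ℕ → ℕ) => h (graft x.1 x.2) :=
    ⟨hh.1.comp measurable_graft, hh.2.imp fun C hC x => hC _⟩
  have hi := hb.integrable (μ.prod (subtreeLaw μ))
  rw [← map_graft μ, integral_map measurable_graft.aemeasurable hh.1.aestronglyMeasurable,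
    integral_prod _ hi, integral_countable hi.integral_prod_left]
  simp

lemma integral_prod_subtree (m : ℕ) {g : ℕ → (List ℕ → ℕ) → ℂ} (hg : ∀ i, BddMeas (g i)) :
    ∫ η, ∏ i ∈ Finset.range m, g i (η i) ∂subtreeLaw μ =
      ∏ i ∈ Finset.range m, ∫ ξ, g i ξ ∂offspringLaw μ := by
  have h1 : ∀ η : ℕ → List ℕ → ℕ, ∏ i ∈ Finset.range m, g i (η i) =
      (fun y : Finset.range m → List ℕ → ℕ => ∏ i : Finset.range m, g i (y i)) ((Finset.range m).restrict η) :=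
    fun η => (Finset.prod_coe_sort (Finset.range m) fun i => g i (η i)).symm
  rw [integral_congr_ae (ae_of_all _ h1)]
  have hm : Measurable fun y : Finset.range m → List ℕ → ℕ => ∏ i : Finset.range m, g i (y i) :=
    Finset.measurable_prod _ fun i _ => (hg i).1.comp (measurable_pi_apply i)
  have h2 := integral_restrict_infinitePi (μ := fun _ : ℕ => offspringLaw μ) (s := Finset.range m)
    hm.aestronglyMeasurable
  rw [subtreeLaw]
  refine h2.trans ?_
  rw [integral_fintype_prod_eq_prod (fun (i : Finset.range m) ξ => g i ξ)]
  exact Finset.prod_coe_sort (Finset.range m) fun i => ∫ ξ, g i ξ ∂offspringLaw μ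

lemma integrable_prod_subtree (m : ℕ) {g : ℕ → (List ℕ → ℕ) → ℂ} (hg : ∀ i, BddMeas (g i)) :
    Integrable (fun η => ∏ i ∈ Finset.range m, g i (η i)) (subtreeLaw μ) := by
  refine BddMeas.integrable ⟨Finset.measurable_prod _ fun i _ =>
    (hg i).1.comp (measurable_pi_apply i), ?_⟩ _
  choose C hC using fun i => (hg i).2
  refine ⟨∏ i ∈ Finset.range m, C i, fun η => ?_⟩
  rw [norm_prod]
  exact Finset.prod_le_prod (fun _ _ => norm_nonneg _) fun i _ => hC i _

variable {μ} {X a : (List ℕ → ℕ) → ℂ}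

/-- Absorbing `a (η j)` into the `j`-th factor leaves a product over independent subtrees. Only `X *
a` is then required to be bounded, not `a` itself. -/
lemma prod_mul_apply {m j : ℕ} (hj : j ∈ Finset.range m) (η : ℕ → List ℕ → ℕ) :
    (∏ i ∈ Finset.range m, X (η i)) * a (η j) =
      ∏ i ∈ Finset.range m, (if i = j then fun ξ => X ξ * a ξ else X) (η i) := by
  rw [← Finset.mul_prod_erase _ _ hj, ← Finset.mul_prod_erase _ (fun i => (ite _ _ X) (η i)) hj,
    if_pos rfl, mul_right_comm]
  congr 1
  refine Finset.prod_congr rfl fun i hi => ?_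
  rw [if_neg (Finset.ne_of_mem_erase hi)]

lemma prod_mul_apply_two {m j k : ℕ} (hj : j ∈ Finset.range m) (hk : k ∈ Finset.range m)
    (hjk : j ≠ k) (η : ℕ → List ℕ → ℕ) :
    (∏ i ∈ Finset.range m, X (η i)) * (a (η j) * a (η k)) =
      ∏ i ∈ Finset.range m, (if i = j ∨ i = k then fun ξ => X ξ * a ξ else X) (η i) := by
  have hk' : k ∈ (Finset.range m).erase j := Finset.mem_erase.2 ⟨hjk.symm, hk⟩
  rw [← Finset.mul_prod_erase _ _ hj, ← Finset.mul_prod_erase _ _ hk',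
    ← Finset.mul_prod_erase _ (fun i => (ite _ _ X) (η i)) hj,
    ← Finset.mul_prod_erase _ (fun i => (ite _ _ X) (η i)) hk',
    if_pos (Or.inl rfl), if_pos (Or.inr rfl)]
  have : ∏ i ∈ ((Finset.range m).erase j).erase k, X (η i) = ∏ i ∈ ((Finset.range m).erase j).erase k,
      (if i = j ∨ i = k then fun ξ => X ξ * a ξ else X) (η i) := by
    refine Finset.prod_congr rfl fun i hi => ?_
    rw [Finset.mem_erase, Finset.mem_erase] at hi
    rw [if_neg (by tauto)]
  rw [← this]
  ring

variable (hX : BddMeas X) (ha : BddMeas fun ξ => X ξ * a ξ)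
include hX ha

lemma integrable_prod_mul_sum (m : ℕ) : Integrable (fun η : ℕ → List ℕ → ℕ =>
    (∏ i ∈ Finset.range m, X (η i)) * ∑ j ∈ Finset.range m, a (η j)) (subtreeLaw μ) := by
  simp_rw [Finset.mul_sum]
  refine integrable_finsetSum _ fun j hj => ?_
  simp_rw [prod_mul_apply hj]
  exact integrable_prod_subtree μ m fun i => by split_ifs <;> assumption

/-- These are the terms of the series for `Φ'`. For `m = 0` the truncated exponent `m - 1` is
harmless, because of the factor `m`. -/
lemma integral_prod_mul_sum (m : ℕ) : ∫ η : ℕ → List ℕ → ℕ,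
    (∏ i ∈ Finset.range m, X (η i)) * ∑ j ∈ Finset.range m, a (η j) ∂subtreeLaw μ =
    m * (∫ ξ, X ξ * a ξ ∂offspringLaw μ) * (∫ ξ, X ξ ∂offspringLaw μ) ^ (m - 1) := by
  have hB : ∀ j i : ℕ, BddMeas (if i = j then fun ξ => X ξ * a ξ else X) := fun j i => by
    split_ifs <;> assumption
  simp_rw [Finset.mul_sum]
  rw [integral_finsetSum]
  · have : ∀ j ∈ Finset.range m,
        ∫ η : ℕ → List ℕ → ℕ, (∏ i ∈ Finset.range m, X (η i)) * a (η j) ∂subtreeLaw μ =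
        (∫ ξ, X ξ * a ξ ∂offspringLaw μ) * (∫ ξ, X ξ ∂offspringLaw μ) ^ (m - 1) := by
      intro j hj
      simp_rw [prod_mul_apply hj]
      rw [integral_prod_subtree μ m (hB j), ← Finset.mul_prod_erase _ _ hj, if_pos rfl,
        Finset.prod_congr rfl fun i hi => by rw [if_neg (Finset.ne_of_mem_erase hi)],
        Finset.prod_const, Finset.card_erase_of_mem hj, Finset.card_range]
    rw [Finset.sum_congr rfl this, Finset.sum_const, Finset.card_range, nsmul_eq_mul, mul_assoc]
  · intro j hj
    simp_rw [prod_mul_apply hj]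
    exact integrable_prod_subtree μ m (hB j)

lemma integrable_prod_mul_sum_two (m : ℕ) : Integrable (fun η : ℕ → List ℕ → ℕ =>
    (∏ i ∈ Finset.range m, X (η i)) * ∑ j ∈ Finset.range m, ∑ k ∈ Finset.range m,
      if j = k then 0 else a (η j) * a (η k)) (subtreeLaw μ) := by
  simp_rw [Finset.mul_sum]
  refine integrable_finsetSum _ fun j hj => integrable_finsetSum _ fun k hk => ?_
  split_ifs with hjk
  · simp
  · simp_rw [prod_mul_apply_two hj hk hjk]
    exact integrable_prod_subtree μ m fun i => by split_ifs <;> assumption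

lemma integral_prod_mul_sum_two (m : ℕ) : ∫ η : ℕ → List ℕ → ℕ,
    (∏ i ∈ Finset.range m, X (η i)) * ∑ j ∈ Finset.range m, ∑ k ∈ Finset.range m,
      (if j = k then 0 else a (η j) * a (η k)) ∂subtreeLaw μ =
    m * (m - 1 : ℕ) * (∫ ξ, X ξ * a ξ ∂offspringLaw μ) ^ 2 *
      (∫ ξ, X ξ ∂offspringLaw μ) ^ (m - 2) := by
  have hB : ∀ j k i : ℕ, BddMeas (if i = j ∨ i = k then fun ξ => X ξ * a ξ else X) :=
    fun j k i => by split_ifs <;> assumption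
  set Λ := ∫ ξ, X ξ * a ξ ∂offspringLaw μ with hΛ
  set y := ∫ ξ, X ξ ∂offspringLaw μ with hy
  have hone : ∀ j ∈ Finset.range m, ∀ k ∈ Finset.range m,
      Integrable (fun η : ℕ → List ℕ → ℕ => (∏ i ∈ Finset.range m, X (η i)) *
        if j = k then 0 else a (η j) * a (η k)) (subtreeLaw μ) := by
    intro j hj k hk
    split_ifs with hjk
    · simp
    · simp_rw [prod_mul_apply_two hj hk hjk]
      exact integrable_prod_subtree μ m (hB j k)
  have hval : ∀ j ∈ Finset.range m, ∀ k ∈ Finset.range m,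
      ∫ η : ℕ → List ℕ → ℕ, (∏ i ∈ Finset.range m, X (η i)) *
        (if j = k then 0 else a (η j) * a (η k)) ∂subtreeLaw μ =
      if j = k then 0 else Λ ^ 2 * y ^ (m - 2) := by
    intro j hj k hk
    split_ifs with hjk
    · simp
    · have hk' : k ∈ (Finset.range m).erase j := Finset.mem_erase.2 ⟨Ne.symm hjk, hk⟩
      simp_rw [prod_mul_apply_two hj hk hjk]
      have hrest : ∏ i ∈ ((Finset.range m).erase j).erase k, ∫ ξ,
          (if i = j ∨ i = k then fun ξ => X ξ * a ξ else X) ξ ∂offspringLaw μ =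
          ∏ i ∈ ((Finset.range m).erase j).erase k, y := by
        refine Finset.prod_congr rfl fun i hi => ?_
        rw [Finset.mem_erase, Finset.mem_erase] at hi
        rw [if_neg (by tauto)]
      rw [integral_prod_subtree μ m (hB j k), ← Finset.mul_prod_erase _ _ hj,
        ← Finset.mul_prod_erase _ _ hk', hrest, if_pos (Or.inl rfl), if_pos (Or.inr rfl),
        Finset.prod_const, Finset.card_erase_of_mem hk', Finset.card_erase_of_mem hj,
        Finset.card_range, ← mul_assoc, ← sq, Nat.sub_sub]
  simp_rw [Finset.mul_sum]
  rw [integral_finsetSum _ fun j hj => integrable_finsetSum _ (hone j hj)]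
  calc _ = ∑ j ∈ Finset.range m, ∑ k ∈ Finset.range m,
        if j = k then 0 else Λ ^ 2 * y ^ (m - 2) := by
        refine Finset.sum_congr rfl fun j hj => ?_
        rw [integral_finsetSum _ (hone j hj)]
        exact Finset.sum_congr rfl (hval j hj)
    _ = ∑ j ∈ Finset.range m, (m - 1 : ℕ) * (Λ ^ 2 * y ^ (m - 2)) := by
        refine Finset.sum_congr rfl fun j hj => ?_
        rw [← Finset.sum_erase_add _ _ hj, if_pos rfl, add_zero,
          Finset.sum_congr rfl fun k hk => by rw [if_neg (Finset.ne_of_mem_erase hk).symm],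
          Finset.sum_const, Finset.card_erase_of_mem hj, Finset.card_range, nsmul_eq_mul]
    _ = _ := by
        rw [Finset.sum_const, Finset.card_range, nsmul_eq_mul]; ring

end law

/-! ### Measurability and splitting by the size of the tree -/

lemma measurableSet_mem_familyTree (u : List ℕ) :
    MeasurableSet {ξ : List ℕ → ℕ | u ∈ familyTree ξ} := by
  have : {ξ : List ℕ → ℕ | u ∈ familyTree ξ} =
      ⋂ (v : List ℕ) (i : ℕ) (_ : v ++ [i] <+: u), {ξ | i < ξ v} := by
    ext ξ; simp [familyTree]
  rw [this]
  refine MeasurableSet.iInter fun v => MeasurableSet.iInter fun i => MeasurableSet.iInter fun _ => ?_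
  exact measurableSet_lt measurable_const (measurable_pi_apply v)

lemma measurableSet_fam_eq (τ : Finset (List ℕ)) :
    MeasurableSet {ξ : List ℕ → ℕ | fam ξ = τ} := by
  have hne : ∀ σ : Finset (List ℕ), σ ≠ ∅ → MeasurableSet {ξ : List ℕ → ℕ | fam ξ = σ} := by
    intro σ hσ
    have : {ξ : List ℕ → ℕ | fam ξ = σ} = ⋂ u, {ξ | u ∈ familyTree ξ ↔ u ∈ σ} := by
      ext ξ
      simp only [Set.mem_ofPred_eq, Set.mem_iInter]
      constructor
      · rintro rfl u
        exact (mem_fam hσ).symm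
      · intro h
        have hfin : (familyTree ξ).Finite := by
          refine (Finset.finite_toSet σ).subset fun u hu => (h u).1 hu
        have h0 := fam_ne_empty_iff.2 hfin
        ext u
        rw [mem_fam h0, h]
    rw [this]
    refine MeasurableSet.iInter fun u => ?_
    by_cases hu : u ∈ σ
    · simpa [hu] using measurableSet_mem_familyTree u
    · have hc : {ξ : List ℕ → ℕ | u ∈ familyTree ξ ↔ u ∈ σ} = {ξ | u ∈ familyTree ξ}ᶜ := by
        ext ξ; simp [hu]
      rw [hc]
      exact (measurableSet_mem_familyTree u).compl
  rcases eq_or_ne τ ∅ with rfl | h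
  · have : {ξ : List ℕ → ℕ | fam ξ = ∅} =
        (⋃ (σ : Finset (List ℕ)) (_ : σ ≠ ∅), {ξ | fam ξ = σ})ᶜ := by
      ext ξ
      simp only [Set.mem_ofPred_eq, Set.mem_compl_iff, Set.mem_iUnion, not_exists]
      exact ⟨fun h σ hσ e => hσ (e ▸ h), fun h => by_contra fun hne => h _ hne rfl⟩
    rw [this]
    exact (MeasurableSet.iUnion fun σ => MeasurableSet.iUnion fun hσ => hne σ hσ).compl
  · exact hne τ h

/-- There are only countably many finite sets of words, so every function of `fam` is measurable. -/
lemma measurable_comp_fam {E : Type*} [MeasurableSpace E] (h : Finset (List ℕ) → E) :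
    Measurable fun ξ => h (fam ξ) := by
  intro S _
  have : (fun ξ => h (fam ξ)) ⁻¹' S = ⋃ (τ : Finset (List ℕ)) (_ : h τ ∈ S), {ξ | fam ξ = τ} := by
    ext ξ; simp
  rw [this]
  exact MeasurableSet.iUnion fun τ => MeasurableSet.iUnion fun _ => measurableSet_fam_eq τ

lemma mem_sizeEvent {n : ℕ} {ξ : List ℕ → ℕ} :
    ξ ∈ sizeEvent n ↔ fam ξ ≠ ∅ ∧ (fam ξ).card = n := by
  by_cases h : (familyTree ξ).Finite
  · have h0 := fam_ne_empty_iff.2 h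
    simp only [sizeEvent, Set.mem_ofPred_eq, ← coe_fam h0, Set.encard_coe_eq_coe_finsetCard,
      Nat.cast_inj]
    tauto
  · have h0 : ¬ fam ξ ≠ ∅ := fun e => h (fam_ne_empty_iff.1 e)
    simp only [sizeEvent, Set.mem_ofPred_eq, Set.Infinite.encard_eq h]
    simp [h0]

lemma measurableSet_sizeEvent (n : ℕ) : MeasurableSet (sizeEvent n) := by
  have : sizeEvent n = (fun ξ => (decide (fam ξ ≠ ∅ ∧ (fam ξ).card = n))) ⁻¹' {true} := by
    ext ξ; simp [mem_sizeEvent]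
  rw [this]
  exact measurable_comp_fam (fun τ => decide (τ ≠ ∅ ∧ τ.card = n)) (measurableSet_singleton _)

lemma pairwise_disjoint_sizeEvent : Pairwise (Function.onFun Disjoint sizeEvent) := by
  intro m n hmn
  rw [Function.onFun, Set.disjoint_left]
  intro ξ h1 h2
  exact hmn ((mem_sizeEvent.1 h1).2.symm.trans (mem_sizeEvent.1 h2).2)

/-- Integrals as sums over the size of the tree. -/
lemma hasSum_integral_sizeEvent (ν : Measure (List ℕ → ℕ)) {h : (List ℕ → ℕ) → ℂ}
    (hh : Integrable h ν) (h0 : ∀ ξ, fam ξ = ∅ → h ξ = 0) :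
    HasSum (fun n => ∫ ξ in sizeEvent n, h ξ ∂ν) (∫ ξ, h ξ ∂ν) := by
  have := hasSum_integral_iUnion measurableSet_sizeEvent pairwise_disjoint_sizeEvent
    hh.integrableOn
  rwa [setIntegral_eq_integral_of_forall_compl_eq_zero] at this
  intro ξ hξ
  refine h0 ξ ?_
  by_contra hne
  exact hξ (Set.mem_iUnion.2 ⟨_, mem_sizeEvent.2 ⟨hne, rfl⟩⟩)

/-! ### From the hypotheses on the offspring law to `CriticalOffspring` -/

section critical

variable (μ : Measure ℕ) [IsProbabilityMeasure μ]

omit [IsProbabilityMeasure μ] in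
lemma hasSum_integral_nat {f : ℕ → ℝ} (hf : Integrable f μ) :
    HasSum (fun m => f m * μ.real {m}) (∫ m, f m ∂μ) := by
  have h := hasSum_integral_iUnion (μ := μ) (s := fun m : ℕ => {m}) (f := f)
    (fun m => measurableSet_singleton m)
    (fun i j hij => by simpa [Function.onFun] using hij) hf.integrableOn
  rw [Set.iUnion_of_singleton, setIntegral_univ] at h
  refine h.congr_fun fun m => ?_
  rw [integral_singleton, smul_eq_mul, mul_comm]

theorem criticalOffspring (hmean : ∫ k, (k : ℝ) ∂μ = 1)
    (hsq : MemLp (fun k : ℕ => (k : ℝ)) 2 μ)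
    (hvar : 0 < variance (fun k : ℕ => (k : ℝ)) μ) :
    CriticalOffspring fun m => μ.real {m} := by
  have hint : Integrable (fun k : ℕ => (k : ℝ)) μ := hsq.integrable (by norm_num)
  have h1 : HasSum (fun m => μ.real {m}) 1 := by
    simpa using hasSum_integral_nat μ (f := fun _ => 1) (integrable_const _)
  have h2 : HasSum (fun m => m * μ.real {m}) 1 := hmean ▸ hasSum_integral_nat μ hint
  have h3 : Summable fun m : ℕ => (m : ℝ) ^ 2 * μ.real {m} :=
    (hasSum_integral_nat μ hsq.integrable_sq).summable
  have h4 : HasSum (fun m : ℕ => ((m : ℝ) - 1) * μ.real {m}) 0 := by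
    simpa [sub_mul] using h2.sub h1
  -- If `ξ - 1` vanished almost surely, so would the variance. Since `ξ - 1` has mean zero, it must
  -- take both signs, which gives mass at `0` and mass at some `m ≥ 2`.
  have hne : ¬ ∀ m : ℕ, ((m : ℝ) - 1) * μ.real {m} = 0 := by
    intro h
    rw [variance_eq_integral hint.aemeasurable, hmean] at hvar
    have hs := hasSum_integral_nat μ (f := fun m : ℕ => ((m : ℝ) - 1) ^ 2)
      ((hsq.sub (memLp_const 1)).integrable_sq)
    simp only [sq, mul_assoc, h, mul_zero] at hs
    simp only [sq, hs.unique hasSum_zero, lt_irrefl] at hvar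
  refine ⟨fun m => measureReal_nonneg, h1, h2, h3, ?_, ?_⟩
  · by_contra h0
    have h0' : μ.real {0} = 0 := le_antisymm (not_lt.1 h0) measureReal_nonneg
    have hn : ∀ m : ℕ, 0 ≤ ((m : ℝ) - 1) * μ.real {m} := by
      intro m
      rcases m with _ | m
      · simp [h0']
      · push_cast
        have := measureReal_nonneg (μ := μ) (s := {m + 1})
        simpa using mul_nonneg (Nat.cast_nonneg m) this
    exact hne fun m => congrFun ((hasSum_zero_iff_of_nonneg hn).1 h4) m
  · by_contra! h0
    have hn : ∀ m : ℕ, 0 ≤ -(((m : ℝ) - 1) * μ.real {m}) := by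
      intro m
      rcases lt_or_ge m 2 with hm | hm
      · have := measureReal_nonneg (μ := μ) (s := {m})
        interval_cases m <;> simp
      · rw [le_antisymm (h0 m hm) measureReal_nonneg]; simp
    have h5 := h4.neg
    rw [neg_zero] at h5
    exact hne fun m => neg_eq_zero.1 (congrFun ((hasSum_zero_iff_of_nonneg hn).1 h5) m)

end critical

/-! ### Functional equations for the generating functions -/

section moments

variable {c : ℕ → ℝ} (hc : ∀ m, 0 ≤ c m)
include hc

lemma hasSum_powSum_deriv (hs : Summable (derivCoeff c)) {s : ℂ} (h : ‖s‖ ≤ 1) :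
    HasSum (fun m : ℕ => (c m : ℂ) * (m * s ^ (m - 1))) (powSum (derivCoeff c) s) := by
  refine (hasSum_nat_add_iff' 1).1 ?_
  simp only [Finset.range_one, Finset.sum_singleton, CharP.cast_eq_zero, zero_mul, mul_zero,
    sub_zero]
  refine (hasSum_powSum (derivCoeff_nonneg hc) hs h).congr_fun fun m => ?_
  simp [derivCoeff]; ring

lemma hasSum_powSum_deriv_two (hs : Summable (derivCoeff (derivCoeff c))) {s : ℂ} (h : ‖s‖ ≤ 1) :
    HasSum (fun m : ℕ => (c m : ℂ) * (m * (m - 1 : ℕ) * s ^ (m - 2)))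
      (powSum (derivCoeff (derivCoeff c)) s) := by
  refine (hasSum_nat_add_iff' 2).1 ?_
  simp only [Finset.sum_range_succ, Finset.range_zero, Finset.sum_empty]
  simp only [CharP.cast_eq_zero, zero_mul, mul_zero, sub_zero, zero_add, Nat.sub_self]
  refine (hasSum_powSum (derivCoeff_nonneg (derivCoeff_nonneg hc)) hs h).congr_fun fun m => ?_
  simp [derivCoeff]; ring

end moments

section bounds

variable {x z : ℂ}

lemma norm_sizeWeight_le (hx : ‖x‖ ≤ 1) (τ : Finset (List ℕ)) : ‖sizeWeight x τ‖ ≤ 1 := by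
  rw [sizeWeight]
  split_ifs
  · simp
  · rw [norm_pow]; exact pow_le_one₀ (norm_nonneg _) hx

lemma bddMeas_sizeWeight (hx : ‖x‖ ≤ 1) : BddMeas fun ξ => sizeWeight x (fam ξ) :=
  ⟨measurable_comp_fam _, 1, fun _ => norm_sizeWeight_le hx _⟩

/-- For `|z| ≤ 2` the sums over a tree of size `n` are crudely at most `16^n`: at most `n^2 ≤ 4^n`
pairs, each contributing at most `4^n`. Taking `|x| ≤ 1/16` compensates for this. -/
lemma norm_sizeWeight_mul_le (hx : ‖x‖ ≤ 1 / 16) {τ : Finset (List ℕ)} {a : ℂ}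
    (ha : ‖a‖ ≤ 16 ^ τ.card) : ‖sizeWeight x τ * a‖ ≤ 1 := by
  rw [norm_mul, sizeWeight]
  split_ifs
  · simp
  · rw [norm_pow]
    calc ‖x‖ ^ τ.card * ‖a‖ ≤ (1 / 16) ^ τ.card * 16 ^ τ.card := by gcongr
      _ = 1 := by rw [← mul_pow]; norm_num

lemma norm_pow_le_four_pow (hz : ‖z‖ ≤ 2) {k n : ℕ} (hk : k ≤ 2 * n) : ‖z ^ k‖ ≤ 4 ^ n := by
  rw [norm_pow]
  calc ‖z‖ ^ k ≤ 2 ^ k := by gcongr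
    _ ≤ 2 ^ (2 * n) := pow_le_pow_right₀ (by norm_num) hk
    _ = 4 ^ n := by rw [pow_mul]; norm_num

lemma natCast_le_two_pow (n : ℕ) : (n : ℝ) ≤ 2 ^ n := by
  exact_mod_cast (Nat.lt_two_pow_self (n := n)).le

lemma norm_depthSum_fam_le (hz : ‖z‖ ≤ 2) (ξ : List ℕ → ℕ) :
    ‖depthSum z (fam ξ)‖ ≤ 16 ^ (fam ξ).card := by
  set n := (fam ξ).card with hn
  calc ‖depthSum z (fam ξ)‖ ≤ ∑ v ∈ fam ξ, (4 : ℝ) ^ n := norm_sum_le_of_le _ fun v hv =>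
        norm_pow_le_four_pow hz (by have := length_lt_card_fam hv; omega)
    _ = n * 4 ^ n := by rw [Finset.sum_const, nsmul_eq_mul]
    _ ≤ 2 ^ n * 4 ^ n := by gcongr; exact natCast_le_two_pow n
    _ = 8 ^ n := by rw [← mul_pow]; norm_num
    _ ≤ 16 ^ n := by gcongr; norm_num

lemma norm_pairSum_fam_le (hz : ‖z‖ ≤ 2) (ξ : List ℕ → ℕ) :
    ‖pairSum z (fam ξ)‖ ≤ 16 ^ (fam ξ).card := by
  set n := (fam ξ).card with hn
  calc ‖pairSum z (fam ξ)‖ ≤ ∑ v ∈ fam ξ, ∑ w ∈ fam ξ, (4 : ℝ) ^ n := by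
        refine norm_sum_le_of_le _ fun v hv => norm_sum_le_of_le _ fun w hw => ?_
        split_ifs
        · simp
        · refine norm_pow_le_four_pow hz ?_
          have := length_lt_card_fam hv
          have := length_lt_card_fam hw
          have := wordDist_le v w
          omega
    _ = n * (n * 4 ^ n) := by simp only [Finset.sum_const, nsmul_eq_mul, hn]
    _ ≤ 2 ^ n * (2 ^ n * 4 ^ n) := by gcongr <;> exact natCast_le_two_pow n
    _ = 16 ^ n := by rw [← mul_pow, ← mul_pow]; norm_num

lemma bddMeas_sizeWeight_mul_depthSum (hx : ‖x‖ ≤ 1 / 16) (hz : ‖z‖ ≤ 2) :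
    BddMeas fun ξ => sizeWeight x (fam ξ) * depthSum z (fam ξ) :=
  ⟨measurable_comp_fam fun τ => sizeWeight x τ * depthSum z τ, 1, fun ξ =>
    norm_sizeWeight_mul_le hx (norm_depthSum_fam_le hz ξ)⟩

lemma bddMeas_sizeWeight_mul_pairSum (hx : ‖x‖ ≤ 1 / 16) (hz : ‖z‖ ≤ 2) :
    BddMeas fun ξ => sizeWeight x (fam ξ) * pairSum z (fam ξ) :=
  ⟨measurable_comp_fam fun τ => sizeWeight x τ * pairSum z τ, 1, fun ξ =>
    norm_sizeWeight_mul_le hx (norm_pairSum_fam_le hz ξ)⟩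

end bounds

section series

variable (μ : Measure ℕ) [IsProbabilityMeasure μ]

omit [IsProbabilityMeasure μ] in
lemma setIntegral_sizeWeight_mul (x : ℂ) (h : Finset (List ℕ) → ℂ) (n : ℕ) :
    ∫ ξ in sizeEvent n, sizeWeight x (fam ξ) * h (fam ξ) ∂offspringLaw μ =
      x ^ n * ∫ ξ in sizeEvent n, h (fam ξ) ∂offspringLaw μ := by
  rw [← integral_const_mul]
  refine setIntegral_congr_fun (measurableSet_sizeEvent n) fun ξ hξ => ?_
  obtain ⟨h0, hn⟩ := mem_sizeEvent.1 hξ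
  simp only [sizeWeight, if_neg h0, hn]

lemma hasSum_sizeCoeff {x : ℂ} (hx : ‖x‖ ≤ 1) :
    HasSum (fun n => (((offspringLaw μ).real (sizeEvent n) : ℝ) : ℂ) * x ^ n)
      (∫ ξ, sizeWeight x (fam ξ) ∂offspringLaw μ) := by
  refine (hasSum_integral_sizeEvent _ ((bddMeas_sizeWeight hx).integrable _)
    fun ξ h => by rw [h, sizeWeight, if_pos rfl]).congr_fun fun n => ?_
  have := setIntegral_sizeWeight_mul μ x (fun _ => 1) n
  simp only [mul_one] at this
  rw [this, setIntegral_const, mul_comm]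
  simp

lemma integral_sizeWeight {x : ℂ} (hx : ‖x‖ ≤ 1) : ∫ ξ, sizeWeight x (fam ξ) ∂offspringLaw μ =
    powSum (fun n => (offspringLaw μ).real (sizeEvent n)) x := (hasSum_sizeCoeff μ hx).tsum_eq.symm

lemma sizeWeight_fam_graft (x : ℂ) (m : ℕ) (η : ℕ → List ℕ → ℕ) :
    sizeWeight x (fam (graft m η)) = x * ∏ i ∈ Finset.range m, sizeWeight x (fam (η i)) :=
  sizeWeight_fam x (graft m η)

/-- Conditioning on the number of children of the root turns the product formula for `sizeWeight`
into `y = x Φ(y)`. -/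
theorem isTreeSeries : IsTreeSeries (fun m => μ.real {m})
    (fun n => (offspringLaw μ).real (sizeEvent n)) := by
  have h1 := hasSum_sizeCoeff μ (x := 1) (by simp)
  simp only [one_pow, mul_one] at h1
  have hs : Summable fun n => (offspringLaw μ).real (sizeEvent n) :=
    Complex.summable_ofReal.1 h1.summable
  refine ⟨fun n => measureReal_nonneg, ?_, hs, ?_, fun x hx => ?_⟩
  · have : sizeEvent 0 = ∅ := by
      ext ξ
      simp only [mem_sizeEvent, Finset.card_eq_zero, Set.mem_empty_iff_false]
      tauto
    rw [this, measureReal_empty]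
  · have h2 : ‖((∑' n, (offspringLaw μ).real (sizeEvent n) : ℝ) : ℂ)‖ ≤ 1 := by
      rw [Complex.ofReal_tsum, h1.tsum_eq]
      refine (norm_integral_le_of_norm_le_const (C := 1) (ae_of_all _ fun ξ =>
        norm_sizeWeight_le (by simp) _)).trans (by simp)
    rw [Complex.norm_real] at h2
    exact (le_abs_self _).trans h2
  · have hb := bddMeas_sizeWeight hx.le
    rw [← integral_sizeWeight μ hx.le, powSum, ← tsum_mul_left]
    refine (integral_eq_tsum_graft μ hb).trans (tsum_congr fun m => ?_)
    simp_rw [sizeWeight_fam_graft]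
    rw [integral_const_mul, integral_prod_subtree μ m fun _ => hb, Finset.prod_const,
      Finset.card_range]
    ring

variable {μ} (hp : CriticalOffspring fun m => μ.real {m})
include hp

/-- The generating function of the distances to the root. -/
lemma integral_depthSum {x z : ℂ} (hx : ‖x‖ ≤ 1 / 16) (hz : ‖z‖ ≤ 2) :
    ∫ ξ, sizeWeight x (fam ξ) * depthSum z (fam ξ) ∂offspringLaw μ =
    powSum (fun n => (offspringLaw μ).real (sizeEvent n)) x +
    z * treeQ (fun m => μ.real {m}) (fun n => (offspringLaw μ).real (sizeEvent n)) x *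
    ∫ ξ, sizeWeight x (fam ξ) * depthSum z (fam ξ) ∂offspringLaw μ := by
  have hx1 : ‖x‖ < 1 := hx.trans_lt (by norm_num)
  have hq := isTreeSeries μ
  have hX := bddMeas_sizeWeight hx1.le
  have ha := bddMeas_sizeWeight_mul_depthSum hx hz
  have hy := (hq.norm_lt_one hx1).le
  set y := powSum (fun n => (offspringLaw μ).real (sizeEvent n)) x with hydef
  set Λ := ∫ ξ, sizeWeight x (fam ξ) * depthSum z (fam ξ) ∂offspringLaw μ with hΛ
  have hterm : ∀ m, ∫ η, sizeWeight x (fam (graft m η)) * depthSum z (fam (graft m η))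
      ∂subtreeLaw μ = x * y ^ m + x * z * Λ * (m * y ^ (m - 1)) := by
    intro m
    have he : ∀ η : ℕ → List ℕ → ℕ,
        sizeWeight x (fam (graft m η)) * depthSum z (fam (graft m η)) =
        x * ∏ i ∈ Finset.range m, sizeWeight x (fam (η i)) +
        x * z * ((∏ i ∈ Finset.range m, sizeWeight x (fam (η i))) *
          ∑ i ∈ Finset.range m, depthSum z (fam (η i))) := by
      intro η
      rw [sizeWeight_mul_depthSum_fam, sizeWeight_fam_graft]
      simp only [graft]
      ring
    simp_rw [he]
    rw [integral_add ((integrable_prod_subtree μ m fun _ => hX).const_mul x)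
      ((integrable_prod_mul_sum (μ := μ) hX ha m).const_mul _), integral_const_mul, integral_const_mul,
      integral_prod_subtree μ m fun _ => hX, integral_prod_mul_sum hX ha, Finset.prod_const,
      Finset.card_range, integral_sizeWeight μ hx1.le]
    ring
  have h1 := (hasSum_powSum hp.nonneg hp.summable hy).mul_left x
  have h2 := (hasSum_powSum_deriv hp.nonneg hp.summable_deriv hy).mul_left (x * z * Λ)
  have h3 : y = x * powSum (fun m => μ.real {m}) y := hq.eq x hx1
  refine (integral_eq_tsum_graft μ ha).trans ?_
  simp_rw [hterm]
  refine ((h1.add h2).congr_fun fun m => ?_).tsum_eq.trans ?_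
  · ring
  · rw [← h3, treeQ, ← hydef]; ring

/-- The generating function of the distances of pairs. -/
lemma integral_pairSum {x z : ℂ} (hx : ‖x‖ ≤ 1 / 16) (hz : ‖z‖ ≤ 2) :
    ∫ ξ, sizeWeight x (fam ξ) * pairSum z (fam ξ) ∂offspringLaw μ =
    2 * treeH (fun m => μ.real {m}) (fun n => (offspringLaw μ).real (sizeEvent n)) z x := by
  have hx1 : ‖x‖ < 1 := hx.trans_lt (by norm_num)
  have hq := isTreeSeries μ
  have hX := bddMeas_sizeWeight hx1.le
  have ha := bddMeas_sizeWeight_mul_depthSum hx hz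
  have hb := bddMeas_sizeWeight_mul_pairSum hx hz
  have hy := (hq.norm_lt_one hx1).le
  have hΛe := integral_depthSum hp hx hz
  rw [treeH]
  set Q := treeQ (fun m => μ.real {m}) (fun n => (offspringLaw μ).real (sizeEvent n)) x with hQ
  set y := powSum (fun n => (offspringLaw μ).real (sizeEvent n)) x with hydef
  set Λ := ∫ ξ, sizeWeight x (fam ξ) * depthSum z (fam ξ) ∂offspringLaw μ with hΛ
  set Γ := ∫ ξ, sizeWeight x (fam ξ) * pairSum z (fam ξ) ∂offspringLaw μ with hΓ
  set B := powSum (derivCoeff (derivCoeff fun m => μ.real {m})) y with hB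
  have hterm : ∀ m, ∫ η, sizeWeight x (fam (graft m η)) * pairSum z (fam (graft m η))
      ∂subtreeLaw μ = (2 * x * z * Λ + x * Γ) * (m * y ^ (m - 1)) +
        x * z ^ 2 * Λ ^ 2 * (m * (m - 1 : ℕ) * y ^ (m - 2)) := by
    intro m
    have he : ∀ η : ℕ → List ℕ → ℕ,
        sizeWeight x (fam (graft m η)) * pairSum z (fam (graft m η)) =
        2 * x * z * ((∏ i ∈ Finset.range m, sizeWeight x (fam (η i))) *
          ∑ i ∈ Finset.range m, depthSum z (fam (η i))) +
        (x * ((∏ i ∈ Finset.range m, sizeWeight x (fam (η i))) *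
          ∑ i ∈ Finset.range m, pairSum z (fam (η i))) +
        x * z ^ 2 * ((∏ i ∈ Finset.range m, sizeWeight x (fam (η i))) *
          ∑ i ∈ Finset.range m, ∑ j ∈ Finset.range m,
            if i = j then 0 else depthSum z (fam (η i)) * depthSum z (fam (η j)))) := by
      intro η
      rw [sizeWeight_mul_pairSum_fam, sizeWeight_fam_graft]
      simp only [graft]
      ring
    simp_rw [he]
    have i1 := (integrable_prod_mul_sum (μ := μ) hX ha m).const_mul (2 * x * z)
    have i2 := (integrable_prod_mul_sum (μ := μ) hX hb m).const_mul x
    have i3 := (integrable_prod_mul_sum_two (μ := μ) hX ha m).const_mul (x * z ^ 2)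
    refine (integral_add i1 (i2.add i3)).trans ?_
    rw [integral_add' i2 i3, integral_const_mul, integral_const_mul,
      integral_const_mul, integral_prod_mul_sum hX ha, integral_prod_mul_sum hX hb,
      integral_prod_mul_sum_two hX ha, integral_sizeWeight μ hx1.le]
    ring
  have h1 := (hasSum_powSum_deriv hp.nonneg hp.summable_deriv hy).mul_left (2 * x * z * Λ + x * Γ)
  have h2 := (hasSum_powSum_deriv_two hp.nonneg hp.summable_deriv2 hy).mul_left
    (x * z ^ 2 * Λ ^ 2)
  -- A linear equation for `Γ`. The three terms come from pairs with the root, pairs in one subtree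
  -- and pairs in two subtrees.
  have hΓe : Γ = 2 * z * Q * Λ + Q * Γ + z ^ 2 * (x * B) * Λ ^ 2 := by
    refine (integral_eq_tsum_graft μ hb).trans ?_
    simp_rw [hterm]
    rw [hQ, treeQ, ← hydef, hB]
    refine ((h1.add h2).congr_fun fun m => ?_).tsum_eq.trans ?_
    · ring
    · ring
  -- For such small `x` neither `1 - Q` nor `1 - zQ` vanishes, whatever `z` with `|z| ≤ 2`, so both
  -- linear equations can be solved.
  have hQn : ‖Q‖ ≤ 1 / 16 := by
    rw [hQ, treeQ, norm_mul]
    exact (mul_le_of_le_one_right (norm_nonneg _) (hp.norm_deriv_le hy)).trans hx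
  have hQ1 : 1 - Q ≠ 0 := by
    intro h
    rw [← sub_eq_zero.1 h, norm_one] at hQn
    norm_num at hQn
  have hzQ : 1 - z * Q ≠ 0 := by
    intro h
    have : ‖z * Q‖ ≤ 2 * (1 / 16) := by rw [norm_mul]; gcongr
    rw [← sub_eq_zero.1 h, norm_one] at this
    norm_num at this
  have hΛs : Λ = y * (1 - z * Q)⁻¹ := by
    rw [eq_mul_inv_iff_mul_eq₀ hzQ]; linear_combination hΛe
  have hΓs : Γ = (2 * z * Q * Λ + z ^ 2 * (x * B) * Λ ^ 2) * (1 - Q)⁻¹ := by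
    rw [eq_mul_inv_iff_mul_eq₀ hQ1]; linear_combination hΓe
  rw [hΓs, hΛs]
  ring

end series

/-! ### Conditioned expectations as coefficients -/

lemma one_le_wordDist {v w : List ℕ} (h : v ≠ w) : 1 ≤ wordDist v w := by
  rcases exists_closer h with ⟨_, _, _, h1⟩ | ⟨_, _, _, h1⟩ <;> omega

lemma wordDist_lt_of_mem_fam {ξ : List ℕ → ℕ} {v w : List ℕ} (hv : v ∈ fam ξ) (hw : w ∈ fam ξ) :
    wordDist v w < 2 * (fam ξ).card := by
  have := length_lt_card_fam hv
  have := length_lt_card_fam hw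
  have := wordDist_le v w
  omega

lemma pairCount_le (k : ℕ) (τ : Finset (List ℕ)) : pairCount k τ ≤ τ.card * τ.card := by
  refine (Finset.sum_le_card_nsmul _ _ τ.card fun v _ => ?_).trans (by simp)
  refine (Finset.sum_le_card_nsmul _ _ 1 fun w _ => ?_).trans (by simp)
  split_ifs <;> simp

lemma pairCount_fam_eq_zero {ξ : List ℕ → ℕ} {k : ℕ} (hk : 2 * (fam ξ).card ≤ k) :
    pairCount k (fam ξ) = 0 := by
  refine Finset.sum_eq_zero fun v hv => Finset.sum_eq_zero fun w hw => ?_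
  have := wordDist_lt_of_mem_fam hv hw
  rw [if_neg (by omega)]

lemma sum_pairCount_mul_pow (z : ℂ) (ξ : List ℕ → ℕ) :
    ∑ k ∈ Finset.range (2 * (fam ξ).card), (pairCount (k + 1) (fam ξ) : ℂ) * z ^ (k + 1) =
      pairSum z (fam ξ) := by
  simp only [pairCount, Nat.cast_sum, Finset.sum_mul]
  rw [Finset.sum_comm]
  refine Finset.sum_congr rfl fun v hv => ?_
  rw [Finset.sum_comm]
  refine Finset.sum_congr rfl fun w hw => ?_
  split_ifs with h
  · refine Finset.sum_eq_zero fun k _ => ?_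
    rw [h, wordDist_self, if_neg (by omega)]
    simp
  · have h1 := one_le_wordDist h
    have h2 := wordDist_lt_of_mem_fam hv hw
    rw [Finset.sum_eq_single_of_mem (wordDist v w - 1) (Finset.mem_range.2 (by omega))]
    · rw [if_pos (by omega), Nat.sub_add_cancel h1]; simp
    · intro k _ hk
      rw [if_neg (by omega)]; simp

variable (μ : Measure ℕ) [IsProbabilityMeasure μ]

lemma measureReal_mul_expectedPairs {n : ℕ} (hn : offspringLaw μ (sizeEvent n) ≠ 0) (k : ℕ) :
    (((offspringLaw μ).real (sizeEvent n) : ℝ) : ℂ) * (expectedPairs μ n (k + 1) : ℂ) =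
      1 / 2 * ∫ ξ in sizeEvent n, (pairCount (k + 1) (fam ξ) : ℂ) ∂offspringLaw μ := by
  have h1 : ∫ ξ in sizeEvent n, (pairCount (k + 1) (fam ξ) : ℂ) ∂offspringLaw μ =
      ((∫ ξ in sizeEvent n, 2 * (pairsAtDist (familyGraph ξ) (k + 1) : ℝ) ∂offspringLaw μ : ℝ) :
        ℂ) := by
    rw [← integral_complex_ofReal]
    refine setIntegral_congr_fun (measurableSet_sizeEvent n) fun ξ hξ => ?_
    simp only [← two_mul_pairsAtDist_fam (mem_sizeEvent.1 hξ).1 (Nat.le_add_left 1 k)]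
    push_cast; ring
  have h2 : (offspringLaw μ).real (sizeEvent n) ≠ 0 := by
    simpa [Measure.real, ENNReal.toReal_eq_zero_iff] using hn
  rw [h1, integral_const_mul, expectedPairs, ProbabilityTheory.cond, integral_smul_measure,
    ENNReal.toReal_inv]
  push_cast
  rw [smul_eq_mul]
  push_cast
  rw [← Measure.real, ← mul_assoc, ← mul_assoc, mul_inv_cancel₀ (Complex.ofReal_ne_zero.2 h2)]
  norm_num

/-- This makes the generating function a polynomial in `z`, so it is entire. -/
lemma expectedPairs_eq_zero {n : ℕ} (hn : offspringLaw μ (sizeEvent n) ≠ 0) {k : ℕ}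
    (hk : 2 * n ≤ k) : expectedPairs μ n (k + 1) = 0 := by
  have h2 : (offspringLaw μ).real (sizeEvent n) ≠ 0 := by
    simpa [Measure.real, ENNReal.toReal_eq_zero_iff] using hn
  have h := measureReal_mul_expectedPairs μ hn k
  rw [setIntegral_eq_zero_of_forall_eq_zero fun ξ hξ => by
    rw [pairCount_fam_eq_zero (by rw [(mem_sizeEvent.1 hξ).2]; omega), Nat.cast_zero], mul_zero,
    mul_eq_zero, Complex.ofReal_eq_zero, Complex.ofReal_eq_zero] at h
  exact h.resolve_left h2

/-- The generating function of the expected numbers of pairs, a polynomial. -/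
noncomputable def distPoly (n : ℕ) (z : ℂ) : ℂ :=
  ∑ k ∈ Finset.range (2 * n), (expectedPairs μ n (k + 1) : ℂ) * z ^ (k + 1)

lemma measureReal_mul_distPoly {n : ℕ} (hn : offspringLaw μ (sizeEvent n) ≠ 0) (z : ℂ) :
    (((offspringLaw μ).real (sizeEvent n) : ℝ) : ℂ) * distPoly μ n z =
      1 / 2 * ∫ ξ in sizeEvent n, pairSum z (fam ξ) ∂offspringLaw μ := by
  have h1 : ∫ ξ in sizeEvent n, pairSum z (fam ξ) ∂offspringLaw μ =
      ∫ ξ in sizeEvent n, ∑ k ∈ Finset.range (2 * n),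
        (pairCount (k + 1) (fam ξ) : ℂ) * z ^ (k + 1) ∂offspringLaw μ := by
    refine setIntegral_congr_fun (measurableSet_sizeEvent n) fun ξ hξ => ?_
    simp only [← sum_pairCount_mul_pow z ξ, (mem_sizeEvent.1 hξ).2]
  rw [h1, integral_finsetSum, distPoly, Finset.mul_sum, Finset.mul_sum]
  · refine Finset.sum_congr rfl fun k _ => ?_
    rw [integral_mul_const, ← mul_assoc, measureReal_mul_expectedPairs μ hn, mul_assoc]
  · intro k _
    refine Integrable.mul_const ?_ _
    refine Measure.integrableOn_of_bounded (M := (n : ℝ) * n) (measure_ne_top _ _)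
      (measurable_comp_fam fun τ => (pairCount (k + 1) τ : ℂ)).aestronglyMeasurable ?_
    refine (ae_restrict_iff' (measurableSet_sizeEvent n)).2 (ae_of_all _ fun ξ hξ => ?_)
    rw [Complex.norm_natCast]
    have := pairCount_le (k + 1) (fam ξ)
    rw [(mem_sizeEvent.1 hξ).2] at this
    exact_mod_cast this

lemma hasSum_distPoly {n : ℕ} (hn : offspringLaw μ (sizeEvent n) ≠ 0) (z : ℂ) :
    HasSum (fun k : ℕ => (expectedPairs μ n (k + 1) : ℂ) * z ^ (k + 1)) (distPoly μ n z) := by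
  refine hasSum_sum_of_ne_finset_zero fun k hk => ?_
  rw [expectedPairs_eq_zero μ hn (by simpa using hk)]
  simp

/-- The bivariate generating function. -/
lemma hasSum_distPoly_mul_pow (hp : CriticalOffspring fun m => μ.real {m}) {x z : ℂ}
    (hx : ‖x‖ ≤ 1 / 16) (hz : ‖z‖ ≤ 2) :
    HasSum (fun n => ((((offspringLaw μ).real (sizeEvent n) : ℝ) : ℂ) * distPoly μ n z) * x ^ n)
      (treeH (fun m => μ.real {m}) (fun n => (offspringLaw μ).real (sizeEvent n)) z x) := by
  have h := (hasSum_integral_sizeEvent _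
    ((bddMeas_sizeWeight_mul_pairSum hx hz).integrable (offspringLaw μ))
    fun ξ h => by rw [h, sizeWeight, if_pos rfl, zero_mul]).mul_left (1 / 2 : ℂ)
  rw [integral_pairSum hp hx hz, ← mul_assoc, one_div_mul_cancel two_ne_zero, one_mul] at h
  refine h.congr_fun fun n => ?_
  rw [setIntegral_sizeWeight_mul]
  by_cases hn : offspringLaw μ (sizeEvent n) = 0
  · rw [Measure.restrict_eq_zero.2 hn, Measure.real, hn]; simp
  · rw [measureReal_mul_distPoly μ hn]; ring

end GaltonWatson

/-! ### Comparison of the upper and lower coefficient bounds -/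

open GaltonWatson in
theorem theorem1p3 (μ : Measure ℕ) [IsProbabilityMeasure μ]
    (hmean : ∫ k, (k : ℝ) ∂μ = 1)
    (hsq : MemLp (fun k : ℕ => (k : ℝ)) 2 μ)
    (hvar : 0 < variance (fun k : ℕ => (k : ℝ)) μ) :
    ∃ C β δ : ℝ, 0 < C ∧ 0 < β ∧ β < Real.pi / 2 ∧ 0 < δ ∧
      ∀ n : ℕ, 1 ≤ n → offspringLaw μ (sizeEvent n) ≠ 0 →
        ∃ f : ℂ → ℂ,
          (∀ z : ℂ, ‖z‖ < 1 →
            HasSum (fun k : ℕ => (expectedPairs μ n (k + 1) : ℂ) * z ^ (k + 1)) (f z)) ∧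
          AnalyticOnNhd ℂ f (deltaDomain β δ) ∧
          ∀ z ∈ deltaDomain β δ, ‖f z‖ ≤ C * n * (‖1 - z‖ ^ 2)⁻¹ := by
  have hp := criticalOffspring μ hmean hsq hvar
  have hq := isTreeSeries μ
  obtain ⟨d, hd⟩ := hp.exists_isSpan
  obtain ⟨κ, K, hκ, hκ1, hK, hH⟩ := hq.exists_treeH_bound hp hd
  obtain ⟨β, δ, hβ, hβ2, hδ, hΔ⟩ := exists_deltaDomain hκ hκ1
  obtain ⟨C, hC, hcoeff⟩ := exists_coeff_bound hd.pos
  obtain ⟨c, hc, hlow⟩ := hq.exists_coeff_ge hp hd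
  refine ⟨C * K / c, β, δ, by positivity, hβ, hβ2, hδ, fun n hn hn0 =>
    ⟨distPoly μ n, fun z _ => hasSum_distPoly μ hn0 z, ?_, fun z hz => ?_⟩⟩
  · intro z _
    have : Differentiable ℂ (distPoly μ n) := by unfold distPoly; fun_prop
    exact this.analyticAt z
  · obtain ⟨hz1, hz2, hzκ⟩ := hΔ z hz
    obtain ⟨hdiff, hder⟩ := hH z hz1 hz2 hzκ
    obtain ⟨N, rfl⟩ : ∃ N, n = N + 1 := ⟨n - 1, by omega⟩
    set M : ℝ := ((N + 1 : ℕ) : ℝ) with hM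
    have hM0 : 0 < M := by rw [hM]; positivity
    -- Here `z` is fixed and the functions of `x` vary. The constant `C` of `exists_coeff_bound`
    -- depends on `d` only, so the dependence on `z` is exactly `|1 - z|^(-2)`.
    have h1 := hcoeff _ (fun n => (((offspringLaw μ).real (sizeEvent n) : ℝ) : ℂ) * distPoly μ n z)
      (K * (‖1 - z‖ ^ 2)⁻¹) (by positivity) hdiff hder
      ⟨1 / 16, by norm_num, fun x hx => hasSum_distPoly_mul_pow μ hp hx.le hz2.le⟩ N
    have hqn : (offspringLaw μ).real (sizeEvent (N + 1)) ≠ 0 := by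
      simpa [Measure.real, ENNReal.toReal_eq_zero_iff] using hn0
    have h2 := hlow (N + 1) hn hqn
    rw [norm_mul, Complex.norm_real, Real.norm_of_nonneg measureReal_nonneg] at h1
    set w := ‖distPoly μ (N + 1) z‖
    set q := (offspringLaw μ).real (sizeEvent (N + 1))
    have h3 : c * w ≤ C * K * M * (‖1 - z‖ ^ 2)⁻¹ := by
      calc c * w ≤ (M ^ (3 / 2 : ℝ) * q) * w := by gcongr
        _ = M ^ (3 / 2 : ℝ) * (q * w) := by ring
        _ ≤ M ^ (3 / 2 : ℝ) * (C * (K * (‖1 - z‖ ^ 2)⁻¹) * M ^ (-(1 / 2) : ℝ)) := by gcongr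
        _ = C * K * (M ^ (3 / 2 : ℝ) * M ^ (-(1 / 2) : ℝ)) * (‖1 - z‖ ^ 2)⁻¹ := by ring
        -- The exponents `3/2` and `-1/2` combine to the single factor `n`.
        _ = _ := by rw [← Real.rpow_add hM0]; norm_num
    calc w = c * w / c := by field_simp
      _ ≤ C * K * M * (‖1 - z‖ ^ 2)⁻¹ / c := by gcongr
      _ = _ := by ring
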